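/- Let $G=(V,E)$ be a finite simple undirected graph with $n=|V|\ge 2$ vertices and $m=|E|$ edges whose vertices are distinct points of a metric space $(M,d_M)$; an edge $uv$ has weight $d_M(u,v)$. Let $d_G(u,v)\in[0,\infty]$ be the infimum of the total weights of the walks from $u$ to $v$ in $G$ ($\infty$ if there is none); the dilation of $G$ is the smallest $t\in[0,\infty]$ with $d_G(u,v)\le t\cdot d_M(u,v)$ for all $u,v\in V$ (so it is $\infty$ if $G$ is disconnected). For an integer $k$ with $1\le k\le n^2$ let $$t^*=\min\{\text{dilation of }(V,E\cup S)\;:\;S\subseteq V\times V,\ |S|=k\},$$ where the pairs in $S$ are regarded as undirected edges. The model of computation is a real RAM: a program has registers and arrays for natural numbers and for real numbers, with indirect addressing; its constants are natural numbers; unit-cost operations are addition, truncated subtraction, halving and comparison of natural numbers, conversion of natural numbers to reals, the four field operations and comparison of reals, and Boolean connectives of tests (no rounding, logarithms or roots). The input consists of $n$, $m$, $k$, a list of the $m$ edges and the $n\times n$ matrix of the distances $d_M(u,v)$. **Theorem.** For every fixed $\varepsilon>0$ there are a real RAM program and a constant $C$ (depending only on $\varepsilon$) such that, on every input as above, the program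 halts after at most $C\,(m+n\log n+kn)\cdot n\log n$ steps and outputs a value $t\in[0,\infty]$ with $$t^*\;\le\;t\;\le\;(1+\varepsilon)(k+1)\,t^*.$$ In particular, it outputs $\infty$ if and only if $t^*=\infty$. -/

import Mathlib

open scoped ENNReal

namespace RealRAM

/-!
A real RAM with unit-cost operations. Memory consists of natural-number registers and arrays
and of real registers and arrays; register and array names are natural numbers, and a program,
being a finite syntax tree, mentions finitely many of them. Array indices are computed natural
numbers (indirect addressing). On natural numbers there are addition, truncated subtraction and
halving, but no multiplication; on reals there are the four field operations and comparisons,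
but no rounding, no logarithms or roots, and no conversion from reals to natural numbers.
The only constants of a program are natural numbers.
-/

/-- The contents of the memory. -/
structure State where
  nvar : ℕ → ℕ
  rvar : ℕ → ℝ
  narr : ℕ → ℕ → ℕ
  rarr : ℕ → ℕ → ℝ

/-- Natural-number expressions. -/
inductive NExp where
  | const (c : ℕ)
  | var (x : ℕ)
  | get (a : ℕ) (i : NExp)
  | add (e f : NExp)
  | sub (e f : NExp)
  | half (e : NExp)

/-- Real expressions. -/
inductive RExp where
  | cast (e : NExp)
  | var (x : ℕ)
  | get (a : ℕ) (i : NExp)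
  | add (e f : RExp)
  | sub (e f : RExp)
  | mul (e f : RExp)
  | div (e f : RExp)

/-- Boolean tests. -/
inductive BExp where
  | nlt (e f : NExp)
  | neq (e f : NExp)
  | rlt (e f : RExp)
  | req (e f : RExp)
  | not (b : BExp)
  | and (b c : BExp)
  | or (b c : BExp)

/-- Programs. -/
inductive Cmd where
  | skip
  | nset (x : ℕ) (e : NExp)
  | rset (x : ℕ) (e : RExp)
  | nput (a : ℕ) (i : NExp) (e : NExp)
  | rput (a : ℕ) (i : NExp) (e : RExp)
  | seq (c d : Cmd)
  | cond (b : BExp) (c d : Cmd)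
  | loop (b : BExp) (c : Cmd)

namespace NExp

def eval (s : State) : NExp → ℕ
  | const c => c
  | var x => s.nvar x
  | get a i => s.narr a (i.eval s)
  | add e f => e.eval s + f.eval s
  | sub e f => e.eval s - f.eval s
  | half e => e.eval s / 2

/-- Number of elementary operations of an expression: every node costs one. -/
def cost : NExp → ℕ
  | const _ => 1
  | var _ => 1
  | get _ i => i.cost + 1
  | add e f => e.cost + f.cost + 1
  | sub e f => e.cost + f.cost + 1
  | half e => e.cost + 1

end NExp

namespace RExp

noncomputable def eval (s : State) : RExp → ℝ
  | cast e => (e.eval s : ℝ)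
  | var x => s.rvar x
  | get a i => s.rarr a (i.eval s)
  | add e f => e.eval s + f.eval s
  | sub e f => e.eval s - f.eval s
  | mul e f => e.eval s * f.eval s
  | div e f => e.eval s / f.eval s

def cost : RExp → ℕ
  | cast e => e.cost + 1
  | var _ => 1
  | get _ i => i.cost + 1
  | add e f => e.cost + f.cost + 1
  | sub e f => e.cost + f.cost + 1
  | mul e f => e.cost + f.cost + 1
  | div e f => e.cost + f.cost + 1

end RExp

namespace BExp

def Holds (s : State) : BExp → Prop
  | nlt e f => e.eval s < f.eval s
  | neq e f => e.eval s = f.eval s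
  | rlt e f => e.eval s < f.eval s
  | req e f => e.eval s = f.eval s
  | not b => ¬ b.Holds s
  | and b c => b.Holds s ∧ c.Holds s
  | or b c => b.Holds s ∨ c.Holds s

def cost : BExp → ℕ
  | nlt e f => e.cost + f.cost + 1
  | neq e f => e.cost + f.cost + 1
  | rlt e f => e.cost + f.cost + 1
  | req e f => e.cost + f.cost + 1
  | not b => b.cost + 1
  | and b c => b.cost + c.cost + 1
  | or b c => b.cost + c.cost + 1

end BExp

namespace State

def setN (s : State) (x v : ℕ) : State :=
  { s with nvar := Function.update s.nvar x v }

def setR (s : State) (x : ℕ) (v : ℝ) : State :=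
  { s with rvar := Function.update s.rvar x v }

def putN (s : State) (a i v : ℕ) : State :=
  { s with narr := Function.update s.narr a (Function.update (s.narr a) i v) }

def putR (s : State) (a i : ℕ) (v : ℝ) : State :=
  { s with rarr := Function.update s.rarr a (Function.update (s.rarr a) i v) }

end State

/-- `Exec c s T s'`: the program `c`, started in the state `s`, halts after exactly `T`
elementary steps in the state `s'`. -/
inductive Exec : Cmd → State → ℕ → State → Prop
  | skip (s : State) : Exec Cmd.skip s 1 s
  | nset (x : ℕ) (e : NExp) (s : State) :
      Exec (Cmd.nset x e) s (e.cost + 1) (s.setN x (e.eval s))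
  | rset (x : ℕ) (e : RExp) (s : State) :
      Exec (Cmd.rset x e) s (e.cost + 1) (s.setR x (e.eval s))
  | nput (a : ℕ) (i e : NExp) (s : State) :
      Exec (Cmd.nput a i e) s (i.cost + e.cost + 1) (s.putN a (i.eval s) (e.eval s))
  | rput (a : ℕ) (i : NExp) (e : RExp) (s : State) :
      Exec (Cmd.rput a i e) s (i.cost + e.cost + 1) (s.putR a (i.eval s) (e.eval s))
  | seq {c d : Cmd} {s s' s'' : State} {T T' : ℕ} :
      Exec c s T s' → Exec d s' T' s'' → Exec (Cmd.seq c d) s (T + T') s''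
  | condTrue {b : BExp} {c d : Cmd} {s s' : State} {T : ℕ} :
      b.Holds s → Exec c s T s' → Exec (Cmd.cond b c d) s (b.cost + 1 + T) s'
  | condFalse {b : BExp} {c d : Cmd} {s s' : State} {T : ℕ} :
      ¬ b.Holds s → Exec d s T s' → Exec (Cmd.cond b c d) s (b.cost + 1 + T) s'
  | loopTrue {b : BExp} {c : Cmd} {s s' s'' : State} {T T' : ℕ} :
      b.Holds s → Exec c s T s' → Exec (Cmd.loop b c) s' T' s'' →
        Exec (Cmd.loop b c) s (b.cost + 1 + T + T') s''
  | loopFalse {b : BExp} {c : Cmd} {s : State} :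
      ¬ b.Holds s → Exec (Cmd.loop b c) s (b.cost + 1) s

end RealRAM

namespace Dilation

variable {n : ℕ} {M : Type*} [MetricSpace M]

/-- The total weight of a walk in a graph whose vertices are placed at the points `p` of a
metric space; an edge weighs the distance of its endpoints. -/
noncomputable def walkLength (p : Fin n → M) {G : SimpleGraph (Fin n)} {u v : Fin n}
    (w : G.Walk u v) : ℝ≥0∞ :=
  (w.darts.map fun a => edist (p a.fst) (p a.snd)).sum

/-- Shortest-path distance in the graph; it is `∞` if there is no path. -/
noncomputable def graphDist (p : Fin n → M) (G : SimpleGraph (Fin n)) (u v : Fin n) : ℝ≥0∞ :=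
  ⨅ w : G.Walk u v, walkLength p w

def IsSpanner (p : Fin n → M) (G : SimpleGraph (Fin n)) (t : ℝ≥0∞) : Prop :=
  ∀ u v, graphDist p G u v ≤ t * edist (p u) (p v)

/-- The smallest `t` for which the graph is a `t`-spanner (`∞` for a disconnected graph). -/
noncomputable def dilation (p : Fin n → M) (G : SimpleGraph (Fin n)) : ℝ≥0∞ :=
  sInf {t | IsSpanner p G t}

/-- The graph `(V, E ∪ S)`, with the pairs in `S` regarded as undirected edges. -/
def addEdges (G : SimpleGraph (Fin n)) (S : Finset (Fin n × Fin n)) : SimpleGraph (Fin n) :=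
  G ⊔ SimpleGraph.fromRel fun u v => (u, v) ∈ S

/-- The minimum dilation of `(V, E ∪ S)` over all `S ⊆ V × V` with `|S| = k`. -/
noncomputable def minDilation (p : Fin n → M) (G : SimpleGraph (Fin n)) (k : ℕ) : ℝ≥0∞ :=
  ⨅ (S : Finset (Fin n × Fin n)) (_ : S.card = k), dilation p (addEdges G S)

/-- The sequence `e` lists every edge of `G` exactly once, in any order and orientation. -/
def ListsEdges {m : ℕ} (G : SimpleGraph (Fin n)) (e : Fin m → Fin n × Fin n) : Prop :=
  Function.Injective (fun i => s((e i).1, (e i).2)) ∧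
    Set.range (fun i => s((e i).1, (e i).2)) = G.edgeSet

/-- The memory `s` holds the input: the numbers `n`, `m`, `k` in registers, the endpoints of the
`m` edges in two arrays, and the matrix of the pairwise distances of the vertices, row by row,
in a real array. The rest of the memory is arbitrary. -/
structure HoldsInput (p : Fin n → M) {m : ℕ} (e : Fin m → Fin n × Fin n) (k : ℕ)
    (s : RealRAM.State) : Prop where
  vertices : s.nvar 0 = n
  edges : s.nvar 1 = m
  budget : s.nvar 2 = k
  tail : ∀ i : Fin m, s.narr 0 i = (e i).1
  head : ∀ i : Fin m, s.narr 1 i = (e i).2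
  distances : ∀ u v : Fin n, s.rarr 0 (u * n + v) = dist (p u) (p v)

/-- The output is `∞` if the natural register `0` contains `0`, and otherwise it is the number in
the real register `0`. -/
noncomputable def output (s : RealRAM.State) : ℝ≥0∞ :=
  if s.nvar 0 = 0 then ∞ else ENNReal.ofReal (s.rvar 0)

end Dilation

/-! The algorithm rests on a greedy test for a threshold `T`: run through the pairs in order of
increasing distance and insert a pair as an edge whenever its current graph distance exceeds `T`
times its distance. If at most `k` edges are inserted, the result is a `T`-spanner, so $t^* \le T$.
The heart of the proof is that a run needing `k + 1` edges forces $T < (k+1)t^*$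
(`no_greedy_sequence`, `GreedyChain.lt_minDilation`).

Suppose that $T = (k+1)t$ and that some $S$ with at most $k$ pairs gives dilation at most $t$. Each
greedy edge $e_i$ is spanned by a walk $\delta_i$ in $G \cup S$ of length at most $t|e_i|$. The
parities with which the $k+1$ walks use the edges outside $G$ are vectors in a space of dimension at
most $k$ over the field with two elements, so they sum to zero over a nonempty index set $I$. Let
$e_j$ be the last inserted edge with index in $I$. Modulo two the edges outside $G$ cancel, so the
$G$-parts of the $\delta_i$, $i \in I$, together with the $e_i$, $i \in I \setminus \{j\}$, connect
the endpoints of $e_j$ in the graph in which $e_j$ violated the threshold. Hence their total weight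
exceeds $T|e_j|$. Bounding the $G$-parts by $t|e_i|$ only gives $(k+1)t + k$, which is too much; but
a walk $\delta_i$ with a short $G$-complement would, with its outside edges replaced by greedy
paths, contradict the violation at $e_i$. So it runs at least $\frac{T-t}{T-1}|e_i|$ outside $G$
(`mul_dist_le_outsideLength`), and this saving suffices.

A good threshold must be found without logarithms or roots. A worst pair and the longest edge on its
shortest path show that $t^*$ is a ratio of two distances up to a factor $n$
(`exists_ratio_minDilation`). Up to a factor two, all distances are represented by at most $n$
scales, because a sequence of distances that more than doubles at each step contains no cycle
(`length_le_of_doubling`). This leaves at most $n^2$ candidates. A binary search with $O(\log n)$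
tests finds a threshold within a factor $O(kn)$ of $t^*$, and lowering it by factors $q/(q+1)$, with
$1/q \le \varepsilon$, takes $O(q \log n)$ further tests. Each outcome of a test is a certificate by
itself, so no monotonicity of the test is needed.

The distances in $G$ are computed once by Dijkstra's algorithm for all sources in a common queue, in
$O(n(m+n)\log n)$ steps. A test maintains the distance matrix in $O(n^2)$ steps per inserted edge
and so costs $O(kn^2)$. -/

namespace RealRAM

/-! ### A calculus of correctness and running time for the machine -/

namespace State

@[simp] theorem setN_nvar (s : State) (x v y : ℕ) :
    (s.setN x v).nvar y = if y = x then v else s.nvar y := Function.update_apply ..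
@[simp] theorem setN_rvar (s : State) (x v : ℕ) : (s.setN x v).rvar = s.rvar := rfl
@[simp] theorem setN_narr (s : State) (x v : ℕ) : (s.setN x v).narr = s.narr := rfl
@[simp] theorem setN_rarr (s : State) (x v : ℕ) : (s.setN x v).rarr = s.rarr := rfl

@[simp] theorem setR_nvar (s : State) (x : ℕ) (v : ℝ) : (s.setR x v).nvar = s.nvar := rfl
@[simp] theorem setR_rvar (s : State) (x : ℕ) (v : ℝ) (y : ℕ) :
    (s.setR x v).rvar y = if y = x then v else s.rvar y := Function.update_apply ..
@[simp] theorem setR_narr (s : State) (x : ℕ) (v : ℝ) : (s.setR x v).narr = s.narr := rfl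
@[simp] theorem setR_rarr (s : State) (x : ℕ) (v : ℝ) : (s.setR x v).rarr = s.rarr := rfl

@[simp] theorem putN_nvar (s : State) (a i v : ℕ) : (s.putN a i v).nvar = s.nvar := rfl
@[simp] theorem putN_rvar (s : State) (a i v : ℕ) : (s.putN a i v).rvar = s.rvar := rfl
@[simp] theorem putN_narr (s : State) (a i v b : ℕ) :
    (s.putN a i v).narr b = if b = a then Function.update (s.narr a) i v else s.narr b :=
  Function.update_apply ..
@[simp] theorem putN_rarr (s : State) (a i v : ℕ) : (s.putN a i v).rarr = s.rarr := rfl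

@[simp] theorem putR_nvar (s : State) (a i : ℕ) (v : ℝ) : (s.putR a i v).nvar = s.nvar := rfl
@[simp] theorem putR_rvar (s : State) (a i : ℕ) (v : ℝ) : (s.putR a i v).rvar = s.rvar := rfl
@[simp] theorem putR_narr (s : State) (a i : ℕ) (v : ℝ) : (s.putR a i v).narr = s.narr := rfl
@[simp] theorem putR_rarr (s : State) (a i : ℕ) (v : ℝ) (b : ℕ) :
    (s.putR a i v).rarr b = if b = a then Function.update (s.rarr a) i v else s.rarr b :=
  Function.update_apply ..

end State

attribute [simp] NExp.eval RExp.eval BExp.Holds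

namespace Cmd

/-- Whether the program contains an assignment to the natural register `x`. -/
def writesN : Cmd → ℕ → Bool
  | nset y _, x => y == x
  | seq c d, x => c.writesN x || d.writesN x
  | cond _ c d, x => c.writesN x || d.writesN x
  | loop _ c, x => c.writesN x
  | _, _ => false

/-- Whether the program contains an assignment to the real register `x`. -/
def writesR : Cmd → ℕ → Bool
  | rset y _, x => y == x
  | seq c d, x => c.writesR x || d.writesR x
  | cond _ c d, x => c.writesR x || d.writesR x
  | loop _ c, x => c.writesR x
  | _, _ => false

/-- Whether the program contains an assignment to a cell of the natural array `x`. -/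
def writesNA : Cmd → ℕ → Bool
  | nput y _ _, x => y == x
  | seq c d, x => c.writesNA x || d.writesNA x
  | cond _ c d, x => c.writesNA x || d.writesNA x
  | loop _ c, x => c.writesNA x
  | _, _ => false

/-- Whether the program contains an assignment to a cell of the real array `x`. -/
def writesRA : Cmd → ℕ → Bool
  | rput y _ _, x => y == x
  | seq c d, x => c.writesRA x || d.writesRA x
  | cond _ c d, x => c.writesRA x || d.writesRA x
  | loop _ c, x => c.writesRA x
  | _, _ => false

end Cmd

/-- The states `s` and `s'` agree on all memory that the program `c` does not write. -/
structure Agree (c : Cmd) (s s' : State) : Prop where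
  nvar : ∀ x, c.writesN x = false → s'.nvar x = s.nvar x
  rvar : ∀ x, c.writesR x = false → s'.rvar x = s.rvar x
  narr : ∀ x, c.writesNA x = false → s'.narr x = s.narr x
  rarr : ∀ x, c.writesRA x = false → s'.rarr x = s.rarr x

theorem Agree.refl (c : Cmd) (s : State) : Agree c s s :=
  ⟨fun _ _ => rfl, fun _ _ => rfl, fun _ _ => rfl, fun _ _ => rfl⟩

theorem Agree.trans {c : Cmd} {s s' s'' : State} (h : Agree c s s') (h' : Agree c s' s'') :
    Agree c s s'' :=
  ⟨fun x hx => (h'.nvar x hx).trans (h.nvar x hx), fun x hx => (h'.rvar x hx).trans (h.rvar x hx),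
    fun x hx => (h'.narr x hx).trans (h.narr x hx), fun x hx => (h'.rarr x hx).trans (h.rarr x hx)⟩

theorem Agree.mono {c d : Cmd} {s s' : State} (h : Agree c s s')
    (hn : ∀ x, d.writesN x = false → c.writesN x = false)
    (hr : ∀ x, d.writesR x = false → c.writesR x = false)
    (hna : ∀ x, d.writesNA x = false → c.writesNA x = false)
    (hra : ∀ x, d.writesRA x = false → c.writesRA x = false) : Agree d s s' :=
  ⟨fun x hx => h.nvar x (hn x hx), fun x hx => h.rvar x (hr x hx),
    fun x hx => h.narr x (hna x hx), fun x hx => h.rarr x (hra x hx)⟩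

/-- The frame rule. Register and array names are fixed in the syntax, so what a program leaves alone
is decided by computation, and invariants need only mention what changes. -/
theorem Exec.agree {c : Cmd} {s s' : State} {T : ℕ} (h : Exec c s T s') : Agree c s s' := by
  induction h with
  | skip s => exact Agree.refl _ _
  | nset x e s =>
    refine ⟨fun y hy => ?_, fun _ _ => rfl, fun _ _ => rfl, fun _ _ => rfl⟩
    have : y ≠ x := by rintro rfl; simp [Cmd.writesN] at hy
    simp [this]
  | rset x e s =>
    refine ⟨fun _ _ => rfl, fun y hy => ?_, fun _ _ => rfl, fun _ _ => rfl⟩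
    have : y ≠ x := by rintro rfl; simp [Cmd.writesR] at hy
    simp [this]
  | nput a i e s =>
    refine ⟨fun _ _ => rfl, fun _ _ => rfl, fun y hy => ?_, fun _ _ => rfl⟩
    have : y ≠ a := by rintro rfl; simp [Cmd.writesNA] at hy
    simp [this]
  | rput a i e s =>
    refine ⟨fun _ _ => rfl, fun _ _ => rfl, fun _ _ => rfl, fun y hy => ?_⟩
    have : y ≠ a := by rintro rfl; simp [Cmd.writesRA] at hy
    simp [this]
  | seq _ _ ih ih' =>
    refine (ih.mono ?_ ?_ ?_ ?_).trans (ih'.mono ?_ ?_ ?_ ?_) <;> intro x hx <;>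
      simp_all [Cmd.writesN, Cmd.writesR, Cmd.writesNA, Cmd.writesRA]
  | condTrue _ _ ih =>
    refine ih.mono ?_ ?_ ?_ ?_ <;> intro x hx <;>
      simp_all [Cmd.writesN, Cmd.writesR, Cmd.writesNA, Cmd.writesRA]
  | condFalse _ _ ih =>
    refine ih.mono ?_ ?_ ?_ ?_ <;> intro x hx <;>
      simp_all [Cmd.writesN, Cmd.writesR, Cmd.writesNA, Cmd.writesRA]
  | loopTrue _ _ _ ih ih' =>
    exact Agree.trans (ih.mono (fun _ => id) (fun _ => id) (fun _ => id) (fun _ => id)) ih'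
  | loopFalse _ => exact Agree.refl _ _

/-- Started in `s`, the program `c` halts after at most `B` steps in a state satisfying `Q`. -/
def Runs (c : Cmd) (s : State) (B : ℕ) (Q : State → Prop) : Prop :=
  ∃ (T : ℕ) (s' : State), Exec c s T s' ∧ T ≤ B ∧ Q s'

theorem Runs.mono {c : Cmd} {s : State} {B B' : ℕ} {Q Q' : State → Prop} (h : Runs c s B Q)
    (hB : B ≤ B') (hQ : ∀ s', Agree c s s' → Q s' → Q' s') : Runs c s B' Q' := by
  obtain ⟨T, s', he, hT, hq⟩ := h
  exact ⟨T, s', he, hT.trans hB, hQ s' he.agree hq⟩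

theorem Runs.skip {s : State} {B : ℕ} {Q : State → Prop} (hB : 1 ≤ B) (hQ : Q s) :
    Runs Cmd.skip s B Q := ⟨_, _, Exec.skip s, hB, hQ⟩

theorem Runs.seq {c d : Cmd} {s : State} {P Q : State → Prop} {B B₁ B₂ : ℕ}
    (hc : Runs c s B₁ P) (hd : ∀ s', Agree c s s' → P s' → Runs d s' B₂ Q) (hB : B₁ + B₂ ≤ B) :
    Runs (Cmd.seq c d) s B Q := by
  obtain ⟨T, s', he, hT, hp⟩ := hc
  obtain ⟨T', s'', he', hT', hq⟩ := hd s' he.agree hp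
  exact ⟨T + T', s'', Exec.seq he he', by omega, hq⟩

theorem Runs.cond {b : BExp} {c d : Cmd} {s : State} {Q : State → Prop} {B B' : ℕ}
    (hc : b.Holds s → Runs c s B Q) (hd : ¬ b.Holds s → Runs d s B Q)
    (hB : b.cost + 1 + B ≤ B') : Runs (Cmd.cond b c d) s B' Q := by
  by_cases h : b.Holds s
  · obtain ⟨T, s', he, hT, hq⟩ := hc h
    exact ⟨_, s', Exec.condTrue h he, by omega, hq⟩
  · obtain ⟨T, s', he, hT, hq⟩ := hd h
    exact ⟨_, s', Exec.condFalse h he, by omega, hq⟩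

/-- A loop whose body decreases a potential by at least its running time. In `I f s` the number
`f` is the potential. -/
theorem Runs.loop_of_potential {b : BExp} {c : Cmd} {s₀ : State} (I : ℕ → State → Prop) {f₀ : ℕ}
    (h₀ : I f₀ s₀)
    (step : ∀ f s, Agree c s₀ s → I f s → b.Holds s →
      ∃ B, Runs c s B fun s' => ∃ f', I f' s' ∧ f' + B + b.cost + 1 ≤ f) :
    Runs (Cmd.loop b c) s₀ (f₀ + b.cost + 1) fun s' => (∃ f, I f s') ∧ ¬ b.Holds s' := by
  suffices H : ∀ (f : ℕ) (s : State), Agree c s₀ s → I f s →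
      Runs (Cmd.loop b c) s (f + b.cost + 1) fun s' => (∃ f, I f s') ∧ ¬ b.Holds s' from
    H _ s₀ (Agree.refl _ _) h₀
  intro f
  induction f using Nat.strong_induction_on with
  | _ f ih =>
    intro s ha hi
    by_cases hb : b.Holds s
    · obtain ⟨B, T, s', he, hT, f', hi', hf'⟩ := step f s ha hi hb
      obtain ⟨T', s'', he', hT', hq⟩ := ih f' (by omega) s' (ha.trans he.agree) hi'
      exact ⟨_, s'', Exec.loopTrue hb he he', by omega, hq⟩
    · exact ⟨_, s, Exec.loopFalse hb, by omega, ⟨f, hi⟩, hb⟩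

theorem Runs.loop {b : BExp} {c : Cmd} {s₀ : State} (I : State → Prop) (Φ : State → ℕ)
    (h₀ : I s₀)
    (step : ∀ s, Agree c s₀ s → I s → b.Holds s →
      ∃ B, Runs c s B fun s' => I s' ∧ Φ s' + B + b.cost + 1 ≤ Φ s) :
    Runs (Cmd.loop b c) s₀ (Φ s₀ + b.cost + 1) fun s' => I s' ∧ ¬ b.Holds s' := by
  refine (Runs.loop_of_potential (fun f s => I s ∧ f = Φ s) ⟨h₀, rfl⟩ ?_).mono le_rfl ?_
  · rintro f s ha ⟨hi, rfl⟩ hb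
    obtain ⟨B, hB⟩ := step s ha hi hb
    exact ⟨B, hB.mono le_rfl fun s' _ h => ⟨_, ⟨h.1, rfl⟩, h.2⟩⟩
  · rintro s' - ⟨⟨f, hi, -⟩, hb⟩
    exact ⟨hi, hb⟩

namespace Cmd

/-- The loop `for x := 0, …, b - 1 do c`. -/
def forUp (x : ℕ) (b : NExp) (c : Cmd) : Cmd :=
  seq (nset x (NExp.const 0))
    (loop (BExp.nlt (NExp.var x) b) (seq c (nset x (NExp.add (NExp.var x) (NExp.const 1)))))

def loopFree : Cmd → Bool
  | seq c d => c.loopFree && d.loopFree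
  | cond _ c d => c.loopFree && d.loopFree
  | loop _ _ => false
  | _ => true

/-- An upper bound for the running time of a loop-free program. -/
def maxCost : Cmd → ℕ
  | skip => 1
  | nset _ e => e.cost + 1
  | rset _ e => e.cost + 1
  | nput _ i e => i.cost + e.cost + 1
  | rput _ i e => i.cost + e.cost + 1
  | seq c d => c.maxCost + d.maxCost
  | cond b c d => b.cost + 1 + max c.maxCost d.maxCost
  | loop _ _ => 0

open scoped Classical in
/-- The effect of a loop-free program. -/
noncomputable def run : Cmd → State → State
  | skip, s => s
  | nset x e, s => s.setN x (e.eval s)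
  | rset x e, s => s.setR x (e.eval s)
  | nput a i e, s => s.putN a (i.eval s) (e.eval s)
  | rput a i e, s => s.putR a (i.eval s) (e.eval s)
  | seq c d, s => d.run (c.run s)
  | cond b c d, s => if b.Holds s then c.run s else d.run s
  | loop _ _, s => s

end Cmd

theorem Cmd.run_cond_pos {b : BExp} {c d : Cmd} {s : State} (h : b.Holds s) :
    (Cmd.cond b c d).run s = c.run s := by simp [Cmd.run, h]

theorem Cmd.run_cond_neg {b : BExp} {c d : Cmd} {s : State} (h : ¬ b.Holds s) :
    (Cmd.cond b c d).run s = d.run s := by simp [Cmd.run, h]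

theorem Runs.of_loopFree {c : Cmd} (h : c.loopFree = true) (s : State) :
    Runs c s c.maxCost fun s' => s' = c.run s := by
  induction c generalizing s with
  | skip => exact ⟨_, _, Exec.skip s, le_rfl, rfl⟩
  | nset x e => exact ⟨_, _, Exec.nset x e s, le_rfl, rfl⟩
  | rset x e => exact ⟨_, _, Exec.rset x e s, le_rfl, rfl⟩
  | nput a i e => exact ⟨_, _, Exec.nput a i e s, le_rfl, rfl⟩
  | rput a i e => exact ⟨_, _, Exec.rput a i e s, le_rfl, rfl⟩
  | seq c d ihc ihd =>
    simp only [Cmd.loopFree, Bool.and_eq_true] at h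
    refine Runs.seq (ihc h.1 s) (fun s' _ hs' => ?_) le_rfl
    subst hs'
    exact ihd h.2 _
  | cond b c d ihc ihd =>
    simp only [Cmd.loopFree, Bool.and_eq_true] at h
    refine Runs.cond (fun hb => ?_) (fun hb => ?_) le_rfl
    · exact (ihc h.1 s).mono (le_max_left _ _) (fun s' _ hs' => by simp [Cmd.run, hb, hs'])
    · exact (ihd h.2 s).mono (le_max_right _ _) (fun s' _ hs' => by simp [Cmd.run, hb, hs'])
  | loop b c => simp [Cmd.loopFree] at h

/-- Loop-free blocks are verified by symbolic evaluation: the effect is simplified from `run`, and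
the bound on `maxCost` is a numerical computation. -/
theorem Runs.straight {c : Cmd} {s : State} {B : ℕ} {Q : State → Prop} (h : c.loopFree = true)
    (hB : c.maxCost ≤ B) (hQ : Q (c.run s)) : Runs c s B Q :=
  (Runs.of_loopFree h s).mono hB fun _ _ hs' => hs' ▸ hQ

/-- A `for` loop whose iterations take `B` steps plus the decrease of the credit `f` in
`I i f s`. -/
theorem Runs.forUp_of_credit {x : ℕ} {b : NExp} {c : Cmd} {s : State} {N B B' f₀ : ℕ}
    {Q : State → Prop}
    (I : ℕ → ℕ → State → Prop) (hx : c.writesN x = false)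
    (hb : ∀ s', Agree (Cmd.forUp x b c) s s' → b.eval s' = N)
    (h₀ : I 0 f₀ (s.setN x 0))
    (step : ∀ i f s', i < N → Agree (Cmd.forUp x b c) s s' → s'.nvar x = i → I i f s' →
      ∃ A, Runs c s' A fun s'' => ∃ f', I (i + 1) f' (s''.setN x (i + 1)) ∧ f' + A ≤ f + B)
    (hB : N * (B + b.cost + 7) + f₀ + b.cost + 5 ≤ B')
    (hQ : ∀ f s', Agree (Cmd.forUp x b c) s s' → s'.nvar x = N → I N f s' → Q s') :
    Runs (Cmd.forUp x b c) s B' Q := by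
  have hw : ∀ s', Agree (Cmd.seq c (Cmd.nset x (NExp.add (NExp.var x) (NExp.const 1))))
      (s.setN x 0) s' → Agree (Cmd.forUp x b c) s s' := by
    intro s' h
    refine (Exec.agree (Exec.nset x (NExp.const 0) s)).mono ?_ ?_ ?_ ?_ |>.trans
      (h.mono ?_ ?_ ?_ ?_) <;> intro y hy <;>
      simp_all [Cmd.forUp, Cmd.writesN, Cmd.writesR, Cmd.writesNA, Cmd.writesRA]
  have key := Runs.loop_of_potential (b := BExp.nlt (NExp.var x) b)
    (c := Cmd.seq c (Cmd.nset x (NExp.add (NExp.var x) (NExp.const 1)))) (s₀ := s.setN x 0)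
    (f₀ := N * (B + b.cost + 7) + f₀)
    -- Each remaining iteration is charged `B`, plus `4` for incrementing the counter and `b.cost +
    -- 3` for the loop test.
    (fun g s' => ∃ f, g = (N - s'.nvar x) * (B + b.cost + 7) + f ∧
      s'.nvar x ≤ N ∧ I (s'.nvar x) f s' ∧
      Agree (Cmd.seq c (Cmd.nset x (NExp.add (NExp.var x) (NExp.const 1)))) (s.setN x 0) s')
    ⟨f₀, by simp, by simp, by simpa using h₀, Agree.refl _ _⟩
    (by
      rintro g s' - ⟨f, rfl, h1, h2, h3⟩ h4
      simp only [BExp.Holds, NExp.eval, hb s' (hw s' h3)] at h4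
      obtain ⟨A, hA⟩ := step _ f s' h4 (hw s' h3) rfl h2
      refine ⟨A + 4, ?_⟩
      refine Runs.mono (Runs.seq (B := A + 4) hA (B₂ := 4)
        (Q := fun s'' => s''.nvar x = s'.nvar x + 1 ∧
          ∃ f', I (s'.nvar x + 1) f' s'' ∧ f' + A ≤ f + B)
        (fun s'' ha hs'' => ?_) le_rfl) le_rfl ?_
      · have hx' := ha.nvar x hx
        refine Runs.straight rfl (by simp [Cmd.maxCost, NExp.cost]) ?_
        simp [Cmd.run, hx']
        exact hs''
      · rintro s'' ha ⟨h5, f', h6, h7⟩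
        refine ⟨_, ⟨f', rfl, by omega, h5 ▸ h6, h3.trans ha⟩, ?_⟩
        have : N - s'.nvar x = (N - s''.nvar x) + 1 := by omega
        rw [this, add_mul, one_mul]
        simp [BExp.cost, NExp.cost]
        omega)
  refine (Runs.seq (B := B') (Runs.straight (B := 2) (Q := fun s' => s' = s.setN x 0) rfl ?_ ?_)
    (fun s' _ hs' => by subst hs'; exact key) ?_).mono le_rfl ?_
  · simp [Cmd.maxCost, NExp.cost]
  · simp [Cmd.run]
  · simp [BExp.cost, NExp.cost]
    omega
  · rintro s' ha ⟨⟨_, f, -, h1, h2, h3⟩, h4⟩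
    simp only [BExp.Holds, NExp.eval, hb s' (hw s' h3)] at h4
    have : s'.nvar x = N := by omega
    exact hQ f s' (hw s' h3) this (this ▸ h2)

theorem Runs.forUp {x : ℕ} {b : NExp} {c : Cmd} {s : State} {N B B' : ℕ} {Q : State → Prop}
    (I : ℕ → State → Prop) (hx : c.writesN x = false)
    (hb : ∀ s', Agree (Cmd.forUp x b c) s s' → b.eval s' = N)
    (h₀ : I 0 (s.setN x 0))
    (step : ∀ i s', i < N → Agree (Cmd.forUp x b c) s s' → s'.nvar x = i → I i s' →
      Runs c s' B fun s'' => I (i + 1) (s''.setN x (i + 1)))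
    (hB : N * (B + b.cost + 7) + b.cost + 5 ≤ B')
    (hQ : ∀ s', Agree (Cmd.forUp x b c) s s' → s'.nvar x = N → I N s' → Q s') :
    Runs (Cmd.forUp x b c) s B' Q :=
  Runs.forUp_of_credit (fun i f s' => f = 0 ∧ I i s') hx hb ⟨rfl, h₀⟩
    (fun i f s' hi ha hs' hI => ⟨B, (step i s' hi ha hs' hI.2).mono le_rfl
      fun s'' _ h => ⟨0, ⟨rfl, h⟩, by omega⟩⟩) hB (fun _ s' ha hs' hI => hQ s' ha hs' hI.2)

end RealRAM

/-! ### Lengths of walks and distances in graphs -/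

namespace Dilation

variable {n : ℕ} {M : Type*} [MetricSpace M]

/-- The total weight of a walk as a real number. -/
noncomputable def realLength (p : Fin n → M) {G : SimpleGraph (Fin n)} {u v : Fin n}
    (w : G.Walk u v) : ℝ :=
  (w.darts.map fun a => dist (p a.fst) (p a.snd)).sum

theorem ofReal_list_sum {l : List ℝ} (h : ∀ x ∈ l, 0 ≤ x) :
    (l.map ENNReal.ofReal).sum = ENNReal.ofReal l.sum := by
  induction l with
  | nil => simp
  | cons a l ih =>
    simp only [List.mem_cons, forall_eq_or_imp] at h
    rw [List.map_cons, List.sum_cons, List.sum_cons, ih h.2,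
      ENNReal.ofReal_add h.1 (List.sum_nonneg h.2)]

theorem walkLength_eq (p : Fin n → M) {G : SimpleGraph (Fin n)} {u v : Fin n}
    (w : G.Walk u v) : walkLength p w = ENNReal.ofReal (realLength p w) := by
  rw [realLength, ← ofReal_list_sum (by simp +contextual)]
  simp [walkLength, edist_dist, Function.comp_def]

theorem realLength_nonneg (p : Fin n → M) {G : SimpleGraph (Fin n)} {u v : Fin n}
    (w : G.Walk u v) : 0 ≤ realLength p w :=
  List.sum_nonneg (by simp +contextual)

theorem graphDist_le_realLength (p : Fin n → M) {G : SimpleGraph (Fin n)} {u v : Fin n}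
    (w : G.Walk u v) : graphDist p G u v ≤ ENNReal.ofReal (realLength p w) :=
  (iInf_le _ w).trans_eq (walkLength_eq p w)

/-- There are finitely many paths, and shortcutting a walk to a path deletes darts of nonnegative
weight, so the infimum is attained on a path. -/
theorem exists_isPath_graphDist_eq (p : Fin n → M) {G : SimpleGraph (Fin n)} {u v : Fin n}
    (h : graphDist p G u v ≠ ∞) :
    ∃ w : G.Walk u v, w.IsPath ∧ graphDist p G u v = ENNReal.ofReal (realLength p w) := by
  classical
  have hne : Nonempty (G.Walk u v) := by
    by_contra hc
    rw [not_nonempty_iff] at hc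
    exact h (by simp [graphDist])
  obtain ⟨w₀⟩ := hne
  have : Nonempty (G.Path u v) := ⟨w₀.toPath⟩
  obtain ⟨q, hq⟩ := Finite.exists_min fun q : G.Path u v => realLength p (q : G.Walk u v)
  refine ⟨q, q.2, le_antisymm (graphDist_le_realLength p _) (le_iInf fun w => ?_)⟩
  rw [walkLength_eq]
  refine ENNReal.ofReal_le_ofReal ((hq w.toPath).trans ?_)
  exact ((w.darts_bypass_sublist_darts).map _).sum_le_sum (by simp +contextual)

theorem graphDist_self (p : Fin n → M) (G : SimpleGraph (Fin n)) (u : Fin n) :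
    graphDist p G u u = 0 :=
  nonpos_iff_eq_zero.1 ((iInf_le _ SimpleGraph.Walk.nil).trans_eq (by simp [walkLength]))

theorem graphDist_le_edist_add (p : Fin n → M) {G : SimpleGraph (Fin n)} {u v : Fin n}
    (h : G.Adj u v) (w : Fin n) :
    graphDist p G u w ≤ edist (p u) (p v) + graphDist p G v w := by
  rw [graphDist, graphDist, ENNReal.add_iInf]
  exact le_iInf fun q => (iInf_le _ (q.cons h)).trans_eq (by simp [walkLength])

theorem graphDist_triangle (p : Fin n → M) (G : SimpleGraph (Fin n)) (u v w : Fin n) :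
    graphDist p G u w ≤ graphDist p G u v + graphDist p G v w := by
  rw [graphDist, graphDist, graphDist, ENNReal.iInf_add]
  refine le_iInf fun q => ?_
  rw [ENNReal.add_iInf]
  exact le_iInf fun r => (iInf_le _ (q.append r)).trans_eq (by simp [walkLength])

theorem graphDist_le_edist_of_adj (p : Fin n → M) {G : SimpleGraph (Fin n)} {u v : Fin n}
    (h : G.Adj u v) : graphDist p G u v ≤ edist (p u) (p v) := by
  simpa [graphDist_self] using graphDist_le_edist_add p h v

theorem edist_le_walkLength (p : Fin n → M) {G : SimpleGraph (Fin n)} {u v : Fin n}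
    (w : G.Walk u v) : edist (p u) (p v) ≤ walkLength p w := by
  induction w with
  | nil => simp
  | @cons a b c h q ih =>
    refine (edist_triangle _ (p b) _).trans ?_
    simpa [walkLength] using ih

theorem edist_le_graphDist (p : Fin n → M) (G : SimpleGraph (Fin n)) (u v : Fin n) :
    edist (p u) (p v) ≤ graphDist p G u v := le_iInf fun w => edist_le_walkLength p w

theorem graphDist_anti (p : Fin n → M) {G H : SimpleGraph (Fin n)} (h : G ≤ H) (u v : Fin n) :
    graphDist p H u v ≤ graphDist p G u v := by
  refine le_iInf fun w => (iInf_le _ (w.mapLe h)).trans_eq ?_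
  simp [walkLength, SimpleGraph.Walk.mapLe, Function.comp_def]

/-- A lower bound for the distances after the insertion of a single edge. -/
theorem le_graphDist_of_insert (p : Fin n → M) {G H : SimpleGraph (Fin n)} {u v : Fin n}
    (hH : ∀ a b, H.Adj a b → G.Adj a b ∨ (a = u ∧ b = v) ∨ (a = v ∧ b = u)) (x y : Fin n) :
    min (graphDist p G x y)
      (min (graphDist p G x u + edist (p u) (p v) + graphDist p G v y)
        (graphDist p G x v + edist (p u) (p v) + graphDist p G u y)) ≤ graphDist p H x y := by
  refine le_iInf fun w => ?_
  induction w with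
  | @nil a => simp [graphDist_self]
  | @cons a b c h q ih =>
    have hl : walkLength p (q.cons h) = edist (p a) (p b) + walkLength p q := by
      simp [walkLength]
    rw [hl]
    refine le_trans ?_ (add_le_add_right ih _)
    rcases hH a b h with h | ⟨rfl, rfl⟩ | ⟨rfl, rfl⟩
    · have e := graphDist_le_edist_add p h
      rw [← min_add_add_left, ← min_add_add_left]
      refine min_le_min (e c) (min_le_min ?_ ?_)
      · rw [← add_assoc, ← add_assoc]
        gcongr
        exact e u
      · rw [← add_assoc, ← add_assoc]
        gcongr
        exact e v
    -- The walk starts with the new edge. A continuation that uses this edge once more is dominated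
    -- by one of the other two terms.
    · simp only [graphDist_self, zero_add]
      rw [← min_add_add_left, ← min_add_add_left]
      refine le_min ?_ (le_min ?_ ?_)
      · exact min_le_of_right_le (min_le_of_left_le le_rfl)
      · refine min_le_of_right_le (min_le_of_left_le ?_)
        gcongr
        exact le_add_self
      · exact min_le_of_left_le (le_add_left le_add_self)
    · simp only [graphDist_self, zero_add]
      rw [edist_comm (p a) (p b), ← min_add_add_left, ← min_add_add_left]
      refine le_min ?_ (le_min ?_ ?_)
      · exact min_le_of_right_le (min_le_of_right_le le_rfl)
      · exact min_le_of_left_le (le_add_left le_add_self)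
      · refine min_le_of_right_le (min_le_of_right_le ?_)
        gcongr
        exact le_add_self

/-! ### Spanners and the minimum dilation -/

theorem isSpanner_dilation {p : Fin n → M} (hp : Function.Injective p)
    (G : SimpleGraph (Fin n)) : IsSpanner p G (dilation p G) := by
  intro u v
  rcases eq_or_ne u v with rfl | h
  · simp [graphDist_self]
  have h0 : edist (p u) (p v) ≠ 0 := by simpa using fun h' => h (hp h')
  rw [← ENNReal.div_le_iff h0 (edist_ne_top _ _)]
  refine le_sInf fun t ht => ?_
  rw [ENNReal.div_le_iff h0 (edist_ne_top _ _)]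
  exact ht u v

theorem IsSpanner.anti {p : Fin n → M} {G H : SimpleGraph (Fin n)} {t : ℝ≥0∞} (h : G ≤ H)
    (hG : IsSpanner p G t) : IsSpanner p H t :=
  fun u v => (graphDist_anti p h u v).trans (hG u v)

theorem one_le_of_isSpanner {p : Fin n → M} (hp : Function.Injective p) (hn : 2 ≤ n)
    {G : SimpleGraph (Fin n)} {t : ℝ≥0∞} (h : IsSpanner p G t) : 1 ≤ t := by
  have h1 : (⟨0, by omega⟩ : Fin n) ≠ ⟨1, by omega⟩ := by simp
  have h0 : edist (p ⟨0, by omega⟩) (p ⟨1, by omega⟩) ≠ 0 := by simpa using fun h' => h1 (hp h')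
  have := (edist_le_graphDist p G _ _).trans (h ⟨0, by omega⟩ ⟨1, by omega⟩)
  by_contra hc
  push Not at hc
  have h2 := ENNReal.mul_lt_mul_left h0 (edist_ne_top _ _) hc
  rw [one_mul] at h2
  exact absurd this (not_le.2 h2)

theorem addEdges_mono (G : SimpleGraph (Fin n)) {S S' : Finset (Fin n × Fin n)} (h : S ⊆ S') :
    addEdges G S ≤ addEdges G S' := by
  refine sup_le_sup le_rfl fun a b hab => ?_
  simp only [SimpleGraph.fromRel_adj] at hab ⊢
  exact ⟨hab.1, hab.2.imp (fun x => h x) fun x => h x⟩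

theorem exists_minDilation_eq (p : Fin n → M) (G : SimpleGraph (Fin n)) {k : ℕ}
    (hk : k ≤ n * n) :
    ∃ S : Finset (Fin n × Fin n), S.card = k ∧ minDilation p G k = dilation p (addEdges G S) := by
  obtain ⟨S₀, -, hS₀⟩ := Finset.exists_subset_card_eq
    (s := (Finset.univ : Finset (Fin n × Fin n))) (n := k) (by simpa using hk)
  have : Nonempty {S : Finset (Fin n × Fin n) // S.card = k} := ⟨⟨S₀, hS₀⟩⟩
  obtain ⟨S, hS⟩ := Finite.exists_min
    fun S : {S : Finset (Fin n × Fin n) // S.card = k} => dilation p (addEdges G S)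
  refine ⟨S, S.2, le_antisymm (iInf₂_le_of_le S.1 S.2 le_rfl) ?_⟩
  exact le_iInf₂ fun S' hS' => hS ⟨S', hS'⟩

theorem one_le_minDilation {p : Fin n → M} (hp : Function.Injective p) (hn : 2 ≤ n)
    (G : SimpleGraph (Fin n)) {k : ℕ} (hk : k ≤ n * n) : 1 ≤ minDilation p G k := by
  obtain ⟨S, -, hS⟩ := exists_minDilation_eq p G hk
  rw [hS]
  exact one_le_of_isSpanner hp hn (isSpanner_dilation hp _)

/-- The definition asks for exactly `k` pairs. A smaller set is padded, which is possible since `k ≤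
n * n` and harmless since extra edges only shorten distances. -/
theorem minDilation_le_of_isSpanner {p : Fin n → M} {G : SimpleGraph (Fin n)} {k : ℕ}
    (hk : k ≤ n * n) {S : Finset (Fin n × Fin n)} (hS : S.card ≤ k) {t : ℝ≥0∞}
    (h : IsSpanner p (addEdges G S) t) : minDilation p G k ≤ t := by
  obtain ⟨S', h1, h2, h3⟩ := Finset.exists_subsuperset_card_eq
    (Finset.subset_univ S) hS (by simpa using hk)
  exact (iInf₂_le S' h3).trans (sInf_le (h.anti (addEdges_mono G h1)))

/-! ### Cycles and linear relations over the field with two elements -/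

/-- The weight of an undirected edge. -/
noncomputable def edgeWeight (p : Fin n → M) : Sym2 (Fin n) → ℝ :=
  Sym2.lift ⟨fun a b => dist (p a) (p b), fun _ _ => dist_comm _ _⟩

@[simp] theorem edgeWeight_mk (p : Fin n → M) (a b : Fin n) :
    edgeWeight p s(a, b) = dist (p a) (p b) := rfl

theorem edgeWeight_nonneg (p : Fin n → M) (e : Sym2 (Fin n)) : 0 ≤ edgeWeight p e := by
  induction e with | _ a b => simp

theorem realLength_eq_sum_edges (p : Fin n → M) {G : SimpleGraph (Fin n)} {u v : Fin n}
    (w : G.Walk u v) : realLength p w = (w.edges.map (edgeWeight p)).sum := by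
  simp only [realLength, SimpleGraph.Walk.edges, List.map_map]
  rfl

/-- If every two-colouring that is constant on each edge of a multiset of edges gives `u` and `v`
the same colour, then some path from `u` to `v` uses each of these edges at most once. -/
theorem graphDist_fromEdgeSet_le (p : Fin n → M) (X : Multiset (Sym2 (Fin n))) (u v : Fin n)
    (h : ∀ f : Fin n → ZMod 2, (∀ a b, s(a, b) ∈ X → f a = f b) → f u = f v) :
    graphDist p (SimpleGraph.fromEdgeSet {e | e ∈ X}) u v ≤
      ENNReal.ofReal (X.map (edgeWeight p)).sum := by
  classical
  set H := SimpleGraph.fromEdgeSet {e | e ∈ X} with hH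
  have hr : H.Reachable u v := by
    by_contra hc
    -- If `v` were unreachable, the indicator of the component of `u` would be a colouring that
    -- separates them.
    have := h (fun a => if H.Reachable u a then 1 else 0) ?_
    · simp [hc] at this
    · intro a b hab
      rcases eq_or_ne a b with rfl | hne
      · rfl
      have : H.Adj a b := by simp [hH, hab, hne]
      have : H.Reachable u a ↔ H.Reachable u b :=
        ⟨fun x => x.trans this.reachable, fun x => x.trans this.symm.reachable⟩
      simp [this]
  obtain ⟨w, hw⟩ := hr.exists_isPath
  refine (graphDist_le_realLength p w).trans (ENNReal.ofReal_le_ofReal ?_)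
  rw [realLength_eq_sum_edges, ← Multiset.sum_coe, ← Multiset.map_coe]
  -- A path repeats no edge, so its edges form a submultiset of `X` and weigh no more than `X`,
  -- multiplicities included.
  have hle : (w.edges : Multiset (Sym2 (Fin n))) ≤ X := by
    rw [Multiset.le_iff_subset (Multiset.coe_nodup.2 hw.isTrail.edges_nodup)]
    intro e he
    have := w.edges_subset_edgeSet (Multiset.mem_coe.1 he)
    simp only [hH, SimpleGraph.edgeSet_fromEdgeSet] at this
    exact this.1
  obtain ⟨Y, hY⟩ := Multiset.le_iff_exists_add.1 hle
  rw [hY, Multiset.map_add, Multiset.sum_add]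
  refine le_add_of_nonneg_right (Multiset.sum_nonneg fun x hx => ?_)
  obtain ⟨e, -, rfl⟩ := Multiset.mem_map.1 hx
  exact edgeWeight_nonneg p e

/-- More vectors than the dimension are dependent; with coefficients in `ZMod 2` a nontrivial
relation is just a nonempty subset with sum zero. -/
theorem exists_zmod_two_relation {α ι : Type*} [Fintype α] [Fintype ι]
    (h : Fintype.card α < Fintype.card ι) (c : ι → α → ZMod 2) :
    ∃ I : Finset ι, I.Nonempty ∧ ∀ a, ∑ i ∈ I, c i a = 0 := by
  classical
  have hli : ¬ LinearIndependent (ZMod 2) c := by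
    intro hc
    have := hc.fintype_card_le_finrank
    rw [Module.finrank_fintype_fun_eq_card] at this
    omega
  rw [Fintype.not_linearIndependent_iff] at hli
  obtain ⟨g, hg, i, hi⟩ := hli
  refine ⟨Finset.univ.filter fun i => g i ≠ 0, ⟨i, by simp [hi]⟩, fun a => ?_⟩
  have h1 : ∀ x : ZMod 2, x ≠ 0 → x = 1 := by decide
  have := congrFun hg a
  simp only [Finset.sum_apply, Pi.smul_apply, smul_eq_mul, Pi.zero_apply] at this
  refine Eq.trans ?_ this
  rw [Finset.sum_filter]
  refine Finset.sum_congr rfl fun i _ => ?_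
  split_ifs with h
  · rw [h1 _ h, one_mul]
  · rw [not_not.1 h, zero_mul]

theorem zmod_two_add_self (x : ZMod 2) : x + x = 0 := by
  revert x; decide

theorem zmod_two_eq_of_add (x y : ZMod 2) (h : x + y = 0) : x = y := by
  revert x y; decide

/-- A sequence of positive distances between `n` points in which every term is more than twice
its predecessor has at most `n` terms. -/
theorem length_le_of_doubling (p : Fin n → M) {L : ℕ} (r : ℕ → ℝ) (E : Fin L → Fin n × Fin n)
    (hE : ∀ i : Fin L, r i = dist (p (E i).1) (p (E i).2)) (hpos : ∀ i < L, 0 < r i)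
    (hr : ∀ i, i + 1 < L → 2 * r i < r (i + 1)) : L ≤ n := by
  classical
  by_contra hL
  have hsum : ∀ j < L, ∑ i ∈ Finset.range j, r i < r j := by
    intro j
    induction j with
    | zero => intro h; simpa using hpos 0 h
    | succ j ih =>
      intro h
      rw [Finset.sum_range_succ]
      have := ih (by omega)
      have := hr j h
      linarith
  -- The vectors are the boundaries of the `L > n` edges in the space of functions on the vertices;
  -- a relation is an edge set with all degrees even.
  obtain ⟨I, hI, hrel⟩ := exists_zmod_two_relation (α := Fin n) (ι := Fin L) (by simpa using hL)
    (fun i => Pi.single (E i).1 1 + Pi.single (E i).2 1)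
  -- In this even set the remaining edges connect the endpoints of the longest one, yet their total
  -- length is smaller by `hsum`.
  set j := I.max' hI with hj
  have hjI : j ∈ I := I.max'_mem hI
  have key := graphDist_fromEdgeSet_le p (∑ i ∈ I.erase j, {s((E i).1, (E i).2)})
    (E j).1 (E j).2 ?_
  · have h1 := (edist_le_graphDist p _ _ _).trans key
    rw [edist_dist, ← hE, ENNReal.ofReal_le_ofReal_iff', or_iff_left (not_le.2 (hpos j j.2))] at h1
    rw [← Multiset.coe_mapAddMonoidHom, map_sum, ← Multiset.coe_sumAddMonoidHom, map_sum] at h1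
    simp only [Multiset.coe_mapAddMonoidHom, Multiset.map_singleton, edgeWeight_mk,
      Multiset.coe_sumAddMonoidHom, Multiset.sum_singleton, ← hE] at h1
    refine absurd (h1.trans ?_) (not_le.2 (hsum j j.2))
    have : ∑ i ∈ I.erase j, r i = ∑ i ∈ (I.erase j).map Fin.valEmbedding, r i :=
      by rw [Finset.sum_map]; rfl
    rw [this]
    refine Finset.sum_le_sum_of_subset_of_nonneg ?_ ?_
    · intro i hi
      simp only [Finset.mem_map, Finset.mem_erase, Fin.valEmbedding_apply] at hi
      obtain ⟨a, ⟨ha, ha'⟩, rfl⟩ := hi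
      have := lt_of_le_of_ne (I.le_max' a ha') ha
      simpa using this
    · intro i hi _
      exact (hpos i ((Finset.mem_range.1 hi).trans j.2)).le
  · intro f hf
    have h0 : ∑ i ∈ I, (f (E i).1 + f (E i).2) = 0 := by
      have : ∑ a, f a * ∑ i ∈ I, (Pi.single (E i).1 1 + Pi.single (E i).2 1 : Fin n → ZMod 2) a
          = 0 := Finset.sum_eq_zero fun a _ => by rw [hrel, mul_zero]
      rw [← this]
      simp only [Finset.mul_sum]
      rw [Finset.sum_comm]
      refine Finset.sum_congr rfl fun i _ => ?_
      simp [mul_add, Finset.sum_add_distrib, Pi.single_apply]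
    rw [← Finset.add_sum_erase I _ hjI, Finset.sum_eq_zero, add_zero] at h0
    · exact zmod_two_eq_of_add _ _ h0
    · intro i hi
      rw [hf _ _ (Multiset.mem_sum.2 ⟨i, hi, Multiset.mem_singleton_self _⟩)]
      exact zmod_two_add_self _

/-! ### Why the greedy algorithm cannot insert too many edges -/

theorem sum_darts_zmod_two {G : SimpleGraph (Fin n)} {u v : Fin n} (w : G.Walk u v)
    (f : Fin n → ZMod 2) : (w.darts.map fun a => f a.fst + f a.snd).sum = f u + f v := by
  induction w with
  | nil => simp [zmod_two_add_self]
  | @cons a b c h q ih =>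
    simp only [SimpleGraph.Walk.darts_cons, List.map_cons, List.sum_cons, ih]
    have := zmod_two_add_self (f b)
    linear_combination this

theorem graphDist_le_sum_darts (p : Fin n → M) {G H : SimpleGraph (Fin n)} {u v : Fin n}
    (w : G.Walk u v) (c : G.Dart → ℝ) (hc : ∀ a, 0 ≤ c a)
    (h : ∀ a ∈ w.darts, graphDist p H a.fst a.snd ≤ ENNReal.ofReal (c a)) :
    graphDist p H u v ≤ ENNReal.ofReal (w.darts.map c).sum := by
  induction w with
  | nil => simp [graphDist_self]
  | @cons x y z hxy q ih =>
    simp only [SimpleGraph.Walk.darts_cons, List.mem_cons, forall_eq_or_imp] at h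
    rw [SimpleGraph.Walk.darts_cons, List.map_cons, List.sum_cons, ENNReal.ofReal_add (hc _)
      (List.sum_nonneg (by simp +contextual [hc]))]
    exact (graphDist_triangle p H x y z).trans (add_le_add h.1 (ih h.2))

open scoped Classical in
/-- The length of the part of a walk that runs in the subgraph `G`. -/
noncomputable def insideLength (p : Fin n → M) (G : SimpleGraph (Fin n))
    {K : SimpleGraph (Fin n)} {u v : Fin n} (w : K.Walk u v) : ℝ :=
  (w.darts.map fun a => if G.Adj a.fst a.snd then dist (p a.fst) (p a.snd) else 0).sum

open scoped Classical in
/-- The length of the part of a walk that runs outside the subgraph `G`. -/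
noncomputable def outsideLength (p : Fin n → M) (G : SimpleGraph (Fin n))
    {K : SimpleGraph (Fin n)} {u v : Fin n} (w : K.Walk u v) : ℝ :=
  (w.darts.map fun a => if G.Adj a.fst a.snd then 0 else dist (p a.fst) (p a.snd)).sum

theorem insideLength_add_outsideLength (p : Fin n → M) (G : SimpleGraph (Fin n))
    {K : SimpleGraph (Fin n)} {u v : Fin n} (w : K.Walk u v) :
    insideLength p G w + outsideLength p G w = realLength p w := by
  rw [insideLength, outsideLength, realLength, ← List.sum_map_add]
  congr 2
  funext a
  split_ifs <;> simp

/-- If all pairs shorter than `uv` have dilation at most `T` in `H ≥ G`, then a short walk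
between the endpoints of a pair `uv` with dilation more than `T` is long outside of `G`. -/
theorem mul_dist_le_outsideLength (p : Fin n → M) {G K H : SimpleGraph (Fin n)} {u v : Fin n}
    (w : K.Walk u v) (hGH : G ≤ H) {t T : ℝ} (ht : 1 ≤ t) (hT : 1 ≤ T)
    (hw : realLength p w ≤ t * dist (p u) (p v))
    (hviol : ENNReal.ofReal (T * dist (p u) (p v)) < graphDist p H u v)
    (hshort : ∀ x y, dist (p x) (p y) < dist (p u) (p v) →
      graphDist p H x y ≤ ENNReal.ofReal (T * dist (p x) (p y))) :
    (T - t) * dist (p u) (p v) ≤ (T - 1) * outsideLength p G w := by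
  classical
  have h0 : ∀ x ∈ w.darts.map fun a => if G.Adj a.fst a.snd then 0 else
      dist (p a.fst) (p a.snd), 0 ≤ x := by
    intro x hx
    obtain ⟨a, -, rfl⟩ := List.mem_map.1 hx
    split_ifs <;> simp
  -- A single outside edge at least as long as `uv` already gives the bound, because `1 ≤ t`.
  -- Otherwise every outside edge is shorter than `uv` and can be replaced by a walk in `H` at the
  -- cost of a factor `T`.
  by_cases hlong : ∃ a ∈ w.darts, ¬ G.Adj a.fst a.snd ∧
      dist (p u) (p v) ≤ dist (p a.fst) (p a.snd)
  · obtain ⟨a, ha, hG, hl⟩ := hlong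
    have h1 : dist (p a.fst) (p a.snd) ≤ outsideLength p G w :=
      List.single_le_sum h0 _ (List.mem_map.2 ⟨a, ha, by simp [hG]⟩)
    exact mul_le_mul (by linarith) (hl.trans h1) dist_nonneg (by linarith)
  · push Not at hlong
    have h1 := graphDist_le_sum_darts p (H := H) w
      (fun a => if G.Adj a.fst a.snd then dist (p a.fst) (p a.snd) else
        T * dist (p a.fst) (p a.snd))
      (fun a => by split_ifs <;> positivity) (fun a ha => by
        split_ifs with hG
        · rw [← edist_dist]
          exact graphDist_le_edist_of_adj p (hGH hG)
        · exact hshort _ _ (hlong a ha hG))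
    have h2 := (ENNReal.ofReal_lt_ofReal_iff_of_nonneg (by positivity)).1 (hviol.trans_le h1)
    have h3 : (w.darts.map fun a => if G.Adj a.fst a.snd then dist (p a.fst) (p a.snd) else
        T * dist (p a.fst) (p a.snd)).sum = insideLength p G w + T * outsideLength p G w := by
      rw [insideLength, outsideLength, ← List.sum_map_mul_left, ← List.sum_map_add]
      congr 2
      funext a
      split_ifs <;> simp
    have h4 := insideLength_add_outsideLength p G w
    rw [h3] at h2
    nlinarith

/-- The boundary of the part of a walk outside `G` depends linearly on how often, modulo two, each
undirected edge of `S` is used outside `G`. So a relation between these counts makes the boundaries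
cancel. -/
theorem sum_outside_darts {G : SimpleGraph (Fin n)} {S : Finset (Fin n × Fin n)}
    (f : Fin n → ZMod 2) (l : List (addEdges G S).Dart) [DecidableRel G.Adj] :
    (l.map fun a => if G.Adj a.fst a.snd then 0 else f a.fst + f a.snd).sum =
      ∑ e : {e // e ∈ S.image fun q => s(q.1, q.2)},
        (l.map fun a => if ¬ G.Adj a.fst a.snd ∧ s(a.fst, a.snd) = e.1 then (1 : ZMod 2)
          else 0).sum *
        Sym2.lift ⟨fun a b => f a + f b, fun _ _ => add_comm _ _⟩ e.1 := by
  induction l with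
  | nil => simp
  | cons a l ih =>
    simp only [List.map_cons, List.sum_cons, ih, add_mul, Finset.sum_add_distrib]
    congr 1
    split_ifs with hG
    · simp [hG]
    · have hmem : s(a.fst, a.snd) ∈ S.image fun q => s(q.1, q.2) := by
        have := a.adj
        simp only [addEdges, SimpleGraph.sup_adj, hG, false_or, SimpleGraph.fromRel_adj] at this
        rcases this.2 with h | h
        · exact Finset.mem_image.2 ⟨_, h, rfl⟩
        · exact Finset.mem_image.2 ⟨_, h, Sym2.eq_swap⟩
      rw [Finset.sum_eq_single ⟨_, hmem⟩]
      · simp [hG]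
      · intro b _ hb
        rw [if_neg, zero_mul]
        rintro ⟨-, h⟩
        exact hb (Subtype.ext h.symm)
      · simp

/-- A greedy sequence of `k + 1` edges for the threshold `(k + 1) * t` cannot exist if `k` edges
suffice for the dilation `t`. -/
theorem no_greedy_sequence (p : Fin n → M) (G : SimpleGraph (Fin n)) {k : ℕ} (hk : 1 ≤ k)
    {S : Finset (Fin n × Fin n)} (hS : S.card ≤ k) {t T : ℝ} (ht : 1 ≤ t) (hT : T = (k + 1) * t)
    (hsp : IsSpanner p (addEdges G S) (ENNReal.ofReal t))
    (E : Fin (k + 1) → Fin n × Fin n) (H : Fin (k + 1) → SimpleGraph (Fin n))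
    (hG : ∀ i, G ≤ H i) (hE : ∀ i j, j < i → (H j).Adj (E i).1 (E i).2)
    (hd : ∀ i j, j < i → dist (p (E i).1) (p (E i).2) ≤ dist (p (E j).1) (p (E j).2))
    (hviol : ∀ i, ENNReal.ofReal (T * dist (p (E i).1) (p (E i).2)) <
      graphDist p (H i) (E i).1 (E i).2)
    (hshort : ∀ i x y, dist (p x) (p y) < dist (p (E i).1) (p (E i).2) →
      graphDist p (H i) x y ≤ ENNReal.ofReal (T * dist (p x) (p y))) : False := by
  classical
  have hk' : (1 : ℝ) ≤ k := by exact_mod_cast hk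
  have hT1 : 1 < T := by rw [hT]; nlinarith
  have hδ : ∀ i, ∃ w : (addEdges G S).Walk (E i).1 (E i).2,
      realLength p w ≤ t * dist (p (E i).1) (p (E i).2) := by
    intro i
    have h1 := hsp (E i).1 (E i).2
    rw [edist_dist, ← ENNReal.ofReal_mul (by linarith)] at h1
    obtain ⟨w, -, hw⟩ := exists_isPath_graphDist_eq p (ne_top_of_le_ne_top ENNReal.ofReal_ne_top h1)
    rw [hw] at h1
    exact ⟨w, (ENNReal.ofReal_le_ofReal_iff (by positivity)).1 h1⟩
  choose δ hδ using hδ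
  -- The `k + 1` walks give vectors with one coordinate for each undirected edge from `S`, hence
  -- with at most `k` coordinates.
  obtain ⟨I, hI, hrel⟩ := exists_zmod_two_relation
    (α := {e // e ∈ S.image fun q => s(q.1, q.2)}) (ι := Fin (k + 1))
    (by
      rw [Fintype.card_coe, Fintype.card_fin]
      exact (Finset.card_image_le.trans hS).trans_lt k.lt_succ_self)
    (fun i e => ((δ i).darts.map fun a =>
      if ¬ G.Adj a.fst a.snd ∧ s(a.fst, a.snd) = e.1 then (1 : ZMod 2) else 0).sum)
  -- Indices run backwards in time, so the least index is the edge inserted last, and it is the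
  -- longest in `I`.
  set j := I.min' hI with hj
  have hjI : j ∈ I := I.min'_mem hI
  have hlt : ∀ i ∈ I.erase j, j < i := fun i hi =>
    lt_of_le_of_ne (I.min'_le i (Finset.mem_of_mem_erase hi)) (Finset.ne_of_mem_erase hi).symm
  -- The `G`-parts of the chosen walks and all chosen greedy edges except `E j`. They are all
  -- present in `H j`.
  set X : Multiset (Sym2 (Fin n)) :=
    ∑ i ∈ I, (((δ i).darts.filter fun a => G.Adj a.fst a.snd).map fun a => s(a.fst, a.snd) :
      Multiset (Sym2 (Fin n))) + ∑ i ∈ I.erase j, {s((E i).1, (E i).2)} with hX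
  have hXG : ∀ i ∈ I, ∀ a ∈ (δ i).darts, G.Adj a.fst a.snd → s(a.fst, a.snd) ∈ X := by
    intro i hi a ha hadj
    refine Multiset.mem_add.2 (Or.inl (Multiset.mem_sum.2 ⟨i, hi, ?_⟩))
    exact Multiset.mem_coe.2 (List.mem_map.2 ⟨a, by simp [ha, hadj], rfl⟩)
  have hXE : ∀ i ∈ I.erase j, s((E i).1, (E i).2) ∈ X := fun i hi =>
    Multiset.mem_add.2 (Or.inr (Multiset.mem_sum.2 ⟨i, hi, Multiset.mem_singleton_self _⟩))
  have hXH : SimpleGraph.fromEdgeSet {e | e ∈ X} ≤ H j := by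
    intro a b hab
    rw [SimpleGraph.fromEdgeSet_adj] at hab
    rcases Multiset.mem_add.1 hab.1 with h | h
    · obtain ⟨i, hi, h⟩ := Multiset.mem_sum.1 h
      obtain ⟨d, hd, hde⟩ := List.mem_map.1 (Multiset.mem_coe.1 h)
      have : G.Adj d.fst d.snd := by simpa using (List.mem_filter.1 hd).2
      refine hG j ?_
      rwa [← SimpleGraph.mem_edgeSet, ← hde, SimpleGraph.mem_edgeSet]
    · obtain ⟨i, hi, h⟩ := Multiset.mem_sum.1 h
      rw [Multiset.mem_singleton] at h
      rw [← SimpleGraph.mem_edgeSet, h, SimpleGraph.mem_edgeSet]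
      exact hE i j (hlt i hi)
  have hXw : (X.map (edgeWeight p)).sum =
      ∑ i ∈ I, insideLength p G (δ i) + ∑ i ∈ I.erase j, dist (p (E i).1) (p (E i).2) := by
    rw [hX, Multiset.map_add, Multiset.sum_add]
    congr 1
    · rw [← Multiset.coe_mapAddMonoidHom, map_sum, ← Multiset.coe_sumAddMonoidHom, map_sum]
      refine Finset.sum_congr rfl fun i _ => ?_
      simp only [Multiset.coe_mapAddMonoidHom, Multiset.map_coe, List.map_map,
        Multiset.coe_sumAddMonoidHom, Multiset.sum_coe, insideLength]
      generalize (δ i).darts = l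
      induction l with
      | nil => simp
      | cons a l ih => by_cases h : G.Adj a.fst a.snd <;> simp [h, ih]
    · rw [← Multiset.coe_mapAddMonoidHom, map_sum, ← Multiset.coe_sumAddMonoidHom, map_sum]
      simp
  -- Summing the boundary of each walk over `I`, the inside darts vanish since `f` is constant on
  -- them, and the outside darts vanish by the relation. Of the greedy edges only `E j` can then
  -- contribute, so it contributes zero.
  have hcon : ∀ f : Fin n → ZMod 2, (∀ a b, s(a, b) ∈ X → f a = f b) → f (E j).1 = f (E j).2 := by
    intro f hf
    have h0 : ∑ i ∈ I, (f (E i).1 + f (E i).2) = 0 := by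
      have h1 : ∀ i ∈ I, f (E i).1 + f (E i).2 =
          ((δ i).darts.map fun a => if G.Adj a.fst a.snd then 0 else f a.fst + f a.snd).sum := by
        intro i hi
        rw [← sum_darts_zmod_two (δ i) f]
        congr 1
        refine List.map_congr_left fun a ha => ?_
        split_ifs with h
        · rw [hf _ _ (hXG i hi a ha h), zmod_two_add_self]
        · rfl
      rw [Finset.sum_congr rfl h1]
      simp only [sum_outside_darts]
      rw [Finset.sum_comm]
      refine Finset.sum_eq_zero fun e _ => ?_
      rw [← Finset.sum_mul, hrel, zero_mul]
    rw [← Finset.add_sum_erase I _ hjI, Finset.sum_eq_zero, add_zero] at h0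
    · exact zmod_two_eq_of_add _ _ h0
    · intro i hi
      rw [hf _ _ (hXE i hi)]
      exact zmod_two_add_self _
  have h1 := (hviol j).trans_le ((graphDist_anti p hXH _ _).trans
    (graphDist_fromEdgeSet_le p X _ _ hcon))
  have hT0 : 0 ≤ T * dist (p (E j).1) (p (E j).2) := by positivity
  rw [hXw, ENNReal.ofReal_lt_ofReal_iff_of_nonneg hT0] at h1
  set D := dist (p (E j).1) (p (E j).2) with hD
  have hdi : ∀ i ∈ I, dist (p (E i).1) (p (E i).2) ≤ D := by
    intro i hi
    rcases eq_or_ne i j with rfl | hne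
    · exact le_rfl
    · exact hd i j (hlt i (Finset.mem_erase.2 ⟨hne, hi⟩))
  have hcard : (I.card : ℝ) ≤ k + 1 := by
    exact_mod_cast (Finset.card_le_univ I).trans_eq (Fintype.card_fin _)
  -- A walk of length at most `t` times its pair, minus the forced outside part `(T - t) / (T - 1)`;
  -- everything is multiplied by `T - 1 > 0` to avoid the division.
  have hA : (T - 1) * ∑ i ∈ I, insideLength p G (δ i) ≤
      (k + 1) * (((T - 1) * t - (T - t)) * D) := by
    rw [Finset.mul_sum]
    have hnn : 0 ≤ (T - 1) * t - (T - t) := by nlinarith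
    have : ∀ i ∈ I, (T - 1) * insideLength p G (δ i) ≤ ((T - 1) * t - (T - t)) * D := by
      intro i hi
      have h2 := mul_dist_le_outsideLength p (δ i) (hG i) ht hT1.le (hδ i) (hviol i) (hshort i)
      have h3 := insideLength_add_outsideLength p G (δ i)
      have h4 := hδ i
      have h5 := mul_le_mul_of_nonneg_left (hdi i hi) hnn
      nlinarith
    refine (Finset.sum_le_sum this).trans ?_
    rw [Finset.sum_const, nsmul_eq_mul]
    exact mul_le_mul_of_nonneg_right hcard (mul_nonneg hnn dist_nonneg)
  have hB : ∑ i ∈ I.erase j, dist (p (E i).1) (p (E i).2) ≤ k * D := by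
    refine (Finset.sum_le_sum fun i hi => hdi i (Finset.mem_of_mem_erase hi)).trans ?_
    rw [Finset.sum_const, nsmul_eq_mul, Finset.card_erase_of_mem hjI]
    refine mul_le_mul_of_nonneg_right ?_ dist_nonneg
    have := (Finset.card_le_univ I).trans_eq (Fintype.card_fin _)
    exact_mod_cast (by omega : I.card - 1 ≤ k)
  have hC := mul_lt_mul_of_pos_left h1 (sub_pos.2 hT1)
  have hD0 : 0 ≤ D := dist_nonneg
  have hBB := mul_le_mul_of_nonneg_left hB (sub_pos.2 hT1).le
  have hfin : (T - 1) * (T * D) < (k + 1) * (((T - 1) * t - (T - t)) * D) + (T - 1) * (k * D) := by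
    rw [mul_add] at hC
    linarith
  -- Here the choice of `T` enters, through `(k + 1) * (T - t) = k * T`; the surplus `k * D ≥ 0`
  -- contradicts the strict inequality `hfin`.
  have : (k + 1) * (((T - 1) * t - (T - t)) * D) + (T - 1) * (k * D) =
      (T - 1) * (T * D) - k * D := by rw [hT]; ring
  nlinarith

end Dilation

/-! ### Chains of greedy edges and candidates for the threshold -/

namespace Dilation

variable {n : ℕ} {M : Type*} [MetricSpace M]

/-- The lists of edges (the last edge first) that the greedy algorithm with threshold `T` may
have added to `G`: a new edge is at least as long as the earlier ones, its endpoints violate the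
threshold, and all shorter pairs satisfy it. -/
inductive GreedyChain (p : Fin n → M) (G : SimpleGraph (Fin n)) (T : ℝ) :
    List (Fin n × Fin n) → Prop
  | nil : GreedyChain p G T []
  | cons {e : Fin n × Fin n} {l : List (Fin n × Fin n)} :
      GreedyChain p G T l →
      (∀ f ∈ l, dist (p f.1) (p f.2) ≤ dist (p e.1) (p e.2)) →
      ENNReal.ofReal (T * dist (p e.1) (p e.2)) <
        graphDist p (addEdges G l.toFinset) e.1 e.2 →
      (∀ x y, dist (p x) (p y) < dist (p e.1) (p e.2) →
        graphDist p (addEdges G l.toFinset) x y ≤ ENNReal.ofReal (T * dist (p x) (p y))) →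
      GreedyChain p G T (e :: l)

theorem GreedyChain.of_append {p : Fin n → M} {G : SimpleGraph (Fin n)} {T : ℝ}
    {l l' : List (Fin n × Fin n)} (h : GreedyChain p G T (l' ++ l)) : GreedyChain p G T l := by
  induction l' with
  | nil => exact h
  | cons a l' ih =>
    cases h with
    | cons h _ _ _ => exact ih h

/-- Position `i` in the list is an edge, and the tail behind it is the set of edges present when it
was inserted. This is the data that `no_greedy_sequence` refutes. -/
theorem GreedyChain.not_spanner {p : Fin n → M} {G : SimpleGraph (Fin n)} {T : ℝ}
    {l : List (Fin n × Fin n)} (h : GreedyChain p G T l) {k : ℕ} (hl : l.length = k + 1)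
    (hk : 1 ≤ k) {S : Finset (Fin n × Fin n)} (hS : S.card ≤ k) {t : ℝ} (ht : 1 ≤ t)
    (hT : T = (k + 1) * t) : ¬ IsSpanner p (addEdges G S) (ENNReal.ofReal t) := by
  intro hsp
  have hc : ∀ i : Fin (k + 1),
      GreedyChain p G T (l[(i : ℕ)]'(by omega) :: l.drop (i + 1)) := by
    intro i
    rw [List.cons_getElem_drop_succ]
    exact GreedyChain.of_append (l' := l.take i) (by rwa [List.take_append_drop])
  have hmem : ∀ i j : Fin (k + 1), j < i → l[(i : ℕ)]'(by omega) ∈ l.drop (j + 1) := by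
    intro i j hij
    refine List.mem_iff_getElem.2 ⟨i - (j + 1), by simp; omega, ?_⟩
    have : (j : ℕ) + 1 + (i - (j + 1)) = i := by
      have : (j : ℕ) < i := hij
      omega
    simp [this]
  have hne : ∀ i : Fin (k + 1), (l[(i : ℕ)]'(by omega)).1 ≠ (l[(i : ℕ)]'(by omega)).2 := by
    intro i heq
    cases hc i with
    | cons _ _ h _ => rw [heq] at h; simp [graphDist_self] at h
  refine no_greedy_sequence p G hk hS ht hT hsp (fun i => l[(i : ℕ)]'(by omega))
    (fun i => addEdges G (l.drop (i + 1)).toFinset) (fun i => le_sup_left) ?_ ?_ ?_ ?_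
  · intro i j hij
    refine Or.inr ?_
    rw [SimpleGraph.fromRel_adj]
    exact ⟨hne i, Or.inl (List.mem_toFinset.2 (hmem i j hij))⟩
  · intro i j hij
    cases hc j with
    | cons _ h _ _ => exact h _ (hmem i j hij)
  · intro i
    cases hc i with
    | cons _ _ h _ => exact h
  · intro i
    cases hc i with
    | cons _ _ _ h => exact h

/-- The certificate of a failed test. If the inequality failed, an optimal set of `k` pairs would
give dilation at most `T / (k + 1)`, which is at least `1` as every dilation is, and the chain would
be impossible. -/
theorem GreedyChain.lt_minDilation {p : Fin n → M} (hp : Function.Injective p) (hn : 2 ≤ n)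
    {G : SimpleGraph (Fin n)} {T : ℝ} {l : List (Fin n × Fin n)} (h : GreedyChain p G T l)
    {k : ℕ} (hl : l.length = k + 1) (hk : 1 ≤ k) (hkn : k ≤ n * n) :
    ENNReal.ofReal T < ENNReal.ofReal (k + 1) * minDilation p G k := by
  by_contra hc
  push Not at hc
  obtain ⟨S, hS, hmin⟩ := exists_minDilation_eq p G hkn
  have hk0 : (0 : ℝ) < k + 1 := by positivity
  have h0 : ENNReal.ofReal ((k : ℝ) + 1) ≠ 0 := by simpa using hk0
  have h1 : minDilation p G k ≤ ENNReal.ofReal (T / (k + 1)) := by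
    rw [ENNReal.ofReal_div_of_pos hk0, ENNReal.le_div_iff_mul_le (Or.inl h0)
      (Or.inl ENNReal.ofReal_ne_top), mul_comm]
    exact hc
  have h2 : IsSpanner p (addEdges G S) (ENNReal.ofReal (T / (k + 1))) := fun u v =>
    (isSpanner_dilation hp (addEdges G S) u v).trans (mul_le_mul_left (hmin ▸ h1) _)
  have h3 := one_le_of_isSpanner hp hn h2
  rw [ENNReal.one_le_ofReal] at h3
  exact h.not_spanner hl hk hS.le h3 (by field_simp) h2

/-- The minimum dilation is, up to a factor `n`, a ratio of two distances. -/
theorem exists_ratio_minDilation {p : Fin n → M} (hp : Function.Injective p) (hn : 2 ≤ n)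
    (G : SimpleGraph (Fin n)) {k : ℕ} (hkn : k ≤ n * n) (hfin : minDilation p G k ≠ ∞) :
    ∃ a b u v, a ≠ b ∧ u ≠ v ∧
      dist (p a) (p b) ≤ (minDilation p G k).toReal * dist (p u) (p v) ∧
      (minDilation p G k).toReal * dist (p u) (p v) ≤ n * dist (p a) (p b) := by
  classical
  obtain ⟨S, -, hmin⟩ := exists_minDilation_eq p G hkn
  set K := addEdges G S with hK
  set t := minDilation p G k with ht
  have : Nonempty {q : Fin n × Fin n // q.1 ≠ q.2} :=
    ⟨⟨(⟨0, by omega⟩, ⟨1, by omega⟩), by simp⟩⟩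
  -- A pair of largest dilation attains the minimum dilation exactly, so `t` times its distance is
  -- the length of a shortest path.
  obtain ⟨⟨⟨u, v⟩, huv⟩, hmax⟩ := Finite.exists_max
    fun q : {q : Fin n × Fin n // q.1 ≠ q.2} =>
      graphDist p K q.1.1 q.1.2 / edist (p q.1.1) (p q.1.2)
  simp only at huv hmax
  have hne0 : ∀ a b, a ≠ b → edist (p a) (p b) ≠ 0 := fun a b h => by
    simpa using fun h' => h (hp h')
  have hle : t ≤ graphDist p K u v / edist (p u) (p v) := by
    rw [hmin]
    refine sInf_le fun a b => ?_
    rcases eq_or_ne a b with rfl | hab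
    · simp [graphDist_self]
    · rw [← ENNReal.div_le_iff (hne0 a b hab) (edist_ne_top _ _)]
      exact hmax ⟨(a, b), hab⟩
  rw [ENNReal.le_div_iff_mul_le (Or.inl (hne0 u v huv)) (Or.inl (edist_ne_top _ _))] at hle
  have hge : graphDist p K u v ≤ t * edist (p u) (p v) := by
    rw [hmin]; exact isSpanner_dilation hp K u v
  have htop : graphDist p K u v ≠ ∞ :=
    ne_top_of_le_ne_top (ENNReal.mul_ne_top hfin (edist_ne_top _ _)) hge
  obtain ⟨w, hw, hlen⟩ := exists_isPath_graphDist_eq p htop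
  have heq : t.toReal * dist (p u) (p v) = realLength p w := by
    have := le_antisymm hle hge
    rw [hlen, edist_dist] at this
    have := congrArg ENNReal.toReal this
    rwa [ENNReal.toReal_mul, ENNReal.toReal_ofReal dist_nonneg,
      ENNReal.toReal_ofReal (realLength_nonneg p w)] at this
  have hne : w.darts ≠ [] := by
    cases w with
    | nil => exact absurd rfl huv
    | cons _ _ => simp
  -- The length of a path lies between the length of its longest edge and `n` times that, a path
  -- having fewer than `n` edges.
  obtain ⟨a, ha, hamax⟩ := (w.darts.toFinset).exists_max_image
    (fun a => dist (p a.fst) (p a.snd)) (by simpa using hne)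
  rw [List.mem_toFinset] at ha
  refine ⟨a.fst, a.snd, u, v, a.adj.ne, huv, ?_, ?_⟩
  · rw [heq]
    exact List.single_le_sum (by simp +contextual) _ (List.mem_map.2 ⟨a, ha, rfl⟩)
  · rw [heq]
    have h1 := List.sum_le_card_nsmul (w.darts.map fun a => dist (p a.fst) (p a.snd))
      (dist (p a.fst) (p a.snd)) (by
        intro x hx
        obtain ⟨b, hb, rfl⟩ := List.mem_map.1 hx
        exact hamax b (List.mem_toFinset.2 hb))
    refine h1.trans ?_
    rw [nsmul_eq_mul]
    refine mul_le_mul_of_nonneg_right ?_ dist_nonneg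
    have := hw.length_lt
    simp only [Fintype.card_fin] at this
    simp only [List.length_map, SimpleGraph.Walk.length_darts]
    exact_mod_cast this.le

/-- Rounding the two distances of the ratio down to scales costs a factor two each. Rounding the
numerator is compensated by `2 * n` instead of `n`, and rounding the denominator turns the upper
factor into `4 * n`. -/
theorem exists_candidate {p : Fin n → M} (hp : Function.Injective p) (hn : 2 ≤ n)
    (G : SimpleGraph (Fin n)) {k : ℕ} (hkn : k ≤ n * n) (hfin : minDilation p G k ≠ ∞)
    {L : ℕ} {r : ℕ → ℝ} (hpos : ∀ i < L, 0 < r i)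
    (hr : ∀ x y, x ≠ y → ∃ i < L, r i ≤ dist (p x) (p y) ∧ dist (p x) (p y) ≤ 2 * r i) :
    ∃ i < L, ∃ j < L, (k + 1) * (minDilation p G k).toReal ≤ (k + 1) * (2 * n) * (r i / r j) ∧
      (k + 1) * (2 * n) * (r i / r j) ≤ (k + 1) * (4 * n) * (minDilation p G k).toReal := by
  obtain ⟨a, b, u, v, hab, huv, h1, h2⟩ := exists_ratio_minDilation hp hn G hkn hfin
  obtain ⟨i, hi, hi1, hi2⟩ := hr a b hab
  obtain ⟨j, hj, hj1, hj2⟩ := hr u v huv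
  have hpj := hpos j hj
  set t := (minDilation p G k).toReal
  have ht : 0 ≤ t := ENNReal.toReal_nonneg
  have hk0 : (0 : ℝ) < k + 1 := by positivity
  have hn0 : (0 : ℝ) < n := by exact_mod_cast (by omega : 0 < n)
  refine ⟨i, hi, j, hj, ?_, ?_⟩
  · rw [mul_assoc]
    refine mul_le_mul_of_nonneg_left ?_ hk0.le
    rw [← mul_div_assoc, le_div_iff₀ hpj]
    have h3 := mul_le_mul_of_nonneg_left hj1 ht
    have h4 := mul_le_mul_of_nonneg_left hi2 hn0.le
    linarith
  · rw [mul_assoc, mul_assoc _ (4 * (n : ℝ))]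
    refine mul_le_mul_of_nonneg_left ?_ hk0.le
    rw [← mul_div_assoc, div_le_iff₀ hpj]
    have h3 := mul_le_mul_of_nonneg_left hj2 ht
    have h4 : r i ≤ 2 * (t * r j) := by linarith
    have h5 := mul_le_mul_of_nonneg_left h4 hn0.le
    linarith

end Dilation

/-! ### A priority queue as a tournament tree -/

namespace RealRAM

infixr:60 ";;" => Cmd.seq

/-!
A priority queue in the form of a tournament tree with `N` leaves. The nodes are numbered from
`1` (the root) to `2 * N - 1`, the leaves being the last `N` of them. A node `l` contains the
natural number `t l`, which is `0` if the node is empty, and the key `κ l`; a nonempty inner node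
is a copy of a child with the least key.
-/

structure TreeNode (t : ℕ → ℕ) (κ : ℕ → ℝ) (l : ℕ) : Prop where
  empty : t l = 0 → t (l + l) = 0 ∧ t (l + l + 1) = 0
  copy : t l ≠ 0 → (t l = t (l + l) ∧ κ l = κ (l + l)) ∨
    (t l = t (l + l + 1) ∧ κ l = κ (l + l + 1))
  left : t (l + l) ≠ 0 → κ l ≤ κ (l + l)
  right : t (l + l + 1) ≠ 0 → κ l ≤ κ (l + l + 1)

theorem TreeNode.congr {t t' : ℕ → ℕ} {κ κ' : ℕ → ℝ} {l : ℕ} (h : TreeNode t κ l)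
    (h₀ : t' l = t l ∧ κ' l = κ l) (h₁ : t' (l + l) = t (l + l) ∧ κ' (l + l) = κ (l + l))
    (h₂ : t' (l + l + 1) = t (l + l + 1) ∧ κ' (l + l + 1) = κ (l + l + 1)) :
    TreeNode t' κ' l := by
  refine ⟨?_, ?_, ?_, ?_⟩ <;> simp only [h₀.1, h₀.2, h₁.1, h₁.2, h₂.1, h₂.2]
  exacts [h.empty, h.copy, h.left, h.right]

def IsTree (N : ℕ) (t : ℕ → ℕ) (κ : ℕ → ℝ) : Prop := ∀ l, 1 ≤ l → l < N → TreeNode t κ l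

/-- Climbing from a node to its parent `l / 2`, nodes stay nonempty and keys do not increase. -/
theorem IsTree.root_le {N : ℕ} {t : ℕ → ℕ} {κ : ℕ → ℝ} (h : IsTree N t κ) (l : ℕ) (h1 : 1 ≤ l)
    (h2 : l < N + N) (h0 : t l ≠ 0) : t 1 ≠ 0 ∧ κ 1 ≤ κ l := by
  induction l using Nat.strong_induction_on with
  | _ l ih =>
    rcases h1.eq_or_lt with rfl | h1
    · exact ⟨h0, le_rfl⟩
    have hn := h (l / 2) (by omega) (by omega)
    have hl : l = l / 2 + l / 2 ∨ l = l / 2 + l / 2 + 1 := by omega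
    have h3 : t (l / 2) ≠ 0 := by
      intro h4
      have := hn.empty h4
      rcases hl with hl | hl <;> rw [hl] at h0
      · exact h0 this.1
      · exact h0 this.2
    have h4 : κ (l / 2) ≤ κ l := by
      rcases hl with hl | hl
      · have := hn.left (hl ▸ h0)
        rwa [← hl] at this
      · have := hn.right (hl ▸ h0)
        rwa [← hl] at this
    have := ih (l / 2) (by omega) (by omega) (by omega) h3
    exact ⟨this.1, this.2.trans h4⟩

theorem IsTree.exists_leaf {N : ℕ} {t : ℕ → ℕ} {κ : ℕ → ℝ} (h : IsTree N t κ) (l : ℕ)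
    (h1 : 1 ≤ l) (h2 : l < N + N) (h0 : t l ≠ 0) :
    ∃ i < N, t l = t (N + i) ∧ κ l = κ (N + i) := by
  induction hd : N + N - l using Nat.strong_induction_on generalizing l with
  | _ d ih =>
    rcases lt_or_ge l N with hl | hl
    · rcases (h l h1 hl).copy h0 with hc | hc
      · obtain ⟨i, hi, h3, h4⟩ := ih (N + N - (l + l)) (by omega) (l + l) (by omega) (by omega)
          (hc.1 ▸ h0) rfl
        exact ⟨i, hi, hc.1.trans h3, hc.2.trans h4⟩
      · obtain ⟨i, hi, h3, h4⟩ := ih (N + N - (l + l + 1)) (by omega) (l + l + 1) (by omega)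
          (by omega) (hc.1 ▸ h0) rfl
        exact ⟨i, hi, hc.1.trans h3, hc.2.trans h4⟩
    · exact ⟨l - N, by omega, by rw [Nat.add_sub_cancel' hl], by rw [Nat.add_sub_cancel' hl]⟩

/-- Recompute the inner node in register `7` of the tree in the arrays `8` and `1`. -/
def treePull : Cmd :=
  .cond (.and (.not (.neq (.get 8 (.add (.var 7) (.var 7))) (.const 0)))
      (.or (.neq (.get 8 (.add (.add (.var 7) (.var 7)) (.const 1))) (.const 0))
        (.not (.rlt (.get 1 (.add (.add (.var 7) (.var 7)) (.const 1)))
          (.get 1 (.add (.var 7) (.var 7)))))))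
    (.nput 8 (.var 7) (.get 8 (.add (.var 7) (.var 7))) ;;
      .rput 1 (.var 7) (.get 1 (.add (.var 7) (.var 7))))
    (.nput 8 (.var 7) (.get 8 (.add (.add (.var 7) (.var 7)) (.const 1))) ;;
      .rput 1 (.var 7) (.get 1 (.add (.add (.var 7) (.var 7)) (.const 1))))

/-- Overwrite the leaf in register `8` of the tree with `N` leaves, `N` being in register `3`, by
the content of the natural register `9` and the key in the real register `1`. -/
def treeSet : Cmd :=
  .nset 7 (.add (.var 3) (.var 8)) ;; .nput 8 (.var 7) (.var 9) ;; .rput 1 (.var 7) (.var 1) ;;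
  .loop (.nlt (.const 1) (.var 7)) (.nset 7 (.half (.var 7)) ;; treePull)

theorem treePull_run (s : State) (h : 1 ≤ s.nvar 7) :
    TreeNode ((treePull.run s).narr 8) ((treePull.run s).rarr 1) (s.nvar 7) ∧
    (∀ l, l ≠ s.nvar 7 → (treePull.run s).narr 8 l = s.narr 8 l ∧
      (treePull.run s).rarr 1 l = s.rarr 1 l) ∧ (treePull.run s).nvar = s.nvar := by
  have e1 : s.nvar 7 + s.nvar 7 ≠ s.nvar 7 := by omega
  have e2 : s.nvar 7 + s.nvar 7 + 1 ≠ s.nvar 7 := by omega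
  by_cases hb : s.narr 8 (s.nvar 7 + s.nvar 7) ≠ 0 ∧ (s.narr 8 (s.nvar 7 + s.nvar 7 + 1) = 0 ∨
      ¬ s.rarr 1 (s.nvar 7 + s.nvar 7 + 1) < s.rarr 1 (s.nvar 7 + s.nvar 7))
  · have hr : treePull.run s = (s.putN 8 (s.nvar 7) (s.narr 8 (s.nvar 7 + s.nvar 7))).putR 1
        (s.nvar 7) (s.rarr 1 (s.nvar 7 + s.nvar 7)) := by
      rw [treePull, Cmd.run_cond_pos]
      · simp [Cmd.run]
      · exact hb
    rw [hr]
    refine ⟨⟨?_, ?_, ?_, ?_⟩, fun l hl => ?_, ?_⟩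
    · simp [hb.1]
    · exact fun _ => Or.inl (by simp [Function.update_of_ne e1])
    · simp [Function.update_of_ne e1]
    · simp only [State.putR_narr, State.putN_narr, State.putR_rarr, State.putN_rarr, if_true]
      rw [Function.update_of_ne e2, Function.update_self, Function.update_of_ne e2]
      intro h3
      rcases hb.2 with h4 | h4
      · exact absurd h4 h3
      · exact not_lt.1 h4
    · simp [hl]
    · simp
  · have hr : treePull.run s = (s.putN 8 (s.nvar 7) (s.narr 8 (s.nvar 7 + s.nvar 7 + 1))).putR 1
        (s.nvar 7) (s.rarr 1 (s.nvar 7 + s.nvar 7 + 1)) := by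
      rw [treePull, Cmd.run_cond_neg]
      · simp [Cmd.run]
      · exact hb
    rw [hr]
    push Not at hb
    refine ⟨⟨?_, ?_, ?_, ?_⟩, fun l hl => ?_, ?_⟩
    · simp only [State.putR_narr, State.putN_narr, if_true]
      rw [Function.update_of_ne e2, Function.update_self, Function.update_of_ne e1]
      intro h3
      refine ⟨?_, h3⟩
      by_contra h4
      exact (hb h4).1 h3
    · exact fun _ => Or.inr (by simp [Function.update_of_ne e2])
    · simp only [State.putR_narr, State.putN_narr, State.putR_rarr, State.putN_rarr, if_true]
      rw [Function.update_of_ne e1, Function.update_self, Function.update_of_ne e1]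
      intro h3
      exact (hb h3).2.le
    · simp [Function.update_of_ne e2]
    · simp [hl]
    · simp

theorem treeSet_runs {s : State} {N i : ℕ} (hN : s.nvar 3 = N) (hi : s.nvar 8 = i) (hiN : i < N)
    (hs : IsTree N (s.narr 8) (s.rarr 1)) :
    Runs treeSet s (100 * (Nat.log 2 (N + N) + 1)) fun s' =>
      IsTree N (s'.narr 8) (s'.rarr 1) ∧
      s'.narr 8 (N + i) = s.nvar 9 ∧ s'.rarr 1 (N + i) = s.rvar 1 ∧
      ∀ l, N ≤ l → l ≠ N + i → s'.narr 8 l = s.narr 8 l ∧ s'.rarr 1 l = s.rarr 1 l := by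
  set s₁ : State := (((s.setN 7 (N + i)).putN 8 (N + i) (s.nvar 9)).putR 1 (N + i) (s.rvar 1))
    with hs₁
  have hrun := Runs.loop (b := .nlt (.const 1) (.var 7))
    (c := .nset 7 (.half (.var 7)) ;; treePull) (s₀ := s₁)
    -- On the way up only the parent of the current node may be inconsistent. When the root is
    -- reached this is node `0`, which is not in the tree. Halving lowers the logarithm by one.
    (fun s' => 1 ≤ s'.nvar 7 ∧ s'.nvar 7 < N + N ∧
      (∀ l, 1 ≤ l → l < N → l ≠ s'.nvar 7 / 2 → TreeNode (s'.narr 8) (s'.rarr 1) l) ∧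
      ∀ l, N ≤ l → s'.narr 8 l = s₁.narr 8 l ∧ s'.rarr 1 l = s₁.rarr 1 l)
    (fun s' => 90 * Nat.log 2 (s'.nvar 7)) ?_ ?_
  · refine Runs.seq (B₁ := 4) (P := fun s' => s' = s.setN 7 (N + i)) ?_ (fun s' _ hs' => ?_)
      (B₂ := 90 * Nat.log 2 (N + N) + 12) (by omega)
    · exact Runs.straight rfl (by decide) (by simp [Cmd.run, hN, hi])
    refine Runs.seq (B₁ := 3) (P := fun s' => s' = (s.setN 7 (N + i)).putN 8 (N + i) (s.nvar 9))
      ?_ (fun s' _ hs' => ?_) (B₂ := 90 * Nat.log 2 (N + N) + 9) (by omega)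
    · exact Runs.straight rfl (by decide) (by simp [Cmd.run, hs'])
    refine Runs.seq (B₁ := 3) (P := fun s' => s' = s₁)
      ?_ (fun s' _ hs' => ?_) (B₂ := 90 * Nat.log 2 (N + N) + 5) (by omega)
    · exact Runs.straight rfl (by decide) (by simp [Cmd.run, hs', hs₁])
    rw [hs']
    refine hrun.mono ?_ ?_
    · have : Nat.log 2 (s₁.nvar 7) ≤ Nat.log 2 (N + N) :=
        Nat.log_mono_right (by simp [hs₁]; omega)
      simp only [BExp.cost, NExp.cost]
      omega
    · rintro s' - ⟨⟨h1, h2, h3, h4⟩, h5⟩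
      simp only [BExp.Holds, NExp.eval] at h5
      refine ⟨fun l hl hlN => h3 l hl hlN (by omega), ?_, ?_, fun l hl hne => ?_⟩
      · rw [(h4 _ (by omega)).1]; simp [hs₁]
      · rw [(h4 _ (by omega)).2]; simp [hs₁]
      · rw [(h4 l hl).1, (h4 l hl).2]; simp [hs₁, hne]
  · refine ⟨?_, ?_, fun l hl hlN hne => ?_, fun l hl => ⟨rfl, rfl⟩⟩
    · simp [hs₁]; omega
    · simp [hs₁]; omega
    · have h7 : s₁.nvar 7 = N + i := by simp [hs₁]
      have hn := hs l hl hlN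
      rw [h7] at hne
      have e : ∀ l', l' ≠ N + i →
          s₁.narr 8 l' = s.narr 8 l' ∧ s₁.rarr 1 l' = s.rarr 1 l' := fun l' h' => by
        simp [hs₁, h']
      exact hn.congr (e _ (by omega)) (e _ (by omega)) (e _ (by omega))
  · rintro s' - ⟨h1, h2, h3, h4⟩ h5
    simp only [BExp.Holds, NExp.eval] at h5
    refine ⟨80, Runs.straight rfl (by decide) ?_⟩
    set s₂ : State := s'.setN 7 (s'.nvar 7 / 2) with hs₂
    have h7 : s₂.nvar 7 = s'.nvar 7 / 2 := by simp [hs₂]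
    have hr : Cmd.run (.nset 7 (.half (.var 7)) ;; treePull) s' = treePull.run s₂ := rfl
    obtain ⟨g1, g2, g3⟩ := treePull_run s₂ (by omega)
    rw [hr]
    refine ⟨⟨?_, ?_, fun l hl hlN hne => ?_, fun l hl => ?_⟩, ?_⟩
    · rw [g3]; omega
    · rw [g3]; omega
    · rw [g3] at hne
      by_cases hl7 : l = s₂.nvar 7
      · rw [hl7]; exact g1
      · have hn := h3 l hl hlN (by omega)
        exact hn.congr (g2 l hl7) (g2 (l + l) (by omega)) (g2 (l + l + 1) (by omega))
    · have := g2 l (by omega)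
      rw [this.1, this.2]
      exact h4 l hl
    · rw [g3, h7]
      have : Nat.log 2 (s'.nvar 7) = Nat.log 2 (s'.nvar 7 / 2) + 1 :=
        Nat.log_of_one_lt_of_le (by norm_num) (by omega)
      simp only [BExp.cost, NExp.cost]
      omega

end RealRAM

namespace RealRAM

/-- The tree is a priority queue that contains the elements `i` of `A`, with the keys `key i`. -/
structure Queue (N : ℕ) (A : Finset ℕ) (key : ℕ → ℝ) (s : State) : Prop where
  size : s.nvar 3 = N
  tree : IsTree N (s.narr 8) (s.rarr 1)
  lt : ∀ i ∈ A, i < N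
  mem : ∀ i ∈ A, s.narr 8 (N + i) = i + 1 ∧ s.rarr 1 (N + i) = key i
  notMem : ∀ i < N, i ∉ A → s.narr 8 (N + i) = 0

theorem Queue.congr {N : ℕ} {A : Finset ℕ} {key : ℕ → ℝ} {s s' : State} (h : Queue N A key s)
    (h3 : s'.nvar 3 = s.nvar 3) (h8 : s'.narr 8 = s.narr 8) (h1 : s'.rarr 1 = s.rarr 1) :
    Queue N A key s' := by
  refine ⟨h3.trans h.size, ?_, h.lt, ?_, ?_⟩ <;> rw [h8]
  · rw [h1]; exact h.tree
  · rw [h1]; exact h.mem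
  · exact h.notMem

theorem Queue.congr_key {N : ℕ} {A : Finset ℕ} {key key' : ℕ → ℝ} {s : State}
    (h : Queue N A key s) (hk : ∀ i ∈ A, key' i = key i) : Queue N A key' s :=
  ⟨h.size, h.tree, h.lt, fun i hi => by rw [hk i hi]; exact h.mem i hi, h.notMem⟩

theorem Queue.eq_empty {N : ℕ} {A : Finset ℕ} {key : ℕ → ℝ} {s : State} (h : Queue N A key s)
    (h0 : s.narr 8 1 = 0) : A = ∅ := by
  refine Finset.eq_empty_of_forall_notMem fun i hi => ?_
  have := h.lt i hi
  exact (h.tree.root_le (N + i) (by omega) (by omega) (by rw [(h.mem i hi).1]; omega)).1 h0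

theorem Queue.root {N : ℕ} {A : Finset ℕ} {key : ℕ → ℝ} {s : State} (h : Queue N A key s)
    (hN : 1 ≤ N) (h0 : s.narr 8 1 ≠ 0) :
    ∃ i ∈ A, s.narr 8 1 = i + 1 ∧ s.rarr 1 1 = key i ∧ ∀ j ∈ A, key i ≤ key j := by
  obtain ⟨i, hi, h1, h2⟩ := h.tree.exists_leaf 1 le_rfl (by omega) h0
  have hiA : i ∈ A := by
    by_contra hc
    exact h0 (h1.trans (h.notMem i hi hc))
  have hm := h.mem i hiA
  refine ⟨i, hiA, h1.trans hm.1, h2.trans hm.2, fun j hj => ?_⟩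
  have hj' := h.lt j hj
  have := (h.tree.root_le (N + j) (by omega) (by omega) (by rw [(h.mem j hj).1]; omega)).2
  rwa [h2, hm.2, (h.mem j hj).2] at this

/-- Make the queue empty. -/
def queueClear : Cmd := .forUp 4 (.add (.var 3) (.var 3)) (.nput 8 (.var 4) (.const 0))

/-- The keys need not be reset, because the conditions on a node concern the keys of nonempty nodes
only. -/
theorem queueClear_runs {s : State} {N : ℕ} (hN : s.nvar 3 = N) (key : ℕ → ℝ) :
    Runs queueClear s (50 * N + 20) (Queue N ∅ key) := by
  refine Runs.forUp (N := N + N) (B := 3) (fun i s' => ∀ l < i, s'.narr 8 l = 0) rfl ?_ ?_ ?_ ?_ ?_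
  · intro s' h
    simp [h.nvar 3 rfl, hN]
  · simp
  · intro i s' hi ha hx hI
    refine Runs.straight rfl (by decide) ?_
    intro l hl
    simp only [Cmd.run, NExp.eval, hx, State.setN_narr, State.putN_narr, if_true]
    rcases eq_or_ne l i with rfl | hne
    · simp
    · rw [Function.update_of_ne hne]
      exact hI l (by omega)
  · simp only [NExp.cost]; omega
  · intro s' ha _ hI
    refine ⟨(ha.nvar 3 rfl).trans hN, fun l h1 h2 => ?_, by simp, by simp, fun i hi _ => ?_⟩
    · refine ⟨fun _ => ⟨hI _ (by omega), hI _ (by omega)⟩, fun h => absurd (hI l (by omega)) h,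
        fun h => absurd (hI _ (by omega)) h, fun h => absurd (hI _ (by omega)) h⟩
    · exact hI _ (by omega)

/-- The leaf stores `i + 1` because `0` means empty. The element may already be in `A`, so the same
operation also decreases keys. The keys of the leaves are tracked outside `A` as well, since they
double as an array of labels. -/
theorem queueInsert_runs {s : State} {N i : ℕ} {A : Finset ℕ} {key : ℕ → ℝ}
    (h : Queue N A key s) (hi : s.nvar 8 = i) (hiN : i < N) (h9 : s.nvar 9 = i + 1) :
    Runs treeSet s (100 * (Nat.log 2 (N + N) + 1)) fun s' =>
      Queue N (insert i A) (Function.update key i (s.rvar 1)) s' ∧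
      s'.rarr 1 (N + i) = s.rvar 1 ∧
      ∀ l, N ≤ l → l ≠ N + i → s'.rarr 1 l = s.rarr 1 l := by
  refine (treeSet_runs h.size hi hiN h.tree).mono le_rfl ?_
  rintro s' ha ⟨h1, h2, h3, h4⟩
  refine ⟨⟨(ha.nvar 3 rfl).trans h.size, h1, ?_, ?_, ?_⟩, h3, fun l hl hne => (h4 l hl hne).2⟩
  · intro j hj
    rcases Finset.mem_insert.1 hj with rfl | hj
    exacts [hiN, h.lt j hj]
  · intro j hj
    rcases eq_or_ne j i with rfl | hne
    · exact ⟨h2.trans h9, by rw [h3, Function.update_self]⟩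
    · have hm := h.mem j ((Finset.mem_insert.1 hj).resolve_left hne)
      have := h4 (N + j) (by omega) (by omega)
      rw [this.1, this.2, Function.update_of_ne hne]
      exact hm
  · intro j hj hjA
    rw [Finset.mem_insert, not_or] at hjA
    rw [(h4 (N + j) (by omega) (by omega)).1]
    exact h.notMem j hj hjA.2

/-- Only the mark of the leaf is removed; its key is rewritten from the register, so that the label
of an extracted element survives. -/
theorem queueErase_runs {s : State} {N i : ℕ} {A : Finset ℕ} {key : ℕ → ℝ}
    (h : Queue N A key s) (hi : s.nvar 8 = i) (hiN : i < N) (h9 : s.nvar 9 = 0) :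
    Runs treeSet s (100 * (Nat.log 2 (N + N) + 1)) fun s' => Queue N (A.erase i) key s' ∧
      s'.rarr 1 (N + i) = s.rvar 1 ∧
      ∀ l, N ≤ l → l ≠ N + i → s'.rarr 1 l = s.rarr 1 l := by
  refine (treeSet_runs h.size hi hiN h.tree).mono le_rfl ?_
  rintro s' ha ⟨h1, h2, h3, h4⟩
  refine ⟨⟨(ha.nvar 3 rfl).trans h.size, h1, fun j hj => h.lt j (Finset.mem_of_mem_erase hj), ?_,
    ?_⟩, h3, fun l hl hne => (h4 l hl hne).2⟩
  · intro j hj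
    have := h4 (N + j) (by omega) (by have := Finset.ne_of_mem_erase hj; omega)
    rw [this.1, this.2]
    exact h.mem j (Finset.mem_of_mem_erase hj)
  · intro j hj hjA
    rcases eq_or_ne j i with rfl | hne
    · exact h2.trans h9
    · rw [(h4 (N + j) (by omega) (by omega)).1]
      exact h.notMem j hj fun h' => hjA (Finset.mem_erase.2 ⟨hne, h'⟩)

/-- Empty the queue, writing its elements and their keys in increasing order of the keys into the
arrays `a` and `b` and their number into register `10`. -/
def queueDrain (a b : ℕ) : Cmd :=
  .nset 10 (.const 0) ;;
  .loop (.not (.neq (.get 8 (.const 1)) (.const 0)))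
    ((.nset 8 (.sub (.get 8 (.const 1)) (.const 1)) ;; .rset 1 (.get 1 (.const 1)) ;;
        .nput a (.var 10) (.var 8) ;; .rput b (.var 10) (.var 1) ;; .nset 9 (.const 0)) ;;
      treeSet ;; .nset 10 (.add (.var 10) (.const 1)))

theorem queueDrain_runs {s : State} {N a b : ℕ} (ha : a ≠ 8) (hb : b ≠ 1) (hN : 1 ≤ N)
    {A : Finset ℕ} {key : ℕ → ℝ} (h : Queue N A key s) :
    Runs (queueDrain a b) s (150 * A.card * (Nat.log 2 (N + N) + 1) + 20) fun s' =>
      s'.nvar 10 = A.card ∧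
      (∀ c < A.card, s'.narr a c ∈ A ∧ s'.rarr b c = key (s'.narr a c)) ∧
      (∀ i ∈ A, ∃ c < A.card, s'.narr a c = i) ∧
      ∀ c c', c ≤ c' → c' < A.card → s'.rarr b c ≤ s'.rarr b c' := by
  refine Runs.seq (B₁ := 2) (P := fun s' => s' = s.setN 10 0)
    (Runs.straight rfl (by simp [Cmd.maxCost, NExp.cost]) (by simp [Cmd.run]))
    (B₂ := 150 * A.card * (Nat.log 2 (N + N) + 1) + 10) ?_ (by omega)
  rintro s₁ - rfl
  set lg := Nat.log 2 (N + N) with hlg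
  have hloop := Runs.loop (b := .not (.neq (.get 8 (.const 1)) (.const 0)))
    (c := (.nset 8 (.sub (.get 8 (.const 1)) (.const 1)) ;; .rset 1 (.get 1 (.const 1)) ;;
        .nput a (.var 10) (.var 8) ;; .rput b (.var 10) (.var 1) ;; .nset 9 (.const 0)) ;;
      treeSet ;; .nset 10 (.add (.var 10) (.const 1))) (s₀ := s.setN 10 0)
    -- The last clause keeps the output sorted: nothing written so far exceeds any remaining key.
    (fun s' => ∃ A' ⊆ A, Queue N A' key s' ∧ s'.nvar 10 + A'.card = A.card ∧
      (∀ c < s'.nvar 10, s'.narr a c ∈ A ∧ s'.rarr b c = key (s'.narr a c)) ∧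
      (∀ i ∈ A, i ∉ A' → ∃ c < s'.nvar 10, s'.narr a c = i) ∧
      (∀ c c', c ≤ c' → c' < s'.nvar 10 → s'.rarr b c ≤ s'.rarr b c') ∧
      ∀ c < s'.nvar 10, ∀ i ∈ A', s'.rarr b c ≤ key i)
    (fun s' => (A.card - s'.nvar 10) * (150 * (lg + 1))) ?_ ?_
  · refine hloop.mono ?_ ?_
    · simp only [State.setN_nvar, if_true, BExp.cost, NExp.cost]
      rw [Nat.sub_zero, ← mul_assoc, mul_comm A.card 150]
      omega
    · rintro s' - ⟨⟨A', -, hq, hcard, h1, h2, h3, -⟩, hend⟩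
      have : A' = ∅ := hq.eq_empty (by simpa using hend)
      subst this
      simp only [Finset.card_empty, add_zero] at hcard
      rw [hcard] at h1 h2 h3
      exact ⟨hcard, h1, fun i hi => h2 i hi (by simp), h3⟩
  · refine ⟨A, subset_rfl, h.congr (by simp) rfl rfl, by simp, by simp, ?_, by simp, by simp⟩
    intro i hi hi'
    exact absurd hi hi'
  · rintro s' - ⟨A', hA', hq, hcard, h1, h2, h3, h4⟩ hb0
    obtain ⟨i, hi, hi1, hi2, hi3⟩ := hq.root hN (by simpa using hb0)
    have hcard' : (A'.erase i).card + 1 = A'.card := Finset.card_erase_add_one hi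
    set c₀ := s'.nvar 10 with hc₀
    refine ⟨100 * (lg + 1) + 30, ?_⟩
    refine Runs.seq (B₁ := 20) (B₂ := 100 * (lg + 1) + 10)
      (P := fun s₂ => s₂.nvar 8 = i ∧ s₂.nvar 9 = 0 ∧ s₂.rvar 1 = key i ∧ s₂.nvar 10 = c₀ ∧
        s₂.narr a = Function.update (s'.narr a) c₀ i ∧
        s₂.rarr b = Function.update (s'.rarr b) c₀ (key i) ∧
        Queue N A' key s₂) ?_ ?_ (by omega)
    · refine Runs.straight rfl (by simp [Cmd.maxCost, NExp.cost, RExp.cost]) ?_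
      refine ⟨?_, ?_, ?_, ?_, ?_, ?_, hq.congr ?_ ?_ ?_⟩ <;>
        simp [Cmd.run, hi1, hi2, ha.symm, hb.symm, hc₀]
    rintro s₂ - ⟨e1, e2, e3, e4, e5, e6, hq₂⟩
    refine Runs.seq (B₁ := 100 * (lg + 1)) (B₂ := 10)
      (queueErase_runs hq₂ e1 (hq.lt i hi) e2) ?_ le_rfl
    rintro s₃ hag ⟨hq₃, -, -⟩
    have f1 : s₃.nvar 10 = c₀ := (hag.nvar 10 rfl).trans e4
    have f2 : s₃.narr a = Function.update (s'.narr a) c₀ i :=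
      (hag.narr a (by simp [treeSet, treePull, Cmd.writesNA, ha.symm])).trans e5
    have f3 : s₃.rarr b = Function.update (s'.rarr b) c₀ (key i) :=
      (hag.rarr b (by simp [treeSet, treePull, Cmd.writesRA, hb.symm])).trans e6
    refine Runs.straight rfl (by simp [Cmd.maxCost, NExp.cost]) ?_
    have hrun : Cmd.run (.nset 10 (.add (.var 10) (.const 1))) s₃ = s₃.setN 10 (c₀ + 1) := by
      simp [Cmd.run, f1]
    rw [hrun]
    have hnv : (s₃.setN 10 (c₀ + 1)).nvar 10 = c₀ + 1 := by simp
    refine ⟨⟨A'.erase i, (Finset.erase_subset _ _).trans hA', hq₃.congr (by simp) rfl rfl,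
      ?_, ?_, ?_, ?_, ?_⟩, ?_⟩
    · rw [hnv]; omega
    · rw [hnv, State.setN_narr, State.setN_rarr, f2, f3]
      intro c hc
      rcases eq_or_ne c c₀ with rfl | hne
      · simpa using hA' hi
      · rw [Function.update_of_ne hne, Function.update_of_ne hne]
        exact h1 c (by omega)
    · rw [hnv, State.setN_narr, f2]
      intro j hj hj'
      rcases eq_or_ne j i with rfl | hne
      · exact ⟨c₀, by omega, by simp⟩
      · obtain ⟨c, hc, hcj⟩ := h2 j hj fun h' => hj' (Finset.mem_erase.2 ⟨hne, h'⟩)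
        exact ⟨c, by omega, by rw [Function.update_of_ne (by omega), hcj]⟩
    · rw [hnv, State.setN_rarr, f3]
      intro c c' hcc hc'
      rcases eq_or_ne c' c₀ with rfl | hne
      · rw [Function.update_self]
        rcases eq_or_ne c c₀ with rfl | hne
        · rw [Function.update_self]
        · rw [Function.update_of_ne hne]
          exact h4 c (by omega) i hi
      · rw [Function.update_of_ne hne, Function.update_of_ne (by omega)]
        exact h3 c c' hcc (by omega)
    · rw [hnv, State.setN_rarr, f3]
      intro c hc j hj
      rcases eq_or_ne c c₀ with rfl | hne
      · rw [Function.update_self]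
        exact hi3 j (Finset.mem_of_mem_erase hj)
      · rw [Function.update_of_ne hne]
        exact h4 c (by omega) j (Finset.mem_of_mem_erase hj)
    · rw [hnv]
      have : A.card - c₀ = (A.card - (c₀ + 1)) + 1 := by omega
      rw [this, add_mul, one_mul]
      simp only [BExp.cost, NExp.cost]
      omega

end RealRAM

/-! ### Numbering of pairs and adjacency lists -/

namespace Dilation

open RealRAM

theorem pair_index_inj {n u v u' v' : ℕ} (hv : v < n) (hv' : v' < n)
    (h : u * n + v = u' * n + v') : u = u' ∧ v = v' := by
  have hn : 0 < n := by omega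
  have h1 : (u * n + v) / n = u := by
    rw [mul_comm, Nat.mul_add_div hn, Nat.div_eq_of_lt hv, add_zero]
  have h2 : (u' * n + v') / n = u' := by
    rw [mul_comm, Nat.mul_add_div hn, Nat.div_eq_of_lt hv', add_zero]
  have : u = u' := by rw [← h1, h, h2]
  subst this
  exact ⟨rfl, by omega⟩

theorem pair_index_lt {n u v : ℕ} (hu : u < n) (hv : v < n) : u * n + v < n * n := by
  have : (u + 1) * n ≤ n * n := Nat.mul_le_mul_right n hu
  rw [add_mul, one_mul] at this
  omega

theorem exists_pair_index {n q : ℕ} (hq : q < n * n) :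
    ∃ u v : Fin n, q = u * n + v := by
  have hn : 0 < n := by
    rcases Nat.eq_zero_or_pos n with rfl | h
    · simp at hq
    · exact h
  exact ⟨⟨q / n, Nat.div_lt_of_lt_mul hq⟩, ⟨q % n, Nat.mod_lt _ hn⟩,
    by rw [mul_comm]; exact (Nat.div_add_mod q n).symm⟩

/-- Register `3` contains `n * n`, and the pair `(u, v)` of vertices has the number `u * n + v`:
array `2` contains the products `u * n`, and the arrays `3` and `4` the components of the pairs. -/
structure Tables (n : ℕ) (s : State) : Prop where
  vertices : s.nvar 0 = n
  size : s.nvar 3 = n * n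
  row : ∀ u < n, s.narr 2 u = u * n
  fst : ∀ u < n, ∀ v < n, s.narr 3 (u * n + v) = u
  snd : ∀ u < n, ∀ v < n, s.narr 4 (u * n + v) = v

theorem Tables.congr {n : ℕ} {s s' : State} (h : Tables n s) (h0 : s'.nvar 0 = s.nvar 0)
    (h3 : s'.nvar 3 = s.nvar 3) (a2 : s'.narr 2 = s.narr 2) (a3 : s'.narr 3 = s.narr 3)
    (a4 : s'.narr 4 = s.narr 4) : Tables n s' :=
  ⟨h0.trans h.vertices, h3.trans h.size, by rw [a2]; exact h.row, by rw [a3]; exact h.fst,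
    by rw [a4]; exact h.snd⟩

theorem Tables.agree {n : ℕ} {s s' : State} {c : Cmd} (h : Tables n s) (ha : Agree c s s')
    (h0 : c.writesN 0 = false) (h3 : c.writesN 3 = false) (a2 : c.writesNA 2 = false)
    (a3 : c.writesNA 3 = false) (a4 : c.writesNA 4 = false) : Tables n s' :=
  h.congr (ha.nvar 0 h0) (ha.nvar 3 h3) (ha.narr 2 a2) (ha.narr 3 a3) (ha.narr 4 a4)

/-- Natural numbers cannot be multiplied or divided by `n` at unit cost, so the row offsets, the
components of pairs and `n * n` are tabulated with a running counter. -/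
def tablesInit : Cmd :=
  .nset 6 (.const 0) ;;
  .forUp 4 (.var 0) (.nput 2 (.var 4) (.var 6) ;;
    .forUp 5 (.var 0) (.nput 3 (.var 6) (.var 4) ;; .nput 4 (.var 6) (.var 5) ;;
      .nset 6 (.add (.var 6) (.const 1)))) ;;
  .nset 3 (.var 6)

theorem tablesInit_runs {s : State} {n : ℕ} (hs : s.nvar 0 = n) (hn : 1 ≤ n) :
    Runs tablesInit s (100 * (n * n)) (Tables n) := by
  have hnn : n ≤ n * n := Nat.le_mul_self n
  refine Runs.seq (B₁ := 2) (B₂ := 50 * (n * n) + 30) (P := fun s' => s' = s.setN 6 0)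
    (Runs.straight rfl (by decide) rfl) ?_ (by omega)
  rintro s₁ - rfl
  refine Runs.seq (B₁ := 50 * (n * n) + 20) (B₂ := 5) (P := fun s' => s'.nvar 0 = n ∧
      s'.nvar 6 = n * n ∧ (∀ u < n, s'.narr 2 u = u * n) ∧
      ∀ u < n, ∀ v < n, s'.narr 3 (u * n + v) = u ∧ s'.narr 4 (u * n + v) = v) ?_ ?_ (by omega)
  swap
  · rintro s' - ⟨h0, h6, h2, h34⟩
    refine Runs.straight rfl (by decide) ⟨?_, ?_, ?_, ?_, ?_⟩
    · simpa [Cmd.run] using h0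
    · simpa [Cmd.run] using h6
    · exact h2
    · exact fun u hu v hv => (h34 u hu v hv).1
    · exact fun u hu v hv => (h34 u hu v hv).2
  refine Runs.forUp (N := n) (B := 20 * n + 10) (fun i s' => s'.nvar 6 = i * n ∧
      (∀ u < i, s'.narr 2 u = u * n) ∧
      ∀ u < i, ∀ v < n, s'.narr 3 (u * n + v) = u ∧ s'.narr 4 (u * n + v) = v) rfl ?_ ?_ ?_ ?_ ?_
  · intro s' h
    simp [h.nvar 0 rfl, hs]
  · simp
  · rintro i s' hi hag hx ⟨h6, h2, h34⟩
    have h0 : s'.nvar 0 = n := (hag.nvar 0 rfl).trans (by simp [hs])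
    refine Runs.seq (B₁ := 3) (B₂ := 20 * n + 7) (P := fun s₂ => s₂ = s'.putN 2 i (i * n))
      (Runs.straight rfl (by decide) (by simp [Cmd.run, hx, h6])) ?_ (by omega)
    rintro s₂ - rfl
    refine Runs.forUp (N := n) (B := 10) (fun j s₃ => s₃.nvar 6 = i * n + j ∧
        (∀ u ≤ i, s₃.narr 2 u = u * n) ∧
        ∀ u v, v < n → (u < i ∨ u = i ∧ v < j) →
          s₃.narr 3 (u * n + v) = u ∧ s₃.narr 4 (u * n + v) = v) rfl ?_ ?_ ?_ ?_ ?_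
    · intro s₃ h
      simp [h.nvar 0 rfl, h0]
    · refine ⟨by simpa using h6, fun u hu => ?_, ?_⟩
      · rcases eq_or_ne u i with rfl | hne
        · simp
        · simpa [hne] using h2 u (by omega)
      · intro u v hv huv
        simpa using h34 u (by omega) v hv
    · rintro j s₃ hj hag₃ hx₃ ⟨g6, g2, g34⟩
      have g4 : s₃.nvar 4 = i := (hag₃.nvar 4 rfl).trans (by simpa using hx)
      refine Runs.straight rfl (by decide) ⟨?_, ?_, ?_⟩
      · simp [Cmd.run, g6]; omega
      · simpa [Cmd.run] using g2
      · intro u v hv huv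
        simp only [Cmd.run, NExp.eval, State.setN_narr, State.putN_narr, State.putN_nvar, g6, g4,
          hx₃]
        by_cases heq : u * n + v = i * n + j
        · obtain ⟨rfl, rfl⟩ := pair_index_inj hv hj heq
          simp
        · have : u < i ∨ u = i ∧ v < j := by
            rcases huv with h | ⟨rfl, h⟩
            · exact Or.inl h
            · refine Or.inr ⟨rfl, ?_⟩
              have : v ≠ j := fun h => heq (by rw [h])
              omega
          simpa [heq] using g34 u v hv this
    · simp only [NExp.cost]; omega
    · rintro s₃ - - ⟨g6, g2, g34⟩
      refine ⟨?_, ?_, ?_⟩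
      · simp [g6]; ring
      · intro u hu
        simpa using g2 u (by omega)
      · intro u hu v hv
        simpa using g34 u v hv (by omega)
  · simp only [NExp.cost]
    have : n * (20 * n + 10 + 1 + 7) = 20 * (n * n) + 18 * n := by ring
    omega
  · rintro s' hag - ⟨h6, h2, h34⟩
    exact ⟨(hag.nvar 0 rfl).trans (by simp [hs]), h6, h2, h34⟩

/-- The arrays `5`, `6`, `7` contain adjacency lists of a relation with `c` pairs: the list of `v`
has length `s.narr 6 v` and begins at the cell `s.narr 7 v` of array `5`. -/
structure AdjLists (n c w : ℕ) (R : ℕ → ℕ → Prop) (s : State) : Prop where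
  base : ∀ v < n, s.narr 7 v = v * w
  mem : ∀ v < n, ∀ x, (∃ l < s.narr 6 v, s.narr 5 (v * w + l) = x) ↔ R v x
  sum : ∑ v ∈ Finset.range n, s.narr 6 v = c

theorem AdjLists.degree_le {n c w : ℕ} {R : ℕ → ℕ → Prop} {s : State} (h : AdjLists n c w R s)
    {v : ℕ} (hv : v < n) : s.narr 6 v ≤ c :=
  h.sum ▸ Finset.single_le_sum (f := fun v => s.narr 6 v) (fun _ _ => Nat.zero_le _)
    (Finset.mem_range.2 hv)

/-- Append the entry of array `y` to the list of the entry of array `x`, for the index in register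
`4`. -/
def adjAppend (x y : ℕ) : Cmd :=
  .nput 5 (.add (.get 7 (.get x (.var 4))) (.get 6 (.get x (.var 4)))) (.get y (.var 4)) ;;
  .nput 6 (.get x (.var 4)) (.add (.get 6 (.get x (.var 4))) (.const 1))

theorem adjAppend_run {n c w x y u v : ℕ} {R : ℕ → ℕ → Prop} {s : State}
    (h : AdjLists n c w R s) (hc : c < w) (hx5 : x ≠ 5) (hx : s.narr x (s.nvar 4) = u)
    (hy : s.narr y (s.nvar 4) = v) (hu : u < n) :
    AdjLists n (c + 1) w (fun a b => R a b ∨ a = u ∧ b = v) ((adjAppend x y).run s) := by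
  have hdeg := h.degree_le hu
  have hrun : (adjAppend x y).run s =
      (s.putN 5 (u * w + s.narr 6 u) v).putN 6 u (s.narr 6 u + 1) := by
    simp [adjAppend, Cmd.run, hx, hy, h.base u hu, hx5]
  rw [hrun]
  refine ⟨?_, ?_, ?_⟩
  · simpa using h.base
  · intro a ha b
    simp only [State.putN_narr]
    norm_num
    rcases eq_or_ne a u with rfl | hne
    · rw [Function.update_self]
      constructor
      · rintro ⟨l, hl, hb⟩
        rcases eq_or_ne l (s.narr 6 a) with rfl | hl'
        · simp only [Function.update_self] at hb
          exact Or.inr ⟨rfl, hb.symm⟩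
        · rw [Function.update_of_ne (by omega)] at hb
          exact Or.inl ((h.mem a ha b).1 ⟨l, by omega, hb⟩)
      · rintro (hR | ⟨-, rfl⟩)
        · obtain ⟨l, hl, hb⟩ := (h.mem a ha b).2 hR
          exact ⟨l, by omega, by rw [Function.update_of_ne (by omega)]; exact hb⟩
        · exact ⟨s.narr 6 a, by omega, by simp⟩
    · rw [Function.update_of_ne hne]
      simp only [hne, false_and, or_false]
      rw [← h.mem a ha b]
      refine exists_congr fun l => and_congr_right fun hl => ?_
      rw [Function.update_of_ne]
      intro heq
      have := h.degree_le ha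
      exact hne (pair_index_inj (by omega) (by omega) heq).1
  · have hsum := h.sum
    simp only [State.putN_narr]
    norm_num
    rw [← Finset.add_sum_erase _ _ (Finset.mem_range.2 hu)] at hsum ⊢
    rw [Function.update_self, Finset.sum_congr rfl (g := fun v => s.narr 6 v)]
    · omega
    · intro a ha
      rw [Function.update_of_ne (Finset.ne_of_mem_erase ha)]

/-- Each vertex gets a block of `2 * m` cells, enough for all entries together, so no degrees have
to be counted beforehand. Only time is charged, and the blocks are not initialised. -/
def adjInit : Cmd :=
  .nset 6 (.const 0) ;;
  .forUp 4 (.var 0) (.nput 7 (.var 4) (.var 6) ;; .nput 6 (.var 4) (.const 0) ;;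
    .nset 6 (.add (.var 6) (.add (.var 1) (.var 1)))) ;;
  .forUp 4 (.var 1) (adjAppend 0 1 ;; adjAppend 1 0)

theorem adjInit_runs {s : State} {n m : ℕ} (h0 : s.nvar 0 = n) (h1 : s.nvar 1 = m)
    (hlt : ∀ i < m, s.narr 0 i < n ∧ s.narr 1 i < n) :
    Runs adjInit s (100 * (n + m + 1)) (AdjLists n (2 * m) (2 * m) fun a b =>
      ∃ i < m, (a = s.narr 0 i ∧ b = s.narr 1 i) ∨ (a = s.narr 1 i ∧ b = s.narr 0 i)) := by
  refine Runs.seq (B₁ := 2) (B₂ := 100 * (n + m) + 90) (P := fun s' => s' = s.setN 6 0)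
    (Runs.straight rfl (by decide) rfl) ?_ (by omega)
  rintro s₁ - rfl
  refine Runs.seq (B₁ := 30 * n + 10) (B₂ := 100 * m + 10)
    (P := AdjLists n 0 (2 * m) fun _ _ => False) ?_ ?_ (by omega)
  · refine Runs.forUp (N := n) (B := 15) (fun i s' => s'.nvar 6 = i * (2 * m) ∧
      ∀ v < i, s'.narr 7 v = v * (2 * m) ∧ s'.narr 6 v = 0) rfl ?_ ?_ ?_ ?_ ?_
    · intro s' h
      simp [h.nvar 0 rfl, h0]
    · simp
    · rintro i s' hi hag hx ⟨h6, hv⟩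
      have g1 : s'.nvar 1 = m := (hag.nvar 1 rfl).trans (by simpa using h1)
      refine Runs.straight rfl (by decide) ⟨?_, fun v hvi => ?_⟩
      · simp [Cmd.run, h6, g1]; ring
      · rcases eq_or_ne v i with rfl | hne
        · simp [Cmd.run, h6, hx]
        · simpa [Cmd.run, h6, hx, hne] using hv v (by omega)
    · simp only [NExp.cost]; omega
    · rintro s' - - ⟨-, hv⟩
      refine ⟨fun v hvn => (hv v hvn).1, fun v hvn x => ?_, ?_⟩
      · simp [(hv v hvn).2]
      · exact Finset.sum_eq_zero fun v hvn => (hv v (Finset.mem_range.1 hvn)).2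
  · intro s₂ hag₂ hadj
    have g1 : s₂.nvar 1 = m := (hag₂.nvar 1 rfl).trans (by simpa using h1)
    have a0 : s₂.narr 0 = s.narr 0 := hag₂.narr 0 rfl
    have a1 : s₂.narr 1 = s.narr 1 := hag₂.narr 1 rfl
    refine Runs.forUp (N := m) (B := 80) (fun i => AdjLists n (2 * i) (2 * m) fun a b =>
      ∃ j < i, (a = s.narr 0 j ∧ b = s.narr 1 j) ∨ (a = s.narr 1 j ∧ b = s.narr 0 j))
      rfl ?_ ?_ ?_ ?_ ?_
    · intro s' h
      simp [h.nvar 1 rfl, g1]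
    · refine ⟨hadj.base, ?_, hadj.sum⟩
      simpa using hadj.mem
    · intro i s' hi hag hx hI
      have b0 : s'.narr 0 = s.narr 0 := (hag.narr 0 rfl).trans a0
      have b1 : s'.narr 1 = s.narr 1 := (hag.narr 1 rfl).trans a1
      refine Runs.straight rfl (by decide) ?_
      have k1 := adjAppend_run (x := 0) (y := 1) hI (by omega) (by norm_num)
        (u := s.narr 0 i) (v := s.narr 1 i) (by rw [b0, hx]) (by rw [b1, hx]) (hlt i hi).1
      set s'' := (adjAppend 0 1).run s' with hs''
      have c4 : s''.nvar 4 = i := by simpa [hs'', adjAppend, Cmd.run] using hx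
      have c0 : s''.narr 0 = s.narr 0 := by simpa [hs'', adjAppend, Cmd.run] using b0
      have c1 : s''.narr 1 = s.narr 1 := by simpa [hs'', adjAppend, Cmd.run] using b1
      have k2 := adjAppend_run (x := 1) (y := 0) k1 (by omega) (by norm_num)
        (u := s.narr 1 i) (v := s.narr 0 i) (by rw [c1, c4]) (by rw [c0, c4]) (hlt i hi).2
      have hr : Cmd.run (adjAppend 0 1 ;; adjAppend 1 0) s' = (adjAppend 1 0).run s'' := rfl
      rw [hr]
      refine ⟨k2.base, fun v hv x => (k2.mem v hv x).trans ?_, k2.sum.trans (by ring)⟩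
      constructor
      · rintro ((⟨j, hj, h⟩ | h) | h)
        · exact ⟨j, by omega, h⟩
        · exact ⟨i, by omega, Or.inl h⟩
        · exact ⟨i, by omega, Or.inr h⟩
      · rintro ⟨j, hj, h⟩
        rcases eq_or_ne j i with rfl | hne
        · rcases h with h | h
          · exact Or.inl (Or.inr h)
          · exact Or.inr h
        · exact Or.inl (Or.inl ⟨j, by omega, h⟩)
    · simp only [NExp.cost]; omega
    · exact fun s' _ _ h => h

end Dilation

/-! ### All distances in the graph by Dijkstra's algorithm -/

namespace Dilation

open RealRAM

variable {n : ℕ} {M : Type*} [MetricSpace M]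

/-- The invariant of the computation of all distances in `G`. Array `9` marks the pairs `(u, v)`
for which a path has been found; the label of such a pair is the key of its leaf. The pairs in `A`
are in the queue; the other marked ones have labels at most `x` and, if `C` requires it, have
been propagated along the edges. -/
structure Labels (p : Fin n → M) (G : SimpleGraph (Fin n)) (A : Finset ℕ) (x : ℝ)
    (C : Fin n → Fin n → Fin n → Prop) (Y : Finset ℕ) (s : State) : Prop where
  queue : Queue (n * n) A (fun q => s.rarr 1 (n * n + q)) s
  seen : ∀ q ∈ A, s.narr 9 q ≠ 0
  done : ∀ q ∈ Y, s.narr 9 q ≠ 0 ∧ q ∉ A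
  sound : ∀ u v : Fin n, s.narr 9 (u * n + v) ≠ 0 → 0 ≤ s.rarr 1 (n * n + (u * n + v)) ∧
    graphDist p G u v ≤ ENNReal.ofReal (s.rarr 1 (n * n + (u * n + v)))
  start : ∀ u : Fin n, s.narr 9 (u * n + u) ≠ 0 ∧ s.rarr 1 (n * n + (u * n + u)) ≤ 0
  closed : ∀ u v w : Fin n, C u v w → s.narr 9 (u * n + v) ≠ 0 → u * n + v ∉ A → G.Adj v w →
    s.narr 9 (u * n + w) ≠ 0 ∧ s.rarr 1 (n * n + (u * n + w)) ≤
      s.rarr 1 (n * n + (u * n + v)) + dist (p v) (p w)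
  low : ∀ q < n * n, s.narr 9 q ≠ 0 → q ∉ A → s.rarr 1 (n * n + q) ≤ x
  high : ∀ q ∈ A, x ≤ s.rarr 1 (n * n + q)

theorem Labels.congr {p : Fin n → M} {G : SimpleGraph (Fin n)} {A Y : Finset ℕ} {x : ℝ}
    {C : Fin n → Fin n → Fin n → Prop} {s s' : State} (h : Labels p G A x C Y s)
    (h3 : s'.nvar 3 = s.nvar 3) (h8 : s'.narr 8 = s.narr 8) (h9 : s'.narr 9 = s.narr 9)
    (h1 : s'.rarr 1 = s.rarr 1) : Labels p G A x C Y s' := by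
  refine ⟨?_, ?_, ?_, ?_, ?_, ?_, ?_, ?_⟩ <;> simp only [h9, h1]
  exacts [h.queue.congr h3 h8 h1, h.seen, h.done, h.sound, h.start, h.closed, h.low, h.high]

/-- A strictly better label `y ≥ x` can only arise for a pair that is unmarked or still queued,
since settled labels are at most `x`. Hence settled pairs stay settled, and closedness at them is
not disturbed. -/
theorem Labels.relax_insert {p : Fin n → M} {G : SimpleGraph (Fin n)} {A Y : Finset ℕ} {x y : ℝ}
    {C : Fin n → Fin n → Fin n → Prop} {s s' : State} (h : Labels p G A x C Y s) {u v w : Fin n}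
    (hy : y = x + dist (p v) (p w)) (huv : s.rarr 1 (n * n + (u * n + v)) = x)
    (hY : (u * n + v : ℕ) ∈ Y) (hadj : G.Adj v w)
    (hnew : s.narr 9 (u * n + w) ≠ 0 → y < s.rarr 1 (n * n + (u * n + w)))
    (hq : Queue (n * n) (insert (u * n + w : ℕ) A)
      (Function.update (fun q => s.rarr 1 (n * n + q)) (u * n + w) y) s')
    (hK : s'.rarr 1 (n * n + (u * n + w)) = y)
    (hK' : ∀ l, n * n ≤ l → l ≠ n * n + (u * n + w) → s'.rarr 1 l = s.rarr 1 l)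
    (h9 : s'.narr 9 = Function.update (s.narr 9) (u * n + w) 1) :
    Labels p G (insert (u * n + w : ℕ) A) x (fun a b c => C a b c ∨ a = u ∧ b = v ∧ c = w) Y s' ∧
      s'.rarr 1 (n * n + (u * n + v)) = x := by
  set q₂ : ℕ := u * n + w with hq₂
  have hd : 0 ≤ dist (p v) (p w) := dist_nonneg
  have hlt : q₂ < n * n := pair_index_lt u.2 w.2
  have hnd : s.narr 9 q₂ ≠ 0 → q₂ ∈ A := by
    intro h1
    by_contra h2
    have := h.low q₂ hlt h1 h2
    have := hnew h1
    linarith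
  have hk : ∀ q, q ≠ q₂ → s'.rarr 1 (n * n + q) = s.rarr 1 (n * n + q) := fun q hq =>
    hK' _ (by omega) (by omega)
  have hle : ∀ q, s.narr 9 q ≠ 0 → s'.rarr 1 (n * n + q) ≤ s.rarr 1 (n * n + q) := by
    intro q h1
    rcases eq_or_ne q q₂ with rfl | hne
    · rw [hK]; exact (hnew h1).le
    · exact (hk q hne).le
  have hs9 : ∀ q, s.narr 9 q ≠ 0 → s'.narr 9 q ≠ 0 := by
    intro q h1
    rw [h9]
    rcases eq_or_ne q q₂ with rfl | hne
    · simp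
    · rwa [Function.update_of_ne hne]
  have hs9' : ∀ q, q ≠ q₂ → s'.narr 9 q = s.narr 9 q := fun q hne => by
    rw [h9, Function.update_of_ne hne]
  have hYne : ∀ q ∈ Y, q ≠ q₂ := by
    rintro q hq rfl
    exact (h.done _ hq).2 (hnd (h.done _ hq).1)
  have huv' : s'.rarr 1 (n * n + (u * n + v)) = x := by rw [hk _ (hYne _ hY), huv]
  refine ⟨⟨?_, ?_, ?_, ?_, ?_, ?_, ?_, ?_⟩, huv'⟩
  · refine hq.congr_key fun q _ => ?_
    rcases eq_or_ne q q₂ with rfl | hne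
    · simp [hK]
    · simp [hne, hk q hne]
  · intro q hq
    rcases Finset.mem_insert.1 hq with rfl | hq
    · rw [h9]; simp
    · exact hs9 q (h.seen q hq)
  · intro q hq
    refine ⟨hs9 q (h.done q hq).1, ?_⟩
    rw [Finset.mem_insert, not_or]
    exact ⟨hYne q hq, (h.done q hq).2⟩
  · intro a b hab
    by_cases heq : (a * n + b : ℕ) = q₂
    · obtain ⟨ha, hb⟩ := pair_index_inj b.2 w.2 heq
      obtain rfl := Fin.ext ha
      obtain rfl := Fin.ext hb
      have hs := h.sound a v (h.done _ hY).1
      rw [huv] at hs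
      rw [heq, hK, hy]
      refine ⟨by linarith, (graphDist_triangle p G a v b).trans ?_⟩
      rw [ENNReal.ofReal_add hs.1 hd, ← edist_dist]
      exact add_le_add hs.2 (graphDist_le_edist_of_adj p hadj)
    · rw [hs9' _ heq] at hab
      rw [hk _ heq]
      exact h.sound a b hab
  · intro a
    have := h.start a
    exact ⟨hs9 _ this.1, (hle _ this.1).trans this.2⟩
  · rintro a b c hC h1 h2 h3
    rw [Finset.mem_insert, not_or] at h2
    rw [hs9' _ h2.1] at h1
    rcases hC with hC | ⟨rfl, rfl, rfl⟩
    · have := h.closed a b c hC h1 h2.2 h3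
      refine ⟨hs9 _ this.1, (hle _ this.1).trans ?_⟩
      rw [hk _ h2.1]
      exact this.2
    · refine ⟨by rw [h9]; simp [hq₂], ?_⟩
      rw [hK, huv', hy]
  · intro q hqn h1 h2
    rw [Finset.mem_insert, not_or] at h2
    rw [hs9' _ h2.1] at h1
    rw [hk _ h2.1]
    exact h.low q hqn h1 h2.2
  · intro q hq
    rcases eq_or_ne q q₂ with rfl | hne
    · rw [hK, hy]; linarith
    · rw [hk _ hne]
      exact h.high q ((Finset.mem_insert.1 hq).resolve_left hne)

theorem Labels.relax_keep {p : Fin n → M} {G : SimpleGraph (Fin n)} {A Y : Finset ℕ} {x : ℝ}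
    {C : Fin n → Fin n → Fin n → Prop} {s : State} (h : Labels p G A x C Y s) {u v w : Fin n}
    (huv : s.rarr 1 (n * n + (u * n + v)) = x) (h9 : s.narr 9 (u * n + w) ≠ 0)
    (hle : s.rarr 1 (n * n + (u * n + w)) ≤ x + dist (p v) (p w)) :
    Labels p G A x (fun a b c => C a b c ∨ a = u ∧ b = v ∧ c = w) Y s := by
  refine ⟨h.queue, h.seen, h.done, h.sound, h.start, ?_, h.low, h.high⟩
  rintro a b c (hC | ⟨rfl, rfl, rfl⟩) h1 h2 h3
  · exact h.closed a b c hC h1 h2 h3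
  · exact ⟨h9, by rw [huv]; exact hle⟩

theorem Labels.mono {p : Fin n → M} {G : SimpleGraph (Fin n)} {A Y : Finset ℕ} {x : ℝ}
    {C C' : Fin n → Fin n → Fin n → Prop} {s : State} (h : Labels p G A x C Y s)
    (hC : ∀ u v w, C' u v w → G.Adj v w → C u v w) : Labels p G A x C' Y s :=
  ⟨h.queue, h.seen, h.done, h.sound, h.start,
    fun u v w hc h1 h2 h3 => h.closed u v w (hC u v w hc h3) h1 h2 h3, h.low, h.high⟩

/-- With an empty queue every marked pair is closed under edges, and adding these inequalities along
a walk bounds the final label by the length. -/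
theorem Labels.complete {p : Fin n → M} {G : SimpleGraph (Fin n)} {Y : Finset ℕ} {x : ℝ}
    {s : State} (h : Labels p G ∅ x (fun _ _ _ => True) Y s) (u : Fin n) {a b : Fin n}
    (w : G.Walk a b) (ha : s.narr 9 (u * n + a) ≠ 0) :
    s.narr 9 (u * n + b) ≠ 0 ∧ s.rarr 1 (n * n + (u * n + b)) ≤
      s.rarr 1 (n * n + (u * n + a)) + realLength p w := by
  induction w with
  | nil => exact ⟨ha, by simp [realLength]⟩
  | @cons a b c hab q ih =>
    obtain ⟨h1, h2⟩ := h.closed u a b trivial ha (by simp) hab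
    obtain ⟨h3, h4⟩ := ih h1
    refine ⟨h3, ?_⟩
    have : realLength p (q.cons hab) = dist (p a) (p b) + realLength p q := by simp [realLength]
    rw [this]
    linarith

/-- The distance between two vertices that a matrix `d` with the marks `f` for its finite entries
describes. -/
noncomputable def matrixEntry (f : ℕ → ℕ) (d : ℕ → ℝ) (q : ℕ) : ℝ≥0∞ :=
  if f q = 0 then ∞ else ENNReal.ofReal (d q)

structure IsDistMatrix (p : Fin n → M) (G : SimpleGraph (Fin n)) (f : ℕ → ℕ) (d : ℕ → ℝ) :
    Prop where
  nonneg : ∀ q < n * n, f q ≠ 0 → 0 ≤ d q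
  eq : ∀ u v : Fin n, matrixEntry f d (u * n + v) = graphDist p G u v

theorem Labels.isDistMatrix {p : Fin n → M} {G : SimpleGraph (Fin n)} {Y : Finset ℕ} {x : ℝ}
    {s : State} (h : Labels p G ∅ x (fun _ _ _ => True) Y s) :
    IsDistMatrix p G (s.narr 9) fun q => s.rarr 1 (n * n + q) := by
  constructor
  · intro q hq h9
    obtain ⟨u, v, rfl⟩ := exists_pair_index hq
    exact (h.sound u v h9).1
  · intro u v
    have key : ∀ w : G.Walk u v, s.narr 9 (u * n + v) ≠ 0 ∧
        s.rarr 1 (n * n + (u * n + v)) ≤ realLength p w := by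
      intro w
      obtain ⟨h1, h2⟩ := h.complete u w (h.start u).1
      exact ⟨h1, by linarith [(h.start u).2]⟩
    rw [matrixEntry]
    split_ifs with h9
    · by_contra hc
      obtain ⟨w, -, -⟩ := exists_isPath_graphDist_eq p (Ne.symm hc)
      exact (key w).1 h9
    · refine le_antisymm (le_iInf fun w => ?_) (h.sound u v h9).2
      rw [walkLength_eq]
      exact ENNReal.ofReal_le_ofReal (key w).2

/-- Relax the edge number `s.nvar 5` in the list of the vertex `v = s.nvar 18` for the source
`u = s.nvar 17`; the label of `(u, v)` is in the real register `2`. -/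
def relaxEdge : Cmd :=
  (.nset 19 (.get 5 (.add (.get 7 (.var 18)) (.var 5))) ;;
    .nset 8 (.add (.get 2 (.var 17)) (.var 19)) ;; .nset 9 (.add (.var 8) (.const 1)) ;;
    .rset 1 (.add (.var 2) (.get 0 (.add (.get 2 (.var 18)) (.var 19))))) ;;
  .cond (.or (.neq (.get 9 (.var 8)) (.const 0)) (.rlt (.var 1) (.get 1 (.add (.var 3) (.var 8)))))
    (.nput 9 (.var 8) (.const 1) ;; treeSet) .skip

theorem relaxEdge_runs {p : Fin n → M} {G : SimpleGraph (Fin n)} {A Y : Finset ℕ} {x : ℝ}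
    {C : Fin n → Fin n → Fin n → Prop} {s : State} (h : Labels p G A x C Y s) {u v w : Fin n}
    (ht : Tables n s) (hdist : ∀ u v : Fin n, s.rarr 0 (u * n + v) = dist (p u) (p v))
    (hu : s.nvar 17 = u) (hv : s.nvar 18 = v) (hw : s.narr 5 (s.narr 7 v + s.nvar 5) = w)
    (hx : s.rvar 2 = x) (huv : s.rarr 1 (n * n + (u * n + v)) = x)
    (hY : (u * n + v : ℕ) ∈ Y) (hadj : G.Adj v w) :
    Runs relaxEdge s (150 * (Nat.log 2 (n * n + n * n) + 1)) fun s' =>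
      ∃ A', Labels p G A' x (fun a b c => C a b c ∨ a = u ∧ b = v ∧ c = w) Y s' ∧
        s'.rarr 1 (n * n + (u * n + v)) = x := by
  set lg := Nat.log 2 (n * n + n * n) with hlg
  refine Runs.seq (B₁ := 25) (B₂ := 100 * (lg + 1) + 20)
    (P := fun s₁ => Labels p G A x C Y s₁ ∧ s₁.nvar 3 = n * n ∧
      s₁.nvar 8 = u * n + w ∧ s₁.nvar 9 = u * n + w + 1 ∧
      s₁.rvar 1 = x + dist (p v) (p w) ∧ s₁.rarr 1 = s.rarr 1 ∧ s₁.narr 9 = s.narr 9) ?_ ?_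
    (by omega)
  · refine Runs.straight rfl (by decide) ⟨?_, ?_, ?_, ?_, ?_, ?_, ?_⟩
    · exact h.congr (by simp [Cmd.run]) rfl rfl rfl
    · simp [Cmd.run, ht.size]
    · simp [Cmd.run, hv, hw, hu, ht.row]
    · simp [Cmd.run, hv, hw, hu, ht.row]
    · simp [Cmd.run, hv, hw, ht.row, hdist, hx]
    · simp [Cmd.run]
    · simp [Cmd.run]
  rintro s₁ - ⟨hL, e3, e8, e9, e1, ek, ef⟩
  rw [← ek] at huv
  refine Runs.cond (B := 100 * (lg + 1) + 5) ?_ ?_ (by simp only [BExp.cost, NExp.cost, RExp.cost]; omega)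
  · intro hb
    simp only [BExp.Holds, NExp.eval, RExp.eval, e8, e1, e3] at hb
    have hnew : s₁.narr 9 (u * n + w) ≠ 0 →
        x + dist (p v) (p w) < s₁.rarr 1 (n * n + (u * n + w)) := fun h0 => hb.resolve_left h0
    refine Runs.seq (B₁ := 3) (B₂ := 100 * (lg + 1)) (P := fun s₂ => s₂ = s₁.putN 9 (u * n + w) 1)
      (Runs.straight rfl (by decide) (by simp [Cmd.run, e8])) ?_ (by omega)
    rintro s₂ - rfl
    have hq : Queue (n * n) A (fun q => s₁.rarr 1 (n * n + q)) (s₁.putN 9 (u * n + w) 1) :=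
      hL.queue.congr (by simp) (by simp) (by simp)
    refine (queueInsert_runs hq (i := u * n + w) (by simpa using e8) (pair_index_lt u.2 w.2)
      (by simpa using e9)).mono le_rfl ?_
    rintro s₃ hag ⟨g1, g2, g3⟩
    refine ⟨_, hL.relax_insert rfl huv hY hadj hnew (y := x + dist (p v) (p w)) ?_ ?_ ?_ ?_⟩
    · simpa [e1] using g1
    · simpa [e1] using g2
    · simpa using g3
    · exact (hag.narr 9 rfl).trans (by simp)
  · intro hb
    simp only [BExp.Holds, NExp.eval, RExp.eval, e8, e1, e3, not_or, not_lt] at hb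
    exact Runs.skip (by omega) ⟨A, hL.relax_keep huv hb.1 hb.2, huv⟩

end Dilation

namespace Dilation

open RealRAM

variable {n : ℕ} {M : Type*} [MetricSpace M]

/-- The arrays `5`, `6`, `7` contain adjacency lists of the graph `G`. -/
def AdjListsOf (G : SimpleGraph (Fin n)) (s : State) : Prop :=
  ∀ (v : Fin n) (x : ℕ), (∃ l < s.narr 6 v, s.narr 5 (s.narr 7 v + l) = x) ↔
    ∃ w : Fin n, (w : ℕ) = x ∧ G.Adj v w

/-- Extract a pair with minimum label from the queue and relax the edges at its second vertex. -/
def distStep : Cmd :=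
  (.nset 16 (.sub (.get 8 (.const 1)) (.const 1)) ;; .nset 17 (.get 3 (.var 16)) ;;
    .nset 18 (.get 4 (.var 16)) ;; .rset 2 (.get 1 (.const 1)) ;; .nset 8 (.var 16) ;;
    .nset 9 (.const 0) ;; .rset 1 (.var 2)) ;;
  treeSet ;; .forUp 5 (.get 6 (.var 18)) relaxEdge

/-- The extracted pair becomes settled before its edges are relaxed, so closedness is suspended for
this pair alone; the bound `x` moves up to its label. -/
theorem Labels.extract {p : Fin n → M} {G : SimpleGraph (Fin n)} {A Y : Finset ℕ} {x : ℝ}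
    {s s' : State} (h : Labels p G A x (fun _ _ _ => True) Y s) {u v : Fin n}
    (hi : (u * n + v : ℕ) ∈ A)
    (hmin : ∀ q ∈ A, s.rarr 1 (n * n + (u * n + v)) ≤ s.rarr 1 (n * n + q))
    (hq : Queue (n * n) (A.erase (u * n + v)) (fun q => s'.rarr 1 (n * n + q)) s')
    (hK : ∀ q, s'.rarr 1 (n * n + q) = s.rarr 1 (n * n + q)) (h9 : s'.narr 9 = s.narr 9) :
    Labels p G (A.erase (u * n + v)) (s.rarr 1 (n * n + (u * n + v)))
      (fun a b _ => ¬ (a = u ∧ b = v)) (insert (u * n + v : ℕ) Y) s' := by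
  refine ⟨hq, ?_, ?_, ?_, ?_, ?_, ?_, ?_⟩ <;> simp only [hK, h9]
  · exact fun q hq => h.seen q (Finset.mem_of_mem_erase hq)
  · intro q hq
    rcases Finset.mem_insert.1 hq with rfl | hq
    · exact ⟨h.seen _ hi, by simp⟩
    · exact ⟨(h.done q hq).1, fun h' => (h.done q hq).2 (Finset.mem_of_mem_erase h')⟩
  · exact h.sound
  · exact h.start
  · intro a b c hC h1 h2 h3
    refine h.closed a b c trivial h1 (fun h' => h2 (Finset.mem_erase.2 ⟨fun heq => ?_, h'⟩)) h3
    obtain ⟨ha, hb⟩ := pair_index_inj b.2 v.2 heq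
    exact hC ⟨Fin.ext ha, Fin.ext hb⟩
  · intro q hqn h1 h2
    by_cases hqA : q ∈ A
    · have : q = u * n + v := by
        by_contra hne
        exact h2 (Finset.mem_erase.2 ⟨hne, hqA⟩)
      rw [this]
    · exact (h.low q hqn h1 hqA).trans (h.high _ hi)
  · exact fun q hq => hmin q (Finset.mem_of_mem_erase hq)

/-- The set `Y` records the pairs already extracted. They never return to the queue, so the cost,
proportional to one plus the degree of the second vertex `i % n`, is charged once to each pair. -/
theorem distStep_runs {p : Fin n → M} {G : SimpleGraph (Fin n)} {A Y : Finset ℕ} {x : ℝ}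
    {s : State} (hn : 1 ≤ n) (h : Labels p G A x (fun _ _ _ => True) Y s)
    (ht : Tables n s) (hdist : ∀ u v : Fin n, s.rarr 0 (u * n + v) = dist (p u) (p v))
    (hadj : AdjListsOf G s) (h0 : s.narr 8 1 ≠ 0) :
    ∃ i ∈ A, i < n * n ∧
      Runs distStep s (200 * (Nat.log 2 (n * n + n * n) + 1) * (s.narr 6 (i % n) + 1)) fun s' =>
        ∃ A' x', Labels p G A' x' (fun _ _ _ => True) (insert i Y) s' := by
  set lg := Nat.log 2 (n * n + n * n) with hlg
  obtain ⟨i, hi, hi1, hi2, hi3⟩ := h.queue.root (Nat.mul_pos hn hn) h0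
  have hin := h.queue.lt i hi
  refine ⟨i, hi, hin, ?_⟩
  obtain ⟨u, v, rfl⟩ := exists_pair_index hin
  have hmod : (u * n + v : ℕ) % n = v := by
    rw [mul_comm, Nat.mul_add_mod, Nat.mod_eq_of_lt v.2]
  rw [hmod]
  set d := s.narr 6 v with hd
  set y := s.rarr 1 (n * n + (u * n + v)) with hy
  have hprod : 200 * (lg + 1) * (d + 1) = 200 * (lg * d + lg + d + 1) := by ring
  refine Runs.seq (B₁ := 24) (B₂ := 100 * (lg + 1) + (d * (150 * (lg + 1) + 9) + 7))
    (P := fun s₁ => s₁.nvar 3 = n * n ∧ s₁.nvar 17 = u ∧ s₁.nvar 18 = v ∧ s₁.rvar 2 = y ∧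
      s₁.rvar 1 = y ∧ s₁.nvar 8 = u * n + v ∧ s₁.nvar 9 = 0 ∧ s₁.narr 8 = s.narr 8 ∧
      s₁.rarr 1 = s.rarr 1) ?_ ?_
    (by rw [hprod]
        have : d * (150 * (lg + 1) + 9) = 150 * (lg * d) + 159 * d := by ring
        omega)
  · refine Runs.straight rfl (by decide) ⟨?_, ?_, ?_, ?_, ?_, ?_, ?_, ?_, ?_⟩ <;>
      simp [Cmd.run, ht.size, hi1, ht.fst, ht.snd, hi2]
  rintro s₁ hag₁ ⟨e3, e17, e18, e2, e1, e8, e9, ea8, ea1⟩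
  refine Runs.seq (B₁ := 100 * (lg + 1)) (B₂ := d * (150 * (lg + 1) + 9) + 7)
    (queueErase_runs (h.queue.congr (s' := s₁) (by rw [e3, ht.size]) ea8 ea1) e8 hin e9) ?_ le_rfl
  rintro s₂ hag₂ ⟨hq, hk1, hk2⟩
  have hK : ∀ q, s₂.rarr 1 (n * n + q) = s.rarr 1 (n * n + q) := by
    intro q
    rcases eq_or_ne q (u * n + v) with rfl | hne
    · rw [hk1, e1]
    · rw [hk2 _ (by omega) (by omega), ea1]
  have h9 : s₂.narr 9 = s.narr 9 := (hag₂.narr 9 rfl).trans (hag₁.narr 9 rfl)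
  have hL := h.extract hi hi3 (s' := s₂) (hq.congr_key fun q _ => hK q) hK h9
  have f17 : s₂.nvar 17 = u := (hag₂.nvar 17 rfl).trans e17
  have f18 : s₂.nvar 18 = v := (hag₂.nvar 18 rfl).trans e18
  have f2 : s₂.rvar 2 = y := (hag₂.rvar 2 rfl).trans e2
  have g5 : s₂.narr 5 = s.narr 5 := (hag₂.narr 5 rfl).trans (hag₁.narr 5 rfl)
  have g6 : s₂.narr 6 = s.narr 6 := (hag₂.narr 6 rfl).trans (hag₁.narr 6 rfl)
  have g7 : s₂.narr 7 = s.narr 7 := (hag₂.narr 7 rfl).trans (hag₁.narr 7 rfl)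
  have g0 : s₂.rarr 0 = s.rarr 0 := (hag₂.rarr 0 rfl).trans (hag₁.rarr 0 rfl)
  have ht₂ : Tables n s₂ := (ht.agree hag₁ rfl rfl rfl rfl rfl).agree hag₂ rfl rfl rfl rfl rfl
  -- Closedness at `(u, v)` is restored one list entry at a time: after `j` rounds it holds for the
  -- first `j` neighbours of `v`.
  refine Runs.forUp (N := d) (B := 150 * (lg + 1)) (fun j s' => ∃ A',
    Labels p G A' y (fun a b c => ¬ (a = u ∧ b = v) ∨
      ∃ l < j, s.narr 5 (s.narr 7 v + l) = c) (insert (u * n + v : ℕ) Y) s' ∧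
    s'.rarr 1 (n * n + (u * n + v)) = y) rfl ?_ ?_ ?_ ?_ ?_
  · intro s' hag
    simp [hag.narr 6 rfl, hag.nvar 18 rfl, f18, g6, hd]
  · refine ⟨_, (hL.mono ?_).congr (by simp) rfl rfl rfl, by simp [hK, hy]⟩
    intro a b c hC _
    simpa using hC
  · rintro j s' hj hag hx ⟨A', hL', hy'⟩
    obtain ⟨w, hw, hvw⟩ := (hadj v _).1 ⟨j, hj, rfl⟩
    refine (relaxEdge_runs hL' (w := w) (ht₂.agree hag rfl rfl rfl rfl rfl) ?_ ?_ ?_ ?_ ?_ hy'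
      (Finset.mem_insert_self _ _) hvw).mono le_rfl ?_
    · rw [hag.rarr 0 rfl, g0]; exact hdist
    · exact (hag.nvar 17 rfl).trans f17
    · exact (hag.nvar 18 rfl).trans f18
    · rw [hag.narr 5 rfl, g5, hag.narr 7 rfl, g7, hx, hw]
    · exact (hag.rvar 2 rfl).trans f2
    · rintro s'' - ⟨A'', hL'', hy''⟩
      refine ⟨A'', (hL''.mono ?_).congr (by simp) rfl rfl rfl, by simpa using hy''⟩
      rintro a b c (hC | ⟨l, hl, hlc⟩) _
      · exact Or.inl (Or.inl hC)
      · rcases eq_or_ne l j with rfl | hne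
        · by_cases hab : a = u ∧ b = v
          · exact Or.inr ⟨hab.1, hab.2, Fin.ext (hlc.symm.trans hw.symm)⟩
          · exact Or.inl (Or.inl hab)
        · exact Or.inl (Or.inr ⟨l, by omega, hlc⟩)
  · simp only [NExp.cost]
    exact le_of_eq (by ring)
  · rintro s' - - ⟨A', hL', -⟩
    refine ⟨A', y, hL'.mono ?_⟩
    intro a b c _ hbc
    by_cases hab : a = u ∧ b = v
    · obtain ⟨l, hl, hlc⟩ := (hadj v c).2 ⟨c, rfl, hab.2 ▸ hbc⟩
      exact Or.inr ⟨l, hl, hlc⟩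
    · exact Or.inl hab

/-- All diagonal pairs start in one queue with label zero, which runs Dijkstra's algorithm from
every source simultaneously. -/
def distInit : Cmd :=
  queueClear ;; .forUp 4 (.var 3) (.nput 9 (.var 4) (.const 0)) ;;
  .forUp 4 (.var 0) ((.nset 8 (.add (.get 2 (.var 4)) (.var 4)) ;;
    .nset 9 (.add (.var 8) (.const 1)) ;; .rset 1 (.cast (.const 0)) ;;
    .nput 9 (.var 8) (.const 1)) ;; treeSet)

theorem distInit_runs (p : Fin n → M) (G : SimpleGraph (Fin n)) {s : State} (ht : Tables n s)
    (hn : 1 ≤ n) :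
    Runs distInit s (300 * (n * n) * (Nat.log 2 (n * n + n * n) + 1)) fun s' =>
      ∃ A, Labels p G A 0 (fun _ _ _ => True) ∅ s' := by
  set lg := Nat.log 2 (n * n + n * n) with hlg
  have hnn : n ≤ n * n := Nat.le_mul_self n
  have hl1 : n * n ≤ n * n * (lg + 1) := Nat.le_mul_of_pos_right _ (by omega)
  have hl2 : n * (lg + 1) ≤ n * n * (lg + 1) := Nat.mul_le_mul_right _ hnn
  refine Runs.seq (B₁ := 50 * (n * n) + 20)
    (B₂ := 11 * (n * n) + 6 + (n * (100 * (lg + 1) + 28) + 6))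
    (queueClear_runs ht.size fun _ => 0) ?_ ?_
  swap
  · have e1 : n * (100 * (lg + 1) + 28) = 100 * (n * (lg + 1)) + 28 * n := by ring
    have e2 : 300 * (n * n) * (lg + 1) = 300 * (n * n * (lg + 1)) := by ring
    rw [e1, e2]
    omega
  intro s₁ hag₁ hq₁
  have ht₁ : Tables n s₁ := ht.agree hag₁ rfl rfl rfl rfl rfl
  refine Runs.seq (B₁ := 11 * (n * n) + 6) (B₂ := n * (100 * (lg + 1) + 28) + 6)
    (P := fun s' => Queue (n * n) ∅ (fun _ => 0) s' ∧ ∀ q < n * n, s'.narr 9 q = 0) ?_ ?_ le_rfl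
  · refine Runs.forUp (N := n * n) (B := 3) (fun i s' => ∀ q < i, s'.narr 9 q = 0)
      rfl ?_ ?_ ?_ ?_ ?_
    · intro s' h
      simp [h.nvar 3 rfl, ht₁.size]
    · simp
    · intro i s' hi ha hx hI
      refine Runs.straight rfl (by decide) ?_
      intro q hq
      rcases eq_or_ne q i with rfl | hne
      · simp [Cmd.run, hx]
      · simpa [Cmd.run, hx, hne] using hI q (by omega)
    · simp only [NExp.cost]; omega
    · intro s' ha _ hI
      exact ⟨hq₁.congr (ha.nvar 3 rfl) (ha.narr 8 rfl) (ha.rarr 1 rfl), hI⟩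
  rintro s₂ hag₂ ⟨hq₂, h9₂⟩
  have ht₂ : Tables n s₂ := ht₁.agree hag₂ rfl rfl rfl rfl rfl
  refine Runs.forUp (N := n) (B := 100 * (lg + 1) + 20) (fun i s' => ∃ A : Finset ℕ,
      Queue (n * n) A (fun q => s'.rarr 1 (n * n + q)) s' ∧
      (∀ q < n * n, q ∈ A ↔ s'.narr 9 q ≠ 0) ∧
      (∀ q ∈ A, s'.rarr 1 (n * n + q) = 0 ∧ ∃ u < i, q = u * n + u) ∧
      ∀ u < i, u * n + u ∈ A) rfl ?_ ?_ ?_ ?_ ?_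
  · intro s' h
    simp [h.nvar 0 rfl, ht₂.vertices]
  · refine ⟨∅, Queue.congr (hq₂.congr_key (by simp)) (by simp) rfl rfl, ?_, by simp, by simp⟩
    intro q hq
    simpa using h9₂ q hq
  · rintro i s' hi hag hx ⟨A, hq, h9, hA, hA'⟩
    have ht' : Tables n s' := ht₂.agree hag rfl rfl rfl rfl rfl
    refine Runs.seq (B₁ := 20) (B₂ := 100 * (lg + 1)) (P := fun s₃ => s₃.nvar 8 = i * n + i ∧
        s₃.nvar 9 = i * n + i + 1 ∧ s₃.rvar 1 = 0 ∧ s₃.nvar 3 = s'.nvar 3 ∧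
        s₃.narr 8 = s'.narr 8 ∧ s₃.rarr 1 = s'.rarr 1 ∧
        s₃.narr 9 = Function.update (s'.narr 9) (i * n + i) 1) ?_ ?_ (by omega)
    · refine Runs.straight rfl (by decide) ⟨?_, ?_, ?_, ?_, ?_, ?_, ?_⟩ <;>
        simp [Cmd.run, hx, ht'.row i hi]
    rintro s₃ - ⟨e8, e9, er, e3, ea8, ea1, ea9⟩
    have hin : i * n + i < n * n := pair_index_lt hi hi
    refine (queueInsert_runs (hq.congr e3 ea8 ea1) e8 hin e9).mono le_rfl ?_
    rintro s₄ hag₄ ⟨g1, g2, g3⟩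
    rw [er] at g1 g2
    have k9 : s₄.narr 9 = Function.update (s'.narr 9) (i * n + i) 1 := (hag₄.narr 9 rfl).trans ea9
    have hk : ∀ q, q ≠ i * n + i → s₄.rarr 1 (n * n + q) = s'.rarr 1 (n * n + q) := fun q hne => by
      rw [g3 _ (by omega) (by omega), ea1]
    refine ⟨insert (i * n + i) A, ?_, ?_, ?_, ?_⟩
    · refine (g1.congr_key fun q hq => ?_).congr (by simp) rfl rfl
      rcases eq_or_ne q (i * n + i) with rfl | hne
      · simp [g2]
      · simp [hne, hk q hne]
    · intro q hqn
      rw [State.setN_narr, k9, Finset.mem_insert]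
      rcases eq_or_ne q (i * n + i) with rfl | hne
      · simp
      · simpa [hne] using h9 q hqn
    · intro q hqA
      rw [State.setN_rarr]
      rcases eq_or_ne q (i * n + i) with rfl | hne
      · exact ⟨g2, i, by omega, rfl⟩
      · obtain ⟨h1, u, hu, h2⟩ := hA q ((Finset.mem_insert.1 hqA).resolve_left hne)
        exact ⟨(hk q hne).trans h1, u, by omega, h2⟩
    · intro u hu
      rcases eq_or_ne u i with rfl | hne
      · simp
      · exact Finset.mem_insert_of_mem (hA' u (by omega))
  · simp only [NExp.cost]
    exact le_of_eq (by ring)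
  · rintro s' - - ⟨A, hq, h9, hA, hA'⟩
    refine ⟨A, hq, fun q hqA => (h9 q (hq.lt q hqA)).1 hqA, by simp, ?_, ?_, ?_, ?_, ?_⟩
    · intro u v h1
      obtain ⟨h2, a, ha, h3⟩ := hA _ ((h9 _ (pair_index_lt u.2 v.2)).2 h1)
      obtain ⟨h4, h5⟩ := pair_index_inj v.2 ha h3
      have : u = v := Fin.ext (h4.trans h5.symm)
      subst this
      rw [h2]
      simp [graphDist_self]
    · intro u
      have := hA' u u.2
      exact ⟨(h9 _ (pair_index_lt u.2 u.2)).1 this, (hA _ this).1.le⟩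
    · intro u v w _ h1 h2
      exact absurd ((h9 _ (pair_index_lt u.2 v.2)).2 h1) h2
    · intro q hqn h1 h2
      exact absurd ((h9 q hqn).2 h1) h2
    · exact fun q hqA => (hA q hqA).1.ge

/-- Compute the distances in the graph; array `9` marks the finite ones, array `3` contains
their values. -/
def distAll : Cmd :=
  distInit ;; .loop (.not (.neq (.get 8 (.const 1)) (.const 0))) distStep ;;
  .forUp 4 (.var 3) (.rput 3 (.var 4) (.get 1 (.add (.var 3) (.var 4))))

/-- Over all pairs `(u, v)` the degree of `v` is counted once for each `u`; this yields the total
cost `n * (2 * m + n)` up to the logarithm. -/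
theorem sum_range_mul_mod (f : ℕ → ℕ) (a n : ℕ) :
    ∑ q ∈ Finset.range (a * n), f (q % n) = a * ∑ v ∈ Finset.range n, f v := by
  induction a with
  | zero => simp
  | succ a ih =>
    rw [add_mul, one_mul, Finset.sum_range_add, ih, add_mul, one_mul]
    congr 1
    refine Finset.sum_congr rfl fun v hv => ?_
    rw [mul_comm, Nat.mul_add_mod, Nat.mod_eq_of_lt (Finset.mem_range.1 hv)]

theorem distAll_runs (p : Fin n → M) (G : SimpleGraph (Fin n)) {s : State} {m : ℕ}
    (ht : Tables n s) (hn : 1 ≤ n)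
    (hdist : ∀ u v : Fin n, s.rarr 0 (u * n + v) = dist (p u) (p v))
    (hadj : AdjListsOf G s) (hm : ∑ v ∈ Finset.range n, s.narr 6 v = 2 * m) :
    Runs distAll s (1000 * (n * (m + n)) * (Nat.log 2 (n * n + n * n) + 1)) fun s' =>
      IsDistMatrix p G (s'.narr 9) (s'.rarr 3) := by
  set lg := Nat.log 2 (n * n + n * n) with hlg
  have hsum : ∑ q ∈ Finset.range (n * n), 220 * (lg + 1) * (s.narr 6 (q % n) + 1) =
      220 * (lg + 1) * (n * (2 * m + n)) := by
    rw [← Finset.mul_sum, sum_range_mul_mod (fun v => s.narr 6 v + 1), Finset.sum_add_distrib, hm]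
    simp
  have hl1 : n * n ≤ n * n * (lg + 1) := Nat.le_mul_of_pos_right _ (by omega)
  have hnn : 1 ≤ n * n := Nat.mul_pos hn hn
  refine Runs.seq (B₁ := 300 * (n * n) * (lg + 1))
    (B₂ := 220 * (lg + 1) * (n * (2 * m + n)) + 10 + (20 * (n * n) + 10))
    (distInit_runs p G ht hn) ?_ ?_
  swap
  · have e1 : 1000 * (n * (m + n)) * (lg + 1) =
        1000 * (n * m * (lg + 1)) + 1000 * (n * n * (lg + 1)) := by ring
    have e2 : 220 * (lg + 1) * (n * (2 * m + n)) =
        440 * (n * m * (lg + 1)) + 220 * (n * n * (lg + 1)) := by ring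
    have e3 : 300 * (n * n) * (lg + 1) = 300 * (n * n * (lg + 1)) := by ring
    rw [e1, e2, e3]
    omega
  rintro s₁ hag₁ ⟨A, hA⟩
  have ht₁ : Tables n s₁ := ht.agree hag₁ rfl rfl rfl rfl rfl
  have a0 : s₁.rarr 0 = s.rarr 0 := hag₁.rarr 0 rfl
  have a5 : s₁.narr 5 = s.narr 5 := hag₁.narr 5 rfl
  have a6 : s₁.narr 6 = s.narr 6 := hag₁.narr 6 rfl
  have a7 : s₁.narr 7 = s.narr 7 := hag₁.narr 7 rfl
  have hloop := Runs.loop_of_potential (b := .not (.neq (.get 8 (.const 1)) (.const 0)))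
    (c := distStep) (s₀ := s₁)
    -- The potential is the cost of all pairs not yet extracted. The constant `220` instead of `200`
    -- pays for the loop test.
    (fun f s' => ∃ A x Y, Labels p G A x (fun _ _ _ => True) Y s' ∧
      f = ∑ q ∈ Finset.range (n * n) \ Y, 220 * (lg + 1) * (s.narr 6 (q % n) + 1))
    ⟨A, 0, ∅, hA, rfl⟩ ?_
  · refine Runs.seq (B₁ := 220 * (lg + 1) * (n * (2 * m + n)) + 10) (B₂ := 20 * (n * n) + 10)
      (hloop.mono ?_ fun s' _ h => h) ?_ le_rfl
    · rw [Finset.sdiff_empty, hsum]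
      simp only [BExp.cost, NExp.cost]
      omega
    rintro s₂ hag₂ ⟨⟨_, A, x, Y, hL, -⟩, h0⟩
    have hE : A = ∅ := hL.queue.eq_empty (by simpa using h0)
    subst hE
    have hmat := hL.isDistMatrix
    refine Runs.forUp (N := n * n) (B := 7)
      (fun i s' => ∀ q < i, s'.rarr 3 q = s₂.rarr 1 (n * n + q)) rfl ?_ ?_ ?_ ?_ ?_
    · intro s' h
      simp [h.nvar 3 rfl, hL.queue.size]
    · simp
    · intro i s' hi hag hx hI
      refine Runs.straight rfl (by decide) fun q hq => ?_
      have h3 : s'.nvar 3 = n * n := (hag.nvar 3 rfl).trans hL.queue.size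
      rcases eq_or_ne q i with rfl | hne
      · simp [Cmd.run, hx, h3, hag.rarr 1 rfl]
      · simpa [Cmd.run, hx, h3, hne] using hI q (by omega)
    · simp only [NExp.cost]; omega
    · intro s' hag _ hI
      rw [hag.narr 9 rfl]
      refine ⟨fun q hq h9 => by rw [hI q hq]; exact hmat.nonneg q hq h9, fun u v => ?_⟩
      rw [← hmat.eq, matrixEntry, matrixEntry, hI _ (pair_index_lt u.2 v.2)]
  · rintro f s' hag ⟨A, x, Y, hL, rfl⟩ hb
    obtain ⟨i, hiA, hin, hrun⟩ := distStep_runs hn hL (ht₁.agree hag rfl rfl rfl rfl rfl)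
      (by rw [hag.rarr 0 rfl, a0]; exact hdist)
      (by rw [AdjListsOf, hag.narr 5 rfl, hag.narr 6 rfl, hag.narr 7 rfl, a5, a6, a7]; exact hadj)
      (by simpa using hb)
    rw [hag.narr 6 rfl, a6, ← hlg] at hrun
    refine ⟨_, hrun.mono le_rfl ?_⟩
    rintro s'' - ⟨A', x', hL'⟩
    refine ⟨_, ⟨A', x', insert i Y, hL', rfl⟩, ?_⟩
    have hi : i ∈ Finset.range (n * n) \ Y :=
      Finset.mem_sdiff.2 ⟨Finset.mem_range.2 hin, fun h => (hL.done i h).2 hiA⟩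
    rw [← Finset.add_sum_erase _ _ hi, ← Finset.sdiff_insert]
    simp only [BExp.cost, NExp.cost]
    have : 220 * (lg + 1) * (s.narr 6 (i % n) + 1) =
        200 * (lg + 1) * (s.narr 6 (i % n) + 1) + 20 * ((lg + 1) * (s.narr 6 (i % n) + 1)) := by
      ring
    have h1 : 1 ≤ (lg + 1) * (s.narr 6 (i % n) + 1) := Nat.mul_pos (by omega) (by omega)
    omega

end Dilation

/-! ### Sorting the distances, scales and candidate thresholds -/

namespace Dilation

open RealRAM

variable {n : ℕ} {M : Type*} [MetricSpace M]

theorem queueInsert_range_runs {s : State} {N i : ℕ} {key : ℕ → ℝ}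
    (h : Queue N (Finset.range i) key s) (hi : s.nvar 8 = i) (hiN : i < N) (h9 : s.nvar 9 = i + 1)
    (h1 : s.rvar 1 = key i) :
    Runs treeSet s (100 * (Nat.log 2 (N + N) + 1)) (Queue N (Finset.range (i + 1)) key) := by
  refine (queueInsert_runs h hi hiN h9).mono le_rfl ?_
  rintro s' - ⟨hq, -⟩
  rw [Finset.range_add_one]
  refine hq.congr_key fun j _ => ?_
  rw [h1, Function.update_eq_self]

/-- The values `val` are the numbers `d 0, …, d (N - 1)` in increasing order, and `ord` contains
their indices. -/
structure IsSorted (N : ℕ) (d : ℕ → ℝ) (ord : ℕ → ℕ) (val : ℕ → ℝ) : Prop where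
  lt : ∀ c < N, ord c < N
  val_eq : ∀ c < N, val c = d (ord c)
  surj : ∀ i < N, ∃ c < N, ord c = i
  mono : ∀ c c', c ≤ c' → c' < N → val c ≤ val c'

/-- Sort the pairs of vertices by their distances: array `10` contains the pairs, array `2` the
distances. -/
def sortPairs : Cmd :=
  queueClear ;;
  .forUp 4 (.var 3) ((.nset 8 (.var 4) ;; .nset 9 (.add (.var 4) (.const 1)) ;;
    .rset 1 (.get 0 (.var 4))) ;; treeSet) ;;
  queueDrain 10 2

theorem sortPairs_runs {s : State} {N : ℕ} (h3 : s.nvar 3 = N) (hN : 1 ≤ N) :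
    Runs sortPairs s (500 * N * (Nat.log 2 (N + N) + 1)) fun s' =>
      IsSorted N (s.rarr 0) (s'.narr 10) (s'.rarr 2) := by
  set lg := Nat.log 2 (N + N) with hlg
  have hl : N ≤ N * (lg + 1) := Nat.le_mul_of_pos_right _ (by omega)
  refine Runs.seq (B₁ := 50 * N + 20)
    (B₂ := N * (100 * (lg + 1) + 28) + 6 + (150 * N * (lg + 1) + 20))
    (queueClear_runs h3 (s.rarr 0)) ?_ ?_
  swap
  · have e1 : N * (100 * (lg + 1) + 28) = 100 * (N * (lg + 1)) + 28 * N := by ring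
    have e2 : 150 * N * (lg + 1) = 150 * (N * (lg + 1)) := by ring
    have e3 : 500 * N * (lg + 1) = 500 * (N * (lg + 1)) := by ring
    rw [e1, e2, e3]
    omega
  intro s₁ hag₁ hq₁
  refine Runs.seq (B₁ := N * (100 * (lg + 1) + 28) + 6) (B₂ := 150 * N * (lg + 1) + 20)
    (P := Queue N (Finset.range N) (s.rarr 0)) ?_ ?_ le_rfl
  · refine Runs.forUp (N := N) (B := 100 * (lg + 1) + 20)
      (fun i => Queue N (Finset.range i) (s.rarr 0)) rfl ?_ ?_ ?_ ?_ ?_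
    · intro s' hag
      simp [hag.nvar 3 rfl, hq₁.size]
    · exact hq₁.congr (by simp) rfl rfl
    · intro i s' hi hag hx hI
      refine Runs.seq (B₁ := 20) (B₂ := 100 * (lg + 1)) (P := fun s₂ => s₂.nvar 8 = i ∧
        s₂.nvar 9 = i + 1 ∧ s₂.rvar 1 = s.rarr 0 i ∧ Queue N (Finset.range i) (s.rarr 0) s₂)
        ?_ ?_ (by omega)
      · refine Runs.straight rfl (by decide) ⟨?_, ?_, ?_, hI.congr ?_ rfl rfl⟩ <;>
          simp [Cmd.run, hx, hag.rarr 0 rfl, hag₁.rarr 0 rfl]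
      · rintro s₂ - ⟨e8, e9, e1, hq⟩
        exact (queueInsert_range_runs hq e8 hi e9 e1).mono le_rfl fun s₃ _ h =>
          h.congr (by simp) rfl rfl
    · simp only [NExp.cost]
      exact le_of_eq (by ring)
    · exact fun s' _ _ h => h
  · intro s₂ _ hq₂
    refine (queueDrain_runs (a := 10) (b := 2) (by norm_num) (by norm_num) hN hq₂).mono ?_ ?_
    · simp [hlg]
    · rintro s' - ⟨-, h1, h2, h4⟩
      simp only [Finset.card_range, Finset.mem_range] at h1 h2 h4
      exact ⟨fun c hc => (h1 c hc).1, fun c hc => (h1 c hc).2, h2, h4⟩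

/-- Choose representatives of the positive distances up to a factor of two. -/
def pickScales : Cmd :=
  (.nset 11 (.const 0) ;; .rset 3 (.cast (.const 0))) ;;
  .forUp 4 (.var 3) (.cond (.rlt (.mul (.cast (.const 2)) (.var 3)) (.get 2 (.var 4)))
    (.rset 3 (.get 2 (.var 4)) ;; .rput 4 (.var 11) (.get 2 (.var 4)) ;;
      .nset 11 (.add (.var 11) (.const 1))) .skip)

/-- The field `doubling` keeps the number of scales below `n + 1`, and `exists_near` makes them
accurate up to a factor two. -/
structure AreScales (N : ℕ) (val : ℕ → ℝ) (L : ℕ) (r : ℕ → ℝ) : Prop where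
  pos : ∀ i < L, 0 < r i
  exists_eq : ∀ i < L, ∃ c < N, r i = val c
  doubling : ∀ i, i + 1 < L → 2 * r i < r (i + 1)
  exists_near : ∀ c < N, 0 < val c → ∃ i < L, r i ≤ val c ∧ val c ≤ 2 * r i

theorem pickScales_runs {s : State} {N : ℕ} (h3 : s.nvar 3 = N) (hN : 1 ≤ N)
    (hmono : ∀ c c', c ≤ c' → c' < N → s.rarr 2 c ≤ s.rarr 2 c') :
    Runs pickScales s (100 * N) fun s' => AreScales N (s.rarr 2) (s'.nvar 11) (s'.rarr 4) := by
  refine Runs.seq (B₁ := 8) (B₂ := 50 * N + 10) (P := fun s' => s' = (s.setN 11 0).setR 3 0)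
    (Runs.straight rfl (by decide) (by simp [Cmd.run])) ?_ (by omega)
  rintro s₁ - rfl
  -- Real register `3` holds the last scale, or `0` if there is none, in which case the test selects
  -- the first positive distance.
  refine Runs.forUp (N := N) (B := 30) (fun i s' =>
      AreScales i (s.rarr 2) (s'.nvar 11) (s'.rarr 4) ∧
      (∀ l, l + 1 = s'.nvar 11 → s'.rvar 3 = s'.rarr 4 l) ∧ (s'.nvar 11 = 0 → s'.rvar 3 = 0))
      rfl ?_ ?_ ?_ ?_ ?_
  · intro s' hag
    simp [hag.nvar 3 rfl, h3]
  · refine ⟨⟨?_, ?_, ?_, ?_⟩, ?_, ?_⟩ <;> simp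
  · rintro i s' hi hag hx ⟨hS, hl, hz⟩
    have h2 : s'.rarr 2 = s.rarr 2 := (hag.rarr 2 rfl).trans (by simp)
    have hlast : 0 ≤ s'.rvar 3 := by
      rcases Nat.eq_zero_or_pos (s'.nvar 11) with h | h
      · rw [hz h]
      · rw [hl (s'.nvar 11 - 1) (by omega)]
        exact (hS.pos _ (by omega)).le
    refine Runs.cond (B := 20) ?_ ?_ (by decide)
    · intro hb
      simp only [BExp.Holds, RExp.eval, NExp.eval, h2, hx, Nat.cast_ofNat] at hb
      refine Runs.straight rfl (by decide) ?_
      have hrun : (Cmd.run (.rset 3 (.get 2 (.var 4)) ;; .rput 4 (.var 11) (.get 2 (.var 4)) ;;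
          .nset 11 (.add (.var 11) (.const 1))) s') =
          ((s'.setR 3 (s.rarr 2 i)).putR 4 (s'.nvar 11) (s.rarr 2 i)).setN 11
            (s'.nvar 11 + 1) := by
        simp [Cmd.run, h2, hx]
      rw [hrun]
      set L := s'.nvar 11 with hL
      set x := s.rarr 2 i with hxv
      have e1 : ((((s'.setR 3 x).putR 4 L x).setN 11 (L + 1)).setN 4 (i + 1)).nvar 11 = L + 1 := by
        simp
      have e2 : ((((s'.setR 3 x).putR 4 L x).setN 11 (L + 1)).setN 4 (i + 1)).rarr 4 =
          Function.update (s'.rarr 4) L x := by simp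
      have e3 : ((((s'.setR 3 x).putR 4 L x).setN 11 (L + 1)).setN 4 (i + 1)).rvar 3 = x := by simp
      rw [e1, e2, e3]
      have hx0 : 0 < x := by linarith
      refine ⟨⟨?_, ?_, ?_, ?_⟩, ?_, by simp⟩
      · intro l hlL
        rcases eq_or_ne l L with rfl | hne
        · simpa using hx0
        · rw [Function.update_of_ne hne]; exact hS.pos l (by omega)
      · intro l hlL
        rcases eq_or_ne l L with rfl | hne
        · exact ⟨i, by omega, by simp [hxv]⟩
        · rw [Function.update_of_ne hne]
          obtain ⟨c, hc, hcl⟩ := hS.exists_eq l (by omega)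
          exact ⟨c, by omega, hcl⟩
      · intro l hlL
        rw [Function.update_of_ne (by omega : l ≠ L)]
        rcases eq_or_ne (l + 1) L with h | hne
        · rw [h, Function.update_self, ← hl l h]; exact hb
        · rw [Function.update_of_ne hne]; exact hS.doubling l (by omega)
      · intro c hc hc0
        rcases eq_or_ne c i with rfl | hne
        · exact ⟨L, by omega, by rw [Function.update_self, ← hxv]; constructor <;> linarith⟩
        · obtain ⟨l, hlL, h⟩ := hS.exists_near c (by omega) hc0
          exact ⟨l, by omega, by rwa [Function.update_of_ne (by omega)]⟩
      · intro l hlL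
        rw [show l = L by omega, Function.update_self]
    · intro hb
      simp only [BExp.Holds, RExp.eval, NExp.eval, h2, hx, Nat.cast_ofNat, not_lt] at hb
      refine Runs.skip (by norm_num) ⟨⟨?_, ?_, ?_, ?_⟩, ?_, ?_⟩
      · simpa using hS.pos
      · intro l hlL
        obtain ⟨c, hc, hcl⟩ := hS.exists_eq l (by simpa using hlL)
        exact ⟨c, by omega, by simpa using hcl⟩
      · simpa using hS.doubling
      · intro c hc hc0
        rcases eq_or_ne c i with rfl | hne
        · have hL : s'.nvar 11 ≠ 0 := by
            intro h
            rw [hz h] at hb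
            linarith
          have hle := hl (s'.nvar 11 - 1) (by omega)
          obtain ⟨c', hc', hcl⟩ := hS.exists_eq (s'.nvar 11 - 1) (by omega)
          refine ⟨s'.nvar 11 - 1, by simp; omega, ?_, ?_⟩
          · simpa [hcl] using hmono c' c hc'.le hi
          · simpa [← hle] using hb
        · simpa using hS.exists_near c (by omega) hc0
      · simpa using hl
      · simpa using hz
  · simp only [NExp.cost]; omega
  · exact fun s' _ _ h => h.1

theorem AreScales.length_le {p : Fin n → M} {d val r : ℕ → ℝ} {ord : ℕ → ℕ} {L : ℕ}
    (h : AreScales (n * n) val L r) (hs : IsSorted (n * n) d ord val)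
    (hd : ∀ u v : Fin n, d (u * n + v) = dist (p u) (p v)) : L ≤ n := by
  have : ∀ i : Fin L, ∃ e : Fin n × Fin n, r i = dist (p e.1) (p e.2) := by
    intro i
    obtain ⟨c, hc, hr⟩ := h.exists_eq i i.2
    obtain ⟨u, v, huv⟩ := exists_pair_index (hs.lt c hc)
    exact ⟨(u, v), by rw [hr, hs.val_eq c hc, huv, hd]⟩
  choose E hE using this
  exact length_le_of_doubling p r E hE h.pos h.doubling

theorem AreScales.exists_near_dist {p : Fin n → M} (hp : Function.Injective p)
    {d val r : ℕ → ℝ} {ord : ℕ → ℕ} {L : ℕ}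
    (h : AreScales (n * n) val L r) (hs : IsSorted (n * n) d ord val)
    (hd : ∀ u v : Fin n, d (u * n + v) = dist (p u) (p v)) (u v : Fin n) (huv : u ≠ v) :
    ∃ i < L, r i ≤ dist (p u) (p v) ∧ dist (p u) (p v) ≤ 2 * r i := by
  obtain ⟨c, hc, hcq⟩ := hs.surj _ (pair_index_lt u.2 v.2)
  have hval : val c = dist (p u) (p v) := by rw [hs.val_eq c hc, hcq, hd]
  rw [← hval]
  exact h.exists_near c hc (by rw [hval]; exact dist_pos.2 fun h' => huv (hp h'))

/-- Sort the candidates for the threshold into array `5`; their number is in register `10`. -/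
def sortCandidates : Cmd :=
  queueClear ;; .nset 6 (.const 0) ;;
  .forUp 4 (.var 11) (.forUp 5 (.var 11) ((.nset 8 (.var 6) ;;
      .nset 9 (.add (.var 6) (.const 1)) ;;
      .rset 1 (.mul (.mul (.add (.cast (.var 2)) (.cast (.const 1)))
          (.mul (.cast (.const 2)) (.cast (.var 0))))
        (.div (.get 4 (.var 4)) (.get 4 (.var 5)))) ;;
      .nset 6 (.add (.var 6) (.const 1))) ;; treeSet)) ;;
  queueDrain 12 5

theorem sortCandidates_runs {s : State} {L k : ℕ} (ht : Tables n s) (h2 : s.nvar 2 = k)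
    (h11 : s.nvar 11 = L) (hL : L ≤ n) (hn : 1 ≤ n) :
    Runs sortCandidates s (1000 * (n * n) * (Nat.log 2 (n * n + n * n) + 1)) fun s' =>
      s'.nvar 10 = L * L ∧
      (∀ c c', c ≤ c' → c' < L * L → s'.rarr 5 c ≤ s'.rarr 5 c') ∧
      ∀ i < L, ∀ j < L, ∃ c < L * L,
        s'.rarr 5 c = (k + 1) * (2 * n) * (s.rarr 4 i / s.rarr 4 j) := by
  set lg := Nat.log 2 (n * n + n * n) with hlg
  set F : ℕ → ℕ → ℝ := fun i j => (k + 1) * (2 * n) * (s.rarr 4 i / s.rarr 4 j) with hF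
  -- The pairs of scales are numbered row by row with row length `L`, not `n`; since `L ≤ n`, they
  -- fit into the queue with `n * n` leaves.
  set key : ℕ → ℝ := fun q => F (q / L) (q % L) with hkey
  have hkeyF : ∀ i j, j < L → key (i * L + j) = F i j := by
    intro i j hj
    rw [hkey]
    simp only
    rw [mul_comm i L, Nat.mul_add_div (by omega), Nat.div_eq_of_lt hj, add_zero, Nat.mul_add_mod,
      Nat.mod_eq_of_lt hj]
  have hLL : L * L ≤ n * n := Nat.mul_le_mul hL hL
  have hnn : n ≤ n * n := Nat.le_mul_self n
  have hl : n * n ≤ n * n * (lg + 1) := Nat.le_mul_of_pos_right _ (by omega)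
  refine Runs.seq (B₁ := 50 * (n * n) + 20)
    (B₂ := 2 + (L * (L * (100 * (lg + 1) + 58) + 14) + 6 + (150 * (L * L) * (lg + 1) + 20)))
    (queueClear_runs ht.size key) ?_ ?_
  swap
  · have e1 : L * (L * (100 * (lg + 1) + 58) + 14) =
        100 * (L * L * (lg + 1)) + 58 * (L * L) + 14 * L := by ring
    have e2 : 150 * (L * L) * (lg + 1) = 150 * (L * L * (lg + 1)) := by ring
    have e3 : 1000 * (n * n) * (lg + 1) = 1000 * (n * n * (lg + 1)) := by ring
    have e4 : L * L * (lg + 1) ≤ n * n * (lg + 1) := Nat.mul_le_mul_right _ hLL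
    rw [e1, e2, e3]
    omega
  intro s₁ hag₁ hq₁
  refine Runs.seq (B₁ := 2)
    (B₂ := L * (L * (100 * (lg + 1) + 58) + 14) + 6 + (150 * (L * L) * (lg + 1) + 20))
    (P := fun s' => s' = s₁.setN 6 0) (Runs.straight rfl (by decide) rfl) ?_ le_rfl
  rintro s₂ - rfl
  have b11 : s₁.nvar 11 = L := (hag₁.nvar 11 rfl).trans h11
  refine Runs.seq (B₁ := L * (L * (100 * (lg + 1) + 58) + 14) + 6)
    (B₂ := 150 * (L * L) * (lg + 1) + 20)
    (P := Queue (n * n) (Finset.range (L * L)) key) ?_ ?_ le_rfl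
  · refine Runs.forUp (N := L) (B := L * (100 * (lg + 1) + 58) + 6) (fun i s' =>
      s'.nvar 6 = i * L ∧ Queue (n * n) (Finset.range (i * L)) key s') rfl ?_ ?_ ?_ ?_ ?_
    · intro s' hag
      simp [hag.nvar 11 rfl, b11]
    · exact ⟨by simp, by rw [zero_mul, Finset.range_zero]; exact hq₁.congr (by simp) rfl rfl⟩
    · rintro i s' hi hag hx ⟨h6, hq⟩
      refine Runs.forUp (N := L) (B := 100 * (lg + 1) + 50) (fun j s' =>
        s'.nvar 6 = i * L + j ∧ Queue (n * n) (Finset.range (i * L + j)) key s') rfl ?_ ?_ ?_ ?_ ?_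
      · intro s'' hag''
        simp [hag''.nvar 11 rfl, hag.nvar 11 rfl, b11]
      · exact ⟨by simpa using h6, hq.congr (by simp) rfl rfl⟩
      · rintro j s₃ hj hag₃ hx₃ ⟨g6, gq⟩
        have g4 : s₃.nvar 4 = i := (hag₃.nvar 4 rfl).trans (by simpa using hx)
        have g2 : s₃.nvar 2 = k :=
          (hag₃.nvar 2 rfl).trans ((hag.nvar 2 rfl).trans (by simpa [hag₁.nvar 2 rfl] using h2))
        have g0 : s₃.nvar 0 = n :=
          (hag₃.nvar 0 rfl).trans ((hag.nvar 0 rfl).trans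
            (by simpa [hag₁.nvar 0 rfl] using ht.vertices))
        have ga : s₃.rarr 4 = s.rarr 4 :=
          (hag₃.rarr 4 rfl).trans ((hag.rarr 4 rfl).trans (by simp [hag₁.rarr 4 rfl]))
        refine Runs.seq (B₁ := 50) (B₂ := 100 * (lg + 1)) (P := fun s₄ => s₄.nvar 8 = i * L + j ∧
          s₄.nvar 9 = i * L + j + 1 ∧ s₄.rvar 1 = F i j ∧ s₄.nvar 6 = i * L + j + 1 ∧
          Queue (n * n) (Finset.range (i * L + j)) key s₄) ?_ ?_ (by omega)
        · refine Runs.straight rfl (by decide) ⟨?_, ?_, ?_, ?_, gq.congr ?_ rfl rfl⟩ <;>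
            simp [Cmd.run, g6, g4, g2, g0, ga, hx₃, hF]
        · rintro s₄ - ⟨e8, e9, e1, e6, hq₄⟩
          refine (queueInsert_range_runs hq₄ e8 ((pair_index_lt hi hj).trans_le hLL) e9
            (by rw [e1, hkeyF i j hj])).mono le_rfl ?_
          intro s₅ hag₅ hq₅
          refine ⟨?_, hq₅.congr (by simp) rfl rfl⟩
          simp [hag₅.nvar 6 rfl, e6, add_assoc]
      · simp only [NExp.cost]
        exact le_of_eq (by ring)
      · rintro s₃ - - ⟨g6, gq⟩
        have e : i * L + L = (i + 1) * L := by ring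
        rw [e] at g6 gq
        exact ⟨by simpa using g6, gq.congr (by simp) rfl rfl⟩
    · simp only [NExp.cost]
      exact le_of_eq (by ring)
    · exact fun s' _ _ h => h.2
  · intro s₂ _ hq₂
    refine (queueDrain_runs (a := 12) (b := 5) (by norm_num) (by norm_num)
      (Nat.mul_pos hn hn) hq₂).mono ?_ ?_
    · simp [hlg]
    · rintro s' - ⟨h10, g1, g2, g4⟩
      simp only [Finset.card_range, Finset.mem_range] at h10 g1 g2 g4
      refine ⟨h10, g4, fun i hi j hj => ?_⟩
      obtain ⟨c, hc, hcq⟩ := g2 (i * L + j) (pair_index_lt hi hj)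
      exact ⟨c, hc, by rw [(g1 c hc).2, hcq, hkeyF i j hj]⟩

end Dilation

/-! ### Updating the distance matrix after an insertion -/

namespace Dilation

open RealRAM

variable {n : ℕ} {M : Type*} [MetricSpace M]

/-- Improve the entry of the pair `(x, y)`, `x = s.nvar 19`, `y = s.nvar 20`, of the distance
matrix in the arrays `11` and `6` by a path through the edge from the vertex in register `a` to
the vertex in register `b`, whose length is in the real register `5`. -/
def relaxThrough (a b : ℕ) : Cmd :=
  (.nset 21 (.add (.get 2 (.var 19)) (.var a)) ;; .nset 22 (.add (.get 2 (.var b)) (.var 20)) ;;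
    .nset 23 (.add (.get 2 (.var 19)) (.var 20)) ;;
    .rset 6 (.add (.add (.get 6 (.var 21)) (.var 5)) (.get 6 (.var 22)))) ;;
  .cond (.and (.and (.not (.neq (.get 11 (.var 21)) (.const 0)))
      (.not (.neq (.get 11 (.var 22)) (.const 0))))
      (.or (.neq (.get 11 (.var 23)) (.const 0)) (.rlt (.var 6) (.get 6 (.var 23)))))
    (.nput 11 (.var 23) (.const 1) ;; .rput 6 (.var 23) (.var 6)) .skip

/-- The entries of the matrix are upper bounds for the distances in `H`. -/
structure IsUpperMatrix (p : Fin n → M) (H : SimpleGraph (Fin n)) (f : ℕ → ℕ) (d : ℕ → ℝ) :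
    Prop where
  nonneg : ∀ q < n * n, f q ≠ 0 → 0 ≤ d q
  le : ∀ u v : Fin n, graphDist p H u v ≤ matrixEntry f d (u * n + v)

theorem matrixEntry_of_ne {f : ℕ → ℕ} {d : ℕ → ℝ} {q : ℕ} (h : f q ≠ 0) :
    matrixEntry f d q = ENNReal.ofReal (d q) := if_neg h

theorem matrixEntry_of_eq {f : ℕ → ℕ} {d : ℕ → ℝ} {q : ℕ} (h : f q = 0) :
    matrixEntry f d q = ∞ := if_pos h

/-- Expressed in `ℝ≥0∞` through `matrixEntry`, the marks for infinite entries disappear from the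
statement, and both outcomes of the test give the same triangle-type inequality. -/
theorem relaxThrough_runs {p : Fin n → M} {H : SimpleGraph (Fin n)} {s : State}
    {ra rb : ℕ} {a b x y : Fin n} (ht : Tables n s)
    (hra : ra < 21) (hrb : rb < 21) (ha : s.nvar ra = a)
    (hb : s.nvar rb = b) (hx : s.nvar 19 = x) (hy : s.nvar 20 = y)
    (h5 : s.rvar 5 = dist (p a) (p b)) (hab : graphDist p H a b ≤ edist (p a) (p b))
    (h : IsUpperMatrix p H (s.narr 11) (s.rarr 6)) :
    Runs (relaxThrough ra rb) s 70 fun s' =>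
      IsUpperMatrix p H (s'.narr 11) (s'.rarr 6) ∧
      (∀ q, matrixEntry (s'.narr 11) (s'.rarr 6) q ≤ matrixEntry (s.narr 11) (s.rarr 6) q) ∧
      matrixEntry (s'.narr 11) (s'.rarr 6) (x * n + y) ≤
        matrixEntry (s.narr 11) (s.rarr 6) (x * n + a) + edist (p a) (p b) +
          matrixEntry (s.narr 11) (s.rarr 6) (b * n + y) := by
  refine Runs.seq (B₁ := 30) (B₂ := 40) (P := fun s₁ => s₁.nvar 21 = x * n + a ∧
      s₁.nvar 22 = b * n + y ∧ s₁.nvar 23 = x * n + y ∧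
      s₁.rvar 6 = s.rarr 6 (x * n + a) + dist (p a) (p b) + s.rarr 6 (b * n + y) ∧
      s₁.narr 11 = s.narr 11 ∧ s₁.rarr 6 = s.rarr 6) ?_ ?_ le_rfl
  · have e1 : ra ≠ 21 := by omega
    have e2 : rb ≠ 21 := by omega
    refine Runs.straight rfl (by simp [Cmd.maxCost, NExp.cost, RExp.cost]) ⟨?_, ?_, ?_, ?_, ?_, ?_⟩
      <;> simp [Cmd.run, hx, hy, ha, hb, ht.row, h5, e2]
  rintro s₁ - ⟨e21, e22, e23, e6, ef, ed⟩
  set f := s.narr 11 with hf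
  set d := s.rarr 6 with hd
  set z := d (x * n + a) + dist (p a) (p b) + d (b * n + y) with hz
  have hqa : (x * n + a : ℕ) < n * n := pair_index_lt x.2 a.2
  have hqb : (b * n + y : ℕ) < n * n := pair_index_lt b.2 y.2
  refine Runs.cond (B := 10) ?_ ?_ (by decide)
  · intro hc
    simp only [BExp.Holds, NExp.eval, RExp.eval, e21, e22, e23, e6, ef, ed] at hc
    obtain ⟨⟨hc1, hc2⟩, hc3⟩ := hc
    have h1 := h.nonneg _ hqa hc1
    have h2 := h.nonneg _ hqb hc2
    have hz0 : 0 ≤ z := add_nonneg (add_nonneg h1 dist_nonneg) h2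
    have hze : ENNReal.ofReal z = matrixEntry f d (x * n + a) + edist (p a) (p b) +
        matrixEntry f d (b * n + y) := by
      rw [matrixEntry_of_ne hc1, matrixEntry_of_ne hc2, edist_dist,
        ← ENNReal.ofReal_add h1 dist_nonneg, ← ENNReal.ofReal_add (add_nonneg h1 dist_nonneg) h2]
    refine Runs.straight rfl (by decide) ?_
    have g1 : (Cmd.run (.nput 11 (.var 23) (.const 1) ;; .rput 6 (.var 23) (.var 6)) s₁).narr 11 =
        Function.update f (x * n + y) 1 := by simp [Cmd.run, e23, ef]
    have g2 : (Cmd.run (.nput 11 (.var 23) (.const 1) ;; .rput 6 (.var 23) (.var 6)) s₁).rarr 6 =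
        Function.update d (x * n + y) z := by simp [Cmd.run, e23, e6, ed]
    rw [g1, g2]
    have k1 : matrixEntry (Function.update f (x * n + y) 1) (Function.update d (x * n + y) z)
        (x * n + y) = ENNReal.ofReal z := by simp [matrixEntry]
    have k2 : ∀ q, q ≠ x * n + y → matrixEntry (Function.update f (x * n + y) 1)
        (Function.update d (x * n + y) z) q = matrixEntry f d q := by
      intro q hq
      simp [matrixEntry, hq]
    refine ⟨⟨?_, ?_⟩, ?_, ?_⟩
    · intro q hq
      rcases eq_or_ne q (x * n + y) with rfl | hne
      · simpa using hz0
      · simpa [hne] using h.nonneg q hq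
    · intro u v
      by_cases heq : (u * n + v : ℕ) = x * n + y
      · rw [heq, k1, hze]
        obtain ⟨hu, hv⟩ := pair_index_inj v.2 y.2 heq
        obtain rfl := Fin.ext hu
        obtain rfl := Fin.ext hv
        refine (graphDist_triangle p H u b v).trans (add_le_add ?_ (h.le b v))
        exact (graphDist_triangle p H u a b).trans (add_le_add (h.le u a) hab)
      · rw [k2 _ heq]; exact h.le u v
    · intro q
      rcases eq_or_ne q (x * n + y) with rfl | hne
      · rw [k1]
        by_cases h0 : f (x * n + y) = 0
        · rw [matrixEntry_of_eq h0]; exact le_top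
        · rw [matrixEntry_of_ne h0]
          exact ENNReal.ofReal_le_ofReal (hc3.resolve_left h0).le
      · rw [k2 q hne]
    · rw [k1, hze]
  · intro hc
    simp only [BExp.Holds, NExp.eval, RExp.eval, e21, e22, e23, e6, ef, ed] at hc
    refine Runs.skip (by norm_num) ?_
    rw [ef, ed]
    refine ⟨h, fun q => le_rfl, ?_⟩
    by_cases hc1 : f (x * n + a) = 0
    · simp [matrixEntry_of_eq hc1]
    by_cases hc2 : f (b * n + y) = 0
    · simp [matrixEntry_of_eq hc2]
    have hc3 : f (x * n + y) ≠ 0 ∧ d (x * n + y) ≤ z := by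
      by_contra h'
      refine hc ⟨⟨hc1, hc2⟩, ?_⟩
      by_contra h''
      rw [not_or, not_lt] at h''
      exact h' h''
    have h1 := h.nonneg _ hqa hc1
    have h2 := h.nonneg _ hqb hc2
    rw [matrixEntry_of_ne hc1, matrixEntry_of_ne hc2, matrixEntry_of_ne hc3.1, edist_dist,
      ← ENNReal.ofReal_add h1 dist_nonneg, ← ENNReal.ofReal_add (add_nonneg h1 dist_nonneg) h2]
    exact ENNReal.ofReal_le_ofReal hc3.2

/-- Update the distance matrix after the insertion of the edge between the vertices in the
registers `17` and `18`, whose length is in the real register `5`. -/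
def insertEdge : Cmd :=
  .forUp 24 (.var 3) ((.nset 19 (.get 3 (.var 24)) ;; .nset 20 (.get 4 (.var 24))) ;;
    relaxThrough 17 18 ;; relaxThrough 18 17)

/-- The matrix may be overwritten in place. Throughout, entries are at least the distances in `H`
and at most those in `G`, so using an already improved entry does no harm; after both orientations
have been tried, the bound `le_graphDist_of_insert` is matched. -/
theorem insertEdge_runs {p : Fin n → M} {G H : SimpleGraph (Fin n)} {s : State} {u v : Fin n}
    (ht : Tables n s) (hGH : G ≤ H)
    (hH : ∀ a b, H.Adj a b → G.Adj a b ∨ (a = u ∧ b = v) ∨ (a = v ∧ b = u))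
    (hadj : H.Adj u v) (hu : s.nvar 17 = u) (hv : s.nvar 18 = v)
    (h5 : s.rvar 5 = dist (p u) (p v)) (h : IsDistMatrix p G (s.narr 11) (s.rarr 6)) :
    Runs insertEdge s (170 * (n * n) + 10) fun s' =>
      IsDistMatrix p H (s'.narr 11) (s'.rarr 6) := by
  refine Runs.forUp (N := n * n) (B := 150) (fun i s' =>
    IsUpperMatrix p H (s'.narr 11) (s'.rarr 6) ∧
    (∀ x y : Fin n, matrixEntry (s'.narr 11) (s'.rarr 6) (x * n + y) ≤ graphDist p G x y) ∧
    ∀ x y : Fin n, (x * n + y : ℕ) < i →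
      matrixEntry (s'.narr 11) (s'.rarr 6) (x * n + y) ≤
        graphDist p G x u + edist (p u) (p v) + graphDist p G v y ∧
      matrixEntry (s'.narr 11) (s'.rarr 6) (x * n + y) ≤
        graphDist p G x v + edist (p u) (p v) + graphDist p G u y) rfl ?_ ?_ ?_ ?_ ?_
  · intro s' hag
    simp [hag.nvar 3 rfl, ht.size]
  · refine ⟨⟨h.nonneg, fun x y => ?_⟩, fun x y => (h.eq x y).le, by simp⟩
    rw [State.setN_narr, State.setN_rarr, h.eq]
    exact graphDist_anti p hGH x y
  · rintro i s' hi hag hx ⟨hU, hle, hdone⟩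
    have ht' : Tables n s' := ht.agree hag rfl rfl rfl rfl rfl
    obtain ⟨x, y, rfl⟩ := exists_pair_index hi
    have f17 : s'.nvar 17 = u := (hag.nvar 17 rfl).trans hu
    have f18 : s'.nvar 18 = v := (hag.nvar 18 rfl).trans hv
    have f5 : s'.rvar 5 = dist (p u) (p v) := (hag.rvar 5 rfl).trans h5
    refine Runs.seq (B₁ := 8) (B₂ := 140)
      (P := fun s₁ => s₁ = (s'.setN 19 x).setN 20 y) ?_ ?_ (by norm_num)
    · refine Runs.straight rfl (by decide) ?_
      simp [Cmd.run, hx, ht'.fst, ht'.snd]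
    rintro s₁ - rfl
    set s₁ := (s'.setN 19 x).setN 20 y with hs₁
    have ht₁ : Tables n s₁ := ht'.congr (by simp [hs₁]) (by simp [hs₁]) rfl rfl rfl
    refine Runs.seq (B₁ := 70) (B₂ := 70)
      (relaxThrough_runs ht₁ (p := p) (H := H) (a := u) (b := v) (x := x) (y := y) (by norm_num)
        (by norm_num) (by simpa [hs₁] using f17) (by simpa [hs₁] using f18) (by simp [hs₁])
        (by simp [hs₁]) (by simpa [hs₁] using f5) (graphDist_le_edist_of_adj p hadj) hU) ?_ le_rfl
    rintro s₂ hag₂ ⟨hU₂, hm₂, hk₂⟩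
    have g17 : s₂.nvar 17 = u := (hag₂.nvar 17 rfl).trans (by simpa [hs₁] using f17)
    have g18 : s₂.nvar 18 = v := (hag₂.nvar 18 rfl).trans (by simpa [hs₁] using f18)
    have g19 : s₂.nvar 19 = x := (hag₂.nvar 19 rfl).trans (by simp [hs₁])
    have g20 : s₂.nvar 20 = y := (hag₂.nvar 20 rfl).trans (by simp [hs₁])
    have g5 : s₂.rvar 5 = dist (p v) (p u) :=
      (hag₂.rvar 5 rfl).trans (by simpa [hs₁, dist_comm (p v)] using f5)
    refine (relaxThrough_runs (p := p) (H := H) (ht₁.agree hag₂ rfl rfl rfl rfl rfl)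
      (by norm_num) (by norm_num) g18 g17 g19 g20 g5
      (graphDist_le_edist_of_adj p hadj.symm) hU₂).mono le_rfl ?_
    rintro s₃ - ⟨hU₃, hm₃, hk₃⟩
    simp only [State.setN_narr, State.setN_rarr]
    have hm : ∀ q, matrixEntry (s₃.narr 11) (s₃.rarr 6) q ≤
        matrixEntry (s'.narr 11) (s'.rarr 6) q := fun q => (hm₃ q).trans (hm₂ q)
    refine ⟨hU₃, fun a b => (hm _).trans (hle a b), fun a b hab => ?_⟩
    by_cases heq : (a * n + b : ℕ) = x * n + y
    · obtain ⟨ha, hb⟩ := pair_index_inj b.2 y.2 heq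
      obtain rfl := Fin.ext ha
      obtain rfl := Fin.ext hb
      refine ⟨(hm₃ _).trans (hk₂.trans ?_), hk₃.trans ?_⟩
      · exact add_le_add (add_le_add (hle a u) le_rfl) (hle v b)
      · rw [edist_comm (p v)]
        exact add_le_add (add_le_add ((hm₂ _).trans (hle a v)) le_rfl) ((hm₂ _).trans (hle u b))
    · have := hdone a b (by omega)
      exact ⟨(hm _).trans this.1, (hm _).trans this.2⟩
  · simp only [NExp.cost]; omega
  · rintro s' - - ⟨hU, hle, hdone⟩
    refine ⟨hU.nonneg, fun x y => le_antisymm ?_ (hU.le x y)⟩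
    have := hdone x y (pair_index_lt x.2 y.2)
    exact (le_min (hle x y) (le_min this.1 this.2)).trans (le_graphDist_of_insert p hH x y)

/-- The results of the preprocessing on which the greedy algorithm works. -/
structure Prepared (p : Fin n → M) (G : SimpleGraph (Fin n)) (k : ℕ) (s : State) : Prop where
  tables : Tables n s
  budget : s.nvar 2 = k
  distances : ∀ u v : Fin n, s.rarr 0 (u * n + v) = dist (p u) (p v)
  sorted : IsSorted (n * n) (s.rarr 0) (s.narr 10) (s.rarr 2)
  matrix : IsDistMatrix p G (s.narr 9) (s.rarr 3)

theorem Prepared.agree {p : Fin n → M} {G : SimpleGraph (Fin n)} {k : ℕ} {s s' : State} {c : Cmd}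
    (h : Prepared p G k s) (ha : Agree c s s')
    (hn : ∀ x ∈ [0, 2, 3], c.writesN x = false)
    (hna : ∀ x ∈ [2, 3, 4, 9, 10], c.writesNA x = false)
    (hra : ∀ x ∈ [0, 2, 3], c.writesRA x = false) : Prepared p G k s' := by
  simp only [List.mem_cons, List.not_mem_nil, or_false, forall_eq_or_imp, forall_eq] at hn hna hra
  refine ⟨h.tables.agree ha hn.1 hn.2.2 hna.1 hna.2.1 hna.2.2.1, (ha.nvar 2 hn.2.1).trans h.budget,
    ?_, ?_, ?_⟩
  · rw [ha.rarr 0 hra.1]; exact h.distances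
  · rw [ha.rarr 0 hra.1, ha.rarr 2 hra.2.1, ha.narr 10 hna.2.2.2.2]; exact h.sorted
  · rw [ha.rarr 3 hra.2.2, ha.narr 9 hna.2.2.2.1]; exact h.matrix

end Dilation

/-! ### The greedy test -/

namespace Dilation

open RealRAM

variable {n : ℕ} {M : Type*} [MetricSpace M]

/-- Process the pair number `s.nvar 15` in the greedy algorithm with the threshold in the real
register `4`. Register `13` counts the inserted edges, and register `14` is set to `0` if there
would be too many of them. -/
def greedyStep : Cmd :=
  (.nset 16 (.get 10 (.var 15)) ;; .nset 17 (.get 3 (.var 16)) ;; .nset 18 (.get 4 (.var 16)) ;;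
    .rset 5 (.get 0 (.var 16))) ;;
  .cond (.or (.neq (.get 11 (.var 16)) (.const 0))
      (.rlt (.mul (.var 4) (.var 5)) (.get 6 (.var 16))))
    (.cond (.nlt (.var 13) (.var 2))
      (.nset 13 (.add (.var 13) (.const 1)) ;; insertEdge) (.nset 14 (.const 0)))
    .skip

/-- Test by the greedy algorithm whether `k` edges suffice for the dilation in the real
register `4`; register `14` contains the answer. -/
def greedy : Cmd :=
  .cond (.rlt (.var 4) (.cast (.const 1))) (.nset 14 (.const 0))
    (.forUp 4 (.var 3) (.nput 11 (.var 4) (.get 9 (.var 4)) ;; .rput 6 (.var 4) (.get 3 (.var 4))) ;;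
      (.nset 13 (.const 0) ;; .nset 14 (.const 1)) ;;
      .forUp 15 (.var 3) greedyStep)

/-- The state of the greedy algorithm after the first `c` pairs, as long as it has not failed. -/
structure GreedyInv (p : Fin n → M) (G : SimpleGraph (Fin n)) (k : ℕ) (T : ℝ) (ord : ℕ → ℕ)
    (val : ℕ → ℝ) (c : ℕ) (l : List (Fin n × Fin n)) (s : State) : Prop where
  chain : GreedyChain p G T l
  length : l.length = s.nvar 13
  length_le : l.length ≤ k
  flag : s.nvar 14 = 1
  matrix : IsDistMatrix p (addEdges G l.toFinset) (s.narr 11) (s.rarr 6)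
  earlier : ∀ f ∈ l, ∃ c' < c, dist (p f.1) (p f.2) = val c'
  satisfied : ∀ c' < c, ∀ u v : Fin n, ord c' = u * n + v →
    graphDist p (addEdges G l.toFinset) u v ≤ ENNReal.ofReal (T * dist (p u) (p v))

theorem GreedyInv.congr {p : Fin n → M} {G : SimpleGraph (Fin n)} {k : ℕ} {T : ℝ} {ord : ℕ → ℕ}
    {val : ℕ → ℝ} {c : ℕ} {l : List (Fin n × Fin n)} {s s' : State}
    (h : GreedyInv p G k T ord val c l s) (h13 : s'.nvar 13 = s.nvar 13)
    (h14 : s'.nvar 14 = s.nvar 14) (h11 : s'.narr 11 = s.narr 11) (h6 : s'.rarr 6 = s.rarr 6) :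
    GreedyInv p G k T ord val c l s' :=
  ⟨h.chain, h.length.trans h13.symm, h.length_le, h14.trans h.flag, by rw [h11, h6]; exact h.matrix,
    h.earlier, h.satisfied⟩

/-- The sorted order supplies both side conditions of a chain: edges inserted earlier are not
longer, and strictly shorter pairs have already been processed, hence satisfy the threshold. -/
theorem GreedyInv.chain_cons {p : Fin n → M} {G : SimpleGraph (Fin n)} {k : ℕ} {T : ℝ}
    {d : ℕ → ℝ} {ord : ℕ → ℕ} {val : ℕ → ℝ} {c : ℕ} {l : List (Fin n × Fin n)} {s : State}
    (h : GreedyInv p G k T ord val c l s)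
    (hd : ∀ u v : Fin n, d (u * n + v) = dist (p u) (p v))
    (hs : IsSorted (n * n) d ord val) (hc : c < n * n) {u v : Fin n} (huv : ord c = u * n + v)
    (hviol : ENNReal.ofReal (T * dist (p u) (p v)) < graphDist p (addEdges G l.toFinset) u v) :
    GreedyChain p G T ((u, v) :: l) := by
  have hval : val c = dist (p u) (p v) := by rw [hs.val_eq c hc, huv, hd]
  refine GreedyChain.cons h.chain ?_ hviol ?_
  · intro f hf
    obtain ⟨c', hc', hf'⟩ := h.earlier f hf
    rw [hf', ← hval]
    exact hs.mono c' c hc'.le hc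
  · intro x y hxy
    obtain ⟨c', hc', hx⟩ := hs.surj _ (pair_index_lt x.2 y.2)
    refine h.satisfied c' ?_ x y hx
    by_contra hge
    have := hs.mono c c' (by omega) hc'
    rw [hval, hs.val_eq c' hc', hx, hd] at this
    linarith

/-- The cost `A` is left open, because a step is either constant or pays for one matrix update out
of the credit for the `k - l.length` insertions still allowed. -/
theorem greedyStep_runs {p : Fin n → M} (hp : Function.Injective p) (hn : 2 ≤ n)
    {G : SimpleGraph (Fin n)} {k : ℕ} (hk : 1 ≤ k) (hkn : k ≤ n * n) {T : ℝ} (hT : 1 ≤ T)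
    {c : ℕ} {l : List (Fin n × Fin n)} {s : State} (hprep : Prepared p G k s) (h4 : s.rvar 4 = T)
    (h15 : s.nvar 15 = c) (hc : c < n * n)
    (h : GreedyInv p G k T (s.narr 10) (s.rarr 2) c l s) :
    ∃ A, Runs greedyStep s A fun s' =>
      (∃ l', GreedyInv p G k T (s.narr 10) (s.rarr 2) (c + 1) l' s' ∧
        (k - l'.length) * (170 * (n * n) + 20) + A ≤
          (k - l.length) * (170 * (n * n) + 20) + 60) ∨
      (s'.nvar 14 = 0 ∧ s'.nvar 13 = k ∧ A ≤ 60 ∧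
        ENNReal.ofReal T < ENNReal.ofReal (k + 1) * minDilation p G k) := by
  obtain ⟨u, v, huv⟩ := exists_pair_index (hprep.sorted.lt c hc)
  have ht := hprep.tables
  have hfirst : Runs (.nset 16 (.get 10 (.var 15)) ;; .nset 17 (.get 3 (.var 16)) ;;
      .nset 18 (.get 4 (.var 16)) ;; .rset 5 (.get 0 (.var 16))) s 20 fun s₁ =>
      s₁.nvar 16 = u * n + v ∧ s₁.nvar 17 = u ∧ s₁.nvar 18 = v ∧ s₁.rvar 5 = dist (p u) (p v) ∧
      GreedyInv p G k T (s.narr 10) (s.rarr 2) c l s₁ := by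
    refine Runs.straight rfl (by decide) ⟨?_, ?_, ?_, ?_, h.congr ?_ ?_ ?_ ?_⟩ <;>
      simp [Cmd.run, h15, huv, ht.fst, ht.snd, hprep.distances]
  have hT0 : 0 ≤ T * dist (p u) (p v) := mul_nonneg (by linarith) dist_nonneg
  have hval : s.rarr 2 c = dist (p u) (p v) := by
    rw [hprep.sorted.val_eq c hc, huv, hprep.distances]
  by_cases hviol : ENNReal.ofReal (T * dist (p u) (p v)) <
      graphDist p (addEdges G l.toFinset) u v
  · have hchain := h.chain_cons hprep.distances hprep.sorted hc huv hviol
    have htest : ∀ s₁ : State, Agree (.nset 16 (.get 10 (.var 15)) ;; .nset 17 (.get 3 (.var 16)) ;;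
        .nset 18 (.get 4 (.var 16)) ;; .rset 5 (.get 0 (.var 16))) s s₁ →
        s₁.nvar 16 = u * n + v → s₁.rvar 5 = dist (p u) (p v) →
        GreedyInv p G k T (s.narr 10) (s.rarr 2) c l s₁ →
        BExp.Holds s₁ (.or (.neq (.get 11 (.var 16)) (.const 0))
          (.rlt (.mul (.var 4) (.var 5)) (.get 6 (.var 16)))) := by
      intro s₁ hag e16 e5 hI
      simp only [BExp.Holds, NExp.eval, RExp.eval, e16, e5, hag.rvar 4 rfl, h4]
      by_cases h0 : s₁.narr 11 (u * n + v) = 0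
      · exact Or.inl h0
      · refine Or.inr ?_
        rw [← hI.matrix.eq, matrixEntry_of_ne h0] at hviol
        exact (ENNReal.ofReal_lt_ofReal_iff_of_nonneg hT0).1 hviol
    by_cases hlk : l.length < k
    -- The update costs `170 * (n * n) + 10`; the credit of one edge covers it, and the tests fit
    -- into the allowance of `60`.
    · refine ⟨20 + (8 + (4 + (4 + (170 * (n * n) + 10)))) + 7, ?_⟩
      refine Runs.seq hfirst (B₂ := 8 + (4 + (4 + (170 * (n * n) + 10))) + 7) ?_ (by omega)
      rintro s₁ hag₁ ⟨e16, e17, e18, e5, hI⟩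
      refine Runs.cond (B := 4 + (4 + (170 * (n * n) + 10))) (fun _ => ?_)
        (fun hf => absurd (htest s₁ hag₁ e16 e5 hI) hf)
        (by simp only [BExp.cost, NExp.cost, RExp.cost]; omega)
      have e13 : s₁.nvar 13 < s₁.nvar 2 := by
        rw [← hI.length, hag₁.nvar 2 rfl, hprep.budget]; exact hlk
      refine Runs.cond (B := 4 + (170 * (n * n) + 10)) (fun _ => ?_)
        (fun hf => absurd (by simpa using e13) hf)
        (by simp only [BExp.cost, NExp.cost]; omega)
      refine Runs.seq (B₁ := 4) (B₂ := 170 * (n * n) + 10)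
        (P := fun s₂ => s₂ = s₁.setN 13 (l.length + 1))
        (Runs.straight rfl (by decide) (by simp [Cmd.run, hI.length])) ?_ le_rfl
      rintro s₂ - rfl
      have ht₁ : Tables n (s₁.setN 13 (l.length + 1)) :=
        (ht.agree hag₁ rfl rfl rfl rfl rfl).congr (by simp) (by simp) rfl rfl rfl
      have hne : u ≠ v := by
        rintro rfl
        simp [graphDist_self] at hviol
      have hadj : (addEdges G ((u, v) :: l).toFinset).Adj u v := by
        refine Or.inr ?_
        rw [SimpleGraph.fromRel_adj]
        exact ⟨hne, Or.inl (by simp)⟩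
      have hmono : addEdges G l.toFinset ≤ addEdges G ((u, v) :: l).toFinset :=
        addEdges_mono G (by intro e he; simp only [List.mem_toFinset] at he ⊢; simp [he])
      refine (insertEdge_runs (G := addEdges G l.toFinset)
        (H := addEdges G ((u, v) :: l).toFinset) ht₁ hmono ?_ hadj
        (by simpa using e17) (by simpa using e18) (by simpa using e5)
        hI.matrix).mono le_rfl ?_
      · rintro a b (hab | hab)
        · exact Or.inl (Or.inl hab)
        · rw [SimpleGraph.fromRel_adj] at hab
          simp only [List.toFinset_cons, Finset.mem_insert, Prod.mk.injEq, List.mem_toFinset] at hab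
          rcases hab with ⟨hne', (⟨rfl, rfl⟩ | hm) | (⟨rfl, rfl⟩ | hm)⟩
          · exact Or.inr (Or.inl ⟨rfl, rfl⟩)
          · refine Or.inl (Or.inr ?_)
            rw [SimpleGraph.fromRel_adj]
            exact ⟨hne', Or.inl (List.mem_toFinset.2 hm)⟩
          · exact Or.inr (Or.inr ⟨rfl, rfl⟩)
          · refine Or.inl (Or.inr ?_)
            rw [SimpleGraph.fromRel_adj]
            exact ⟨hne', Or.inr (List.mem_toFinset.2 hm)⟩
      · intro s₃ hag₃ hmat
        refine Or.inl ⟨(u, v) :: l, ⟨hchain, ?_, hlk, ?_, hmat, ?_, ?_⟩, ?_⟩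
        · simp [hag₃.nvar 13 rfl]
        · simpa [hag₃.nvar 14 rfl] using hI.flag
        · intro f hf
          rcases List.mem_cons.1 hf with rfl | hf
          · exact ⟨c, by omega, hval.symm⟩
          · obtain ⟨c', hc', h'⟩ := h.earlier f hf
            exact ⟨c', by omega, h'⟩
        · intro c' hc' a b hab
          rcases eq_or_ne c' c with rfl | hne
          · obtain ⟨ha, hb⟩ := pair_index_inj b.2 v.2 (hab.symm.trans huv)
            obtain rfl := Fin.ext ha
            obtain rfl := Fin.ext hb
            -- The inserted edge gives its own pair dilation one, which is enough because `1 ≤ T`.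
            refine (graphDist_le_edist_of_adj p hadj).trans ?_
            rw [edist_dist]
            exact ENNReal.ofReal_le_ofReal (le_mul_of_one_le_left dist_nonneg hT)
          · exact (graphDist_anti p hmono a b).trans (h.satisfied c' (by omega) a b hab)
        · have : k - l.length = (k - ((u, v) :: l).length) + 1 := by
            simp only [List.length_cons]; omega
          rw [this, add_mul, one_mul]
          omega
    · have hlen : l.length = k := by have := h.length_le; omega
      refine ⟨60, ?_⟩
      refine Runs.seq hfirst (B₂ := 40) ?_ (by omega)
      rintro s₁ hag₁ ⟨e16, e17, e18, e5, hI⟩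
      refine Runs.cond (B := 20) (fun _ => ?_)
        (fun hf => absurd (htest s₁ hag₁ e16 e5 hI) hf) (by decide)
      have e13 : ¬ s₁.nvar 13 < s₁.nvar 2 := by
        rw [← hI.length, hag₁.nvar 2 rfl, hprep.budget]; exact hlk
      refine Runs.cond (B := 4) (fun hf => absurd hf (by simpa using e13)) (fun _ => ?_) (by decide)
      refine Runs.straight rfl (by decide) (Or.inr ⟨?_, ?_, le_rfl, ?_⟩)
      · simp [Cmd.run]
      · simp [Cmd.run, ← hI.length, hlen]
      · exact hchain.lt_minDilation hp hn (by simp [hlen]) hk hkn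
  · refine ⟨60, ?_⟩
    refine Runs.seq hfirst (B₂ := 40) ?_ (by omega)
    rintro s₁ hag₁ ⟨e16, e17, e18, e5, hI⟩
    refine Runs.cond (B := 1) (fun hf => ?_) (fun _ => ?_) (by decide)
    · exfalso
      simp only [BExp.Holds, NExp.eval, RExp.eval, e16, e5, hag₁.rvar 4 rfl, h4] at hf
      apply hviol
      rw [← hI.matrix.eq]
      rcases hf with hf | hf
      · rw [matrixEntry_of_eq hf]; exact ENNReal.ofReal_lt_top
      · rw [matrixEntry]
        split_ifs with h0
        · exact ENNReal.ofReal_lt_top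
        · exact (ENNReal.ofReal_lt_ofReal_iff_of_nonneg hT0).2 hf
    · refine Runs.skip le_rfl (Or.inl ⟨l, ⟨hI.chain, hI.length, hI.length_le, hI.flag, hI.matrix,
        fun f hf => ?_, fun c' hc' a b hab => ?_⟩, by omega⟩)
      · obtain ⟨c', hc', h'⟩ := hI.earlier f hf
        exact ⟨c', by omega, h'⟩
      · rcases eq_or_ne c' c with rfl | hne
        · obtain ⟨ha, hb⟩ := pair_index_inj b.2 v.2 (hab.symm.trans huv)
          obtain rfl := Fin.ext ha
          obtain rfl := Fin.ext hb
          exact not_lt.1 hviol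
        · exact hI.satisfied c' (by omega) a b hab

/-- The loop runs on after a failure. The counter then stays at `k`, which blocks every further
insertion and keeps the remaining steps constant. -/
theorem greedyStep_runs_of_failed {k : ℕ} {s : State} (h14 : s.nvar 14 = 0)
    (h13 : s.nvar 13 = k) (h2 : s.nvar 2 = k) :
    Runs greedyStep s 60 fun s' => s'.nvar 14 = 0 ∧ s'.nvar 13 = k := by
  refine Runs.seq (B₁ := 20) (B₂ := 40)
    (P := fun s₁ => s₁.nvar 14 = 0 ∧ s₁.nvar 13 = k ∧ s₁.nvar 2 = k) ?_ ?_ le_rfl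
  · refine Runs.straight rfl (by decide) ⟨?_, ?_, ?_⟩ <;> simp [Cmd.run, h14, h13, h2]
  rintro s₁ - ⟨e14, e13, e2⟩
  refine Runs.cond (B := 20) (fun _ => ?_) (fun _ => Runs.skip (by norm_num) ⟨e14, e13⟩) (by decide)
  refine Runs.cond (B := 4) (fun hf => absurd hf (by simp [e13, e2])) (fun _ => ?_) (by decide)
  refine Runs.straight rfl (by decide) ⟨?_, ?_⟩ <;> simp [Cmd.run, e13]

/-- The two answers are certificates that do not exclude each other; nothing is claimed about which
one is given when both inequalities hold. A threshold below `1` fails at once, since the minimum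
dilation is at least `1`. -/
theorem greedy_runs {p : Fin n → M} (hp : Function.Injective p) (hn : 2 ≤ n)
    {G : SimpleGraph (Fin n)} {k : ℕ} (hk : 1 ≤ k) (hkn : k ≤ n * n) {T : ℝ} {s : State}
    (hprep : Prepared p G k s) (h4 : s.rvar 4 = T) :
    Runs greedy s (500 * (k * (n * n))) fun s' =>
      (s'.nvar 14 = 1 ∧ minDilation p G k ≤ ENNReal.ofReal T) ∨
      (s'.nvar 14 = 0 ∧ ENNReal.ofReal T < ENNReal.ofReal (k + 1) * minDilation p G k) := by
  have hnn : 1 ≤ n * n := Nat.mul_pos (by omega) (by omega)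
  have hknn : n * n ≤ k * (n * n) := Nat.le_mul_of_pos_left _ hk
  have hkk : k ≤ k * (n * n) := Nat.le_mul_of_pos_right _ hnn
  refine Runs.cond (B := 450 * (k * (n * n))) ?_ ?_
    (by simp only [BExp.cost, NExp.cost, RExp.cost]; omega)
  · intro hb
    refine Runs.straight rfl (by simp [Cmd.maxCost, NExp.cost]; omega)
      (Or.inr ⟨by simp [Cmd.run], ?_⟩)
    have hb' : T < 1 := by simpa [h4] using hb
    have h1 := one_le_minDilation hp hn G hkn
    calc ENNReal.ofReal T < 1 := by simpa using hb'
      _ ≤ ENNReal.ofReal (k + 1) := by simp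
      _ ≤ ENNReal.ofReal (k + 1) * minDilation p G k := le_mul_of_one_le_right zero_le h1
  intro hb
  have hT : 1 ≤ T := by simpa [h4] using hb
  refine Runs.seq (B₁ := 20 * (n * n) + 10)
    (B₂ := 10 + ((n * n) * 68 + k * (170 * (n * n) + 20) + 6))
    (P := fun s₁ => ∀ q < n * n, s₁.narr 11 q = s.narr 9 q ∧ s₁.rarr 6 q = s.rarr 3 q) ?_ ?_ ?_
  · refine Runs.forUp (N := n * n) (B := 10)
      (fun i s' => ∀ q < i, s'.narr 11 q = s.narr 9 q ∧ s'.rarr 6 q = s.rarr 3 q) rfl ?_ ?_ ?_ ?_ ?_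
    · intro s' hag
      simp [hag.nvar 3 rfl, hprep.tables.size]
    · simp
    · intro i s' hi hag hx hI
      refine Runs.straight rfl (by decide) fun q hq => ?_
      rcases eq_or_ne q i with rfl | hne
      · simp [Cmd.run, hx, hag.narr 9 rfl, hag.rarr 3 rfl]
      · simpa [Cmd.run, hx, hne] using hI q (by omega)
    · simp only [NExp.cost]; omega
    · exact fun s' _ _ h => h
  swap
  · have : k * (170 * (n * n) + 20) = 170 * (k * (n * n)) + 20 * k := by ring
    omega
  intro s₁ hag₁ hcopy
  have hprep₁ : Prepared p G k s₁ := hprep.agree hag₁ (by decide) (by decide) (by decide)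
  have hmat : IsDistMatrix p (addEdges G ([] : List (Fin n × Fin n)).toFinset)
      (s₁.narr 11) (s₁.rarr 6) := by
    have he : addEdges G ([] : List (Fin n × Fin n)).toFinset = G := by
      refine sup_eq_left.2 fun a b hab => ?_
      rw [SimpleGraph.fromRel_adj] at hab
      simp at hab
    rw [he]
    refine ⟨fun q hq h9 => ?_, fun u v => ?_⟩
    · rw [(hcopy q hq).1] at h9
      rw [(hcopy q hq).2]
      exact hprep.matrix.nonneg q hq h9
    · have := hcopy _ (pair_index_lt u.2 v.2)
      rw [← hprep.matrix.eq, matrixEntry, matrixEntry, this.1, this.2]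
  refine Runs.seq (B₁ := 10) (B₂ := (n * n) * 68 + k * (170 * (n * n) + 20) + 6)
    (P := fun s₂ => s₂ = (s₁.setN 13 0).setN 14 1) (Runs.straight rfl (by decide) rfl) ?_ le_rfl
  rintro s₂ hag₂ hs₂
  have hprep₂ : Prepared p G k s₂ := hprep₁.agree hag₂ (by decide) (by decide) (by decide)
  refine Runs.forUp_of_credit (N := n * n) (B := 60) (f₀ := k * (170 * (n * n) + 20))
    (fun c f s' =>
      (∃ l, GreedyInv p G k T (s₂.narr 10) (s₂.rarr 2) c l s' ∧
        f = (k - l.length) * (170 * (n * n) + 20)) ∨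
      (f = 0 ∧ s'.nvar 14 = 0 ∧ s'.nvar 13 = k ∧
        ENNReal.ofReal T < ENNReal.ofReal (k + 1) * minDilation p G k)) rfl ?_ ?_ ?_ ?_ ?_
  · intro s' hag
    simp [hag.nvar 3 rfl, hprep₂.tables.size]
  · refine Or.inl ⟨[], ⟨GreedyChain.nil, ?_, by simp, ?_, ?_, by simp, by simp⟩, by simp⟩
    · simp [hs₂]
    · simp [hs₂]
    · simpa [hs₂] using hmat
  · intro c f s' hc hag hx hI
    have hprep' : Prepared p G k s' := hprep₂.agree hag (by decide) (by decide) (by decide)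
    have e4 : s'.rvar 4 = T := by
      rw [hag.rvar 4 rfl, hag₂.rvar 4 rfl, hag₁.rvar 4 rfl, h4]
    rcases hI with ⟨l, hl, rfl⟩ | ⟨rfl, h14, h13, hlt⟩
    · rw [← hag.narr 10 rfl, ← hag.rarr 2 rfl] at hl
      obtain ⟨A, hA⟩ := greedyStep_runs hp hn hk hkn hT hprep' e4 hx hc hl
      refine ⟨A, hA.mono le_rfl ?_⟩
      rintro s'' - (⟨l', hl', hle⟩ | ⟨h14, h13, hA60, hlt⟩)
      · rw [hag.narr 10 rfl, hag.rarr 2 rfl] at hl'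
        exact ⟨_, Or.inl ⟨l', hl'.congr (by simp) (by simp) rfl rfl, rfl⟩, hle⟩
      · exact ⟨0, Or.inr ⟨rfl, by simpa using h14, by simpa using h13, hlt⟩, by omega⟩
    · refine ⟨60, (greedyStep_runs_of_failed h14 h13 hprep'.budget).mono le_rfl ?_⟩
      rintro s'' - ⟨g14, g13⟩
      exact ⟨0, Or.inr ⟨rfl, by simpa using g14, by simpa using g13, hlt⟩, by omega⟩
  · simp only [NExp.cost]; omega
  · rintro f s' hag - (⟨l, hl, -⟩ | ⟨-, h14, -, hlt⟩)
    · refine Or.inl ⟨hl.flag, minDilation_le_of_isSpanner hkn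
        ((List.toFinset_card_le l).trans hl.length_le) fun u v => ?_⟩
      obtain ⟨c, hc, hcq⟩ := hprep₂.sorted.surj _ (pair_index_lt u.2 v.2)
      rw [edist_dist, ← ENNReal.ofReal_mul (by linarith)]
      exact hl.satisfied c hc u v hcq
    · exact Or.inr ⟨h14, hlt⟩

end Dilation

/-! ### Search for the threshold -/

namespace Dilation

open RealRAM

variable {n : ℕ} {M : Type*} [MetricSpace M]

theorem lt_mul_toReal_of_ofReal_lt {D : ℝ≥0∞} (hD : D ≠ ∞) {a T : ℝ} (ha : 0 ≤ a)
    (h : ENNReal.ofReal T < ENNReal.ofReal a * D) : T < a * D.toReal := by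
  by_contra! hT
  refine h.not_ge ?_
  rw [← ENNReal.ofReal_toReal hD, ← ENNReal.ofReal_mul ha]
  exact ENNReal.ofReal_le_ofReal hT

/-- Array `5` contains `N` thresholds in increasing order, one of which is an approximation from
above of `k + 1` times the minimum dilation, unless this is infinite. -/
structure HasCandidates (p : Fin n → M) (G : SimpleGraph (Fin n)) (k N : ℕ) (s : State) :
    Prop where
  count : s.nvar 10 = N
  pos : 1 ≤ N
  le : N ≤ n * n
  mono : ∀ c c', c ≤ c' → c' < N → s.rarr 5 c ≤ s.rarr 5 c'
  exists_near : minDilation p G k ≠ ∞ → ∃ c < N,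
    (k + 1) * (minDilation p G k).toReal ≤ s.rarr 5 c ∧
      s.rarr 5 c ≤ (k + 1) * (4 * n) * (minDilation p G k).toReal

theorem HasCandidates.agree {p : Fin n → M} {G : SimpleGraph (Fin n)} {k N : ℕ} {s s' : State}
    {c : Cmd} (h : HasCandidates p G k N s) (ha : Agree c s s') (h10 : c.writesN 10 = false)
    (h5 : c.writesRA 5 = false) : HasCandidates p G k N s' := by
  refine ⟨(ha.nvar 10 h10).trans h.count, h.pos, h.le, ?_, ?_⟩ <;> rw [ha.rarr 5 h5]
  exacts [h.mono, h.exists_near]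

/-- Find by binary search a candidate in array `5` that passes the greedy test while its
predecessor does not; register `31` contains its index. -/
def bisect : Cmd :=
  (.nset 30 (.const 0) ;; .nset 31 (.sub (.var 10) (.const 1))) ;;
  .loop (.nlt (.var 30) (.var 31))
    ((.nset 32 (.half (.add (.var 30) (.var 31))) ;; .rset 4 (.get 5 (.var 32))) ;; greedy ;;
      .cond (.neq (.var 14) (.const 1)) (.nset 31 (.var 32))
        (.nset 30 (.add (.var 32) (.const 1))))

/-- No monotonicity of the test is used: the search only keeps an upper index whose threshold is
certified from above and a lower index whose predecessor failed. -/
theorem bisect_runs {p : Fin n → M} (hp : Function.Injective p) (hn : 2 ≤ n)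
    {G : SimpleGraph (Fin n)} {k N : ℕ} (hk : 1 ≤ k) (hkn : k ≤ n * n) {s : State}
    (hprep : Prepared p G k s) (hc : HasCandidates p G k N s)
    (htop : minDilation p G k ≤ ENNReal.ofReal (s.rarr 5 (N - 1))) :
    Runs bisect s (600 * (k * (n * n)) * (Nat.log 2 (n * n + n * n) + 1) + 20) fun s' =>
      minDilation p G k ≤ ENNReal.ofReal (s'.rarr 5 (s'.nvar 31)) ∧
      s'.rarr 5 (s'.nvar 31) ≤ (k + 1) * (4 * n) * (minDilation p G k).toReal := by
  set K := k * (n * n) with hK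
  have hK1 : 1 ≤ K := Nat.mul_pos hk (Nat.mul_pos (by omega) (by omega))
  set D := minDilation p G k with hD
  have hfin : D ≠ ∞ := ne_top_of_le_ne_top ENNReal.ofReal_ne_top htop
  have hclog : Nat.clog 2 N ≤ Nat.log 2 (n * n + n * n) + 1 := by
    refine Nat.clog_le_of_le_pow ?_
    have := Nat.lt_pow_succ_log_self (b := 2) (by norm_num) (n * n + n * n)
    have := hc.le
    omega
  have hB : 600 * K * Nat.clog 2 N ≤ 600 * K * (Nat.log 2 (n * n + n * n) + 1) :=
    Nat.mul_le_mul_left _ hclog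
  refine Runs.seq (B₁ := 8) (B₂ := 600 * K * Nat.clog 2 N + 4)
    (P := fun s₁ => s₁.nvar 30 = 0 ∧ s₁.nvar 31 = N - 1) ?_ ?_ (by omega)
  · refine Runs.straight rfl (by decide) ⟨?_, ?_⟩ <;> simp [Cmd.run, hc.count]
  rintro s₁ hag₁ ⟨e30, e31⟩
  have hprep₁ : Prepared p G k s₁ := hprep.agree hag₁ (by decide) (by decide) (by decide)
  have hc₁ := hc.agree hag₁ rfl rfl
  rw [← hag₁.rarr 5 rfl] at htop
  have hpos := hc.pos
  have key := Runs.loop (b := .nlt (.var 30) (.var 31))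
    (c := (.nset 32 (.half (.add (.var 30) (.var 31))) ;; .rset 4 (.get 5 (.var 32))) ;; greedy ;;
      .cond (.neq (.var 14) (.const 1)) (.nset 31 (.var 32))
        (.nset 30 (.add (.var 32) (.const 1)))) (s₀ := s₁)
    -- The last clause is vacuous as long as the lower index is `0`, where there is no predecessor.
    (fun s' => s'.nvar 30 ≤ s'.nvar 31 ∧ s'.nvar 31 < N ∧
      D ≤ ENNReal.ofReal (s₁.rarr 5 (s'.nvar 31)) ∧
      ∀ c, c + 1 = s'.nvar 30 → s₁.rarr 5 c < (k + 1) * D.toReal)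
    (fun s' => 600 * K * Nat.clog 2 (s'.nvar 31 - s'.nvar 30 + 1))
    ⟨by omega, by omega, by rwa [e31], by omega⟩ ?_
  · refine key.mono ?_ ?_
    · simp only [e30, e31, BExp.cost, NExp.cost]
      rw [show N - 1 - 0 + 1 = N by omega]
    · rintro s' hag ⟨⟨h1, h2, h3, h4⟩, hb⟩
      have hb' : s'.nvar 30 = s'.nvar 31 := by
        simp at hb
        omega
      rw [hag.rarr 5 rfl]
      refine ⟨h3, ?_⟩
      obtain ⟨c, hcN, hc1, hc2⟩ := hc₁.exists_near hfin
      refine (hc₁.mono _ _ ?_ hcN).trans hc2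
      -- If the good candidate `c` came before the index found, the failed predecessor would be at
      -- least as large as candidate `c`, hence at least `(k + 1) * D.toReal`.
      by_contra! hlt
      have := h4 (s'.nvar 31 - 1) (by omega)
      have := hc₁.mono c (s'.nvar 31 - 1) (by omega) (by omega)
      linarith
  · rintro s' hag ⟨h1, h2, h3, h4⟩ hb
    have hb' : s'.nvar 30 < s'.nvar 31 := by simpa using hb
    set lo := s'.nvar 30 with hlo
    set hi := s'.nvar 31 with hhi
    set mid := (lo + hi) / 2 with hmid
    have hcl : Nat.clog 2 (hi - lo + 1) = Nat.clog 2 ((hi - lo) / 2 + 1) + 1 := by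
      rw [Nat.clog_of_two_le (by norm_num) (by omega)]
      congr 2
      omega
    have hprep' : Prepared p G k s' := hprep₁.agree hag (by decide) (by decide) (by decide)
    refine ⟨500 * K + 40, ?_⟩
    refine Runs.seq (B₁ := 15) (B₂ := 500 * K + 25)
      (P := fun s₂ => s₂.nvar 30 = lo ∧ s₂.nvar 31 = hi ∧ s₂.nvar 32 = mid ∧
        s₂.rvar 4 = s₁.rarr 5 mid) ?_ ?_ (by omega)
    · refine Runs.straight rfl (by decide) ⟨?_, ?_, ?_, ?_⟩ <;>
        simp [Cmd.run, hag.rarr 5 rfl, ← hlo, ← hhi, hmid]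
    rintro s₂ hag₂ ⟨g30, g31, g32, g4⟩
    have hprep₂ : Prepared p G k s₂ := hprep'.agree hag₂ (by decide) (by decide) (by decide)
    refine Runs.seq (B₂ := 25) (greedy_runs hp hn hk hkn hprep₂ g4) ?_ le_rfl
    intro s₃ hag₃ hres
    have f30 : s₃.nvar 30 = lo := (hag₃.nvar 30 rfl).trans g30
    have f31 : s₃.nvar 31 = hi := (hag₃.nvar 31 rfl).trans g31
    have f32 : s₃.nvar 32 = mid := (hag₃.nvar 32 rfl).trans g32
    have hΦ : ∀ d, d ≤ (hi - lo) / 2 → 600 * K * Nat.clog 2 (d + 1) + (500 * K + 40) + 3 + 1 ≤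
        600 * K * Nat.clog 2 (hi - lo + 1) := by
      intro d hd
      rw [hcl, mul_add, mul_one]
      have := Nat.mul_le_mul_left (600 * K) (Nat.clog_mono_right 2 (by omega : d + 1 ≤ (hi - lo) / 2 + 1))
      have : 100 * K ≥ 44 := by omega
      omega
    rcases hres with ⟨h14, hle⟩ | ⟨h14, hlt⟩
    · refine Runs.straight rfl (by decide) ?_
      rw [Cmd.run_cond_pos (by simp [h14])]
      refine ⟨⟨?_, ?_, ?_, ?_⟩, ?_⟩
      · simp [Cmd.run, f30, f32]; omega
      · simp [Cmd.run, f32]; omega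
      · simpa [Cmd.run, f32] using hle
      · simpa [Cmd.run, f30] using h4
      · simpa [Cmd.run, f30, f32, BExp.cost, NExp.cost] using hΦ (mid - lo) (by omega)
    · refine Runs.straight rfl (by decide) ?_
      rw [Cmd.run_cond_neg (by simp [h14])]
      refine ⟨⟨?_, ?_, ?_, ?_⟩, ?_⟩
      · simp [Cmd.run, f31, f32]; omega
      · simp [Cmd.run, f31]; omega
      · simpa [Cmd.run, f31] using h3
      · simp only [Cmd.run, State.setN_nvar, NExp.eval, f32, if_true, Nat.add_right_cancel_iff,
          forall_eq]
        exact lt_mul_toReal_of_ofReal_lt hfin (by positivity) hlt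
      · simpa [Cmd.run, f31, f32, BExp.cost, NExp.cost] using hΦ (hi - (mid + 1)) (by omega)

/-- By Bernoulli's inequality `q` reductions by the factor `q / (q + 1)` at least halve the
threshold, so a logarithmic number of halvings bounds the scan. -/
theorem div_succ_pow_le (q : ℕ) (hq : 1 ≤ q) : ((q : ℝ) / (q + 1)) ^ q ≤ 1 / 2 := by
  have hq0 : (0 : ℝ) < q := by exact_mod_cast hq
  have h : (2 : ℝ) ≤ (1 + 1 / q) ^ q := by
    have h0 : 0 < 1 / (q : ℝ) := by positivity
    have := one_add_mul_le_pow (a := 1 / (q : ℝ)) (by linarith) q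
    rwa [mul_one_div_cancel hq0.ne', one_add_one_eq_two] at this
  rw [show (q : ℝ) / (q + 1) = (1 + 1 / (q : ℝ))⁻¹ by field_simp, inv_pow, one_div (2 : ℝ)]
  exact inv_anti₀ (by norm_num) h

/-- Lower the threshold in the real register `4` by the factor `q / (q + 1)` as long as it passes
the greedy test; the real register `0` contains the last one that did. -/
def scanDown (q : ℕ) : Cmd :=
  .loop (.neq (.var 14) (.const 1))
    ((.rset 0 (.var 4) ;;
      .rset 4 (.div (.mul (.var 4) (.cast (.const q))) (.cast (.const (q + 1))))) ;; greedy)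

theorem scanDown_runs {p : Fin n → M} (hp : Function.Injective p) (hn : 2 ≤ n)
    {G : SimpleGraph (Fin n)} {k q : ℕ} (hk : 1 ≤ k) (hkn : k ≤ n * n) (hq : 1 ≤ q) {s : State}
    (hprep : Prepared p G k s) (h14 : s.nvar 14 = 1)
    (hle : minDilation p G k ≤ ENNReal.ofReal (s.rvar 4))
    (hge : s.rvar 4 ≤ (k + 1) * (4 * n) * (minDilation p G k).toReal) :
    Runs (scanDown q) s (1800 * (k * (n * n)) * q * (Nat.log 2 (n * n + n * n) + 1) + 4)
      fun s' => minDilation p G k ≤ ENNReal.ofReal (s'.rvar 0) ∧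
        s'.rvar 0 ≤ (1 + 1 / q) * (k + 1) * (minDilation p G k).toReal := by
  set K := k * (n * n) with hK
  have hK1 : 1 ≤ K := Nat.mul_pos hk (Nat.mul_pos (by omega) (by omega))
  set D := minDilation p G k with hD
  have hfin : D ≠ ∞ := ne_top_of_le_ne_top ENNReal.ofReal_ne_top hle
  have hD1 : 1 ≤ D.toReal := by
    have := ENNReal.toReal_mono hfin (one_le_minDilation hp hn G hkn)
    simpa using this
  set lg := Nat.log 2 (n * n + n * n) + 1 with hlg
  set ρ : ℝ := q / (q + 1) with hρ
  have hq0 : (0 : ℝ) < q := by exact_mod_cast hq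
  have hρ0 : 0 ≤ ρ := by positivity
  have hρ1 : ρ ≤ 1 := by rw [hρ, div_le_one (by positivity)]; linarith
  -- The initial excess is at most `(k + 1) * (4 * n)`. Since `2 ^ lg > 2 * n * n`, one power `2 ^
  -- lg` dominates `k + 1` and two dominate `4 * n`, hence `3 * lg` halvings.
  have hsmall : ((k : ℝ) + 1) * (4 * n) * ρ ^ (q * (3 * lg)) < 1 := by
    have h1 : ρ ^ (q * (3 * lg)) ≤ (1 / 2) ^ (3 * lg) := by
      rw [pow_mul]
      exact pow_le_pow_left₀ (by positivity) (div_succ_pow_le q hq) _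
    have h2 : (k + 1) * (4 * n) < 2 ^ (3 * lg) := by
      have h3 : n * n + n * n < 2 ^ lg := Nat.lt_pow_succ_log_self (by norm_num) _
      have h4 : k + 1 ≤ 2 ^ lg := by nlinarith
      have h5 : 4 * n ≤ 2 ^ lg * 2 ^ lg := by nlinarith
      have h6 : 4 * n < 2 ^ lg * 2 ^ lg := by nlinarith
      calc (k + 1) * (4 * n) < (k + 1) * (2 ^ lg * 2 ^ lg) :=
            Nat.mul_lt_mul_of_pos_left h6 (by omega)
        _ ≤ 2 ^ lg * (2 ^ lg * 2 ^ lg) := Nat.mul_le_mul_right _ h4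
        _ = 2 ^ (3 * lg) := by ring
    have h2' : ((k : ℝ) + 1) * (4 * n) < 2 ^ (3 * lg) := by exact_mod_cast h2
    calc ((k : ℝ) + 1) * (4 * n) * ρ ^ (q * (3 * lg))
        ≤ (k + 1) * (4 * n) * (1 / 2) ^ (3 * lg) := by gcongr
      _ < 2 ^ (3 * lg) * (1 / 2) ^ (3 * lg) := by gcongr
      _ = 1 := by rw [← mul_pow]; norm_num
  have hsteps : ∀ i, D ≤ ENNReal.ofReal (s.rvar 4 * ρ ^ i) → i < q * (3 * lg) := by
    intro i hi
    by_contra! hlt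
    have h1 : D.toReal ≤ s.rvar 4 * ρ ^ i := by
      by_contra! h
      refine hi.not_gt ?_
      rw [← ENNReal.ofReal_toReal hfin]
      exact (ENNReal.ofReal_lt_ofReal_iff (by linarith)).2 h
    have h2 : ρ ^ i ≤ ρ ^ (q * (3 * lg)) := pow_le_pow_of_le_one hρ0 hρ1 hlt
    have h3 : s.rvar 4 * ρ ^ i ≤ (k + 1) * (4 * n) * D.toReal * ρ ^ (q * (3 * lg)) := by gcongr
    nlinarith
  have key := Runs.loop_of_potential (b := .neq (.var 14) (.const 1))
    (c := (.rset 0 (.var 4) ;;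
      .rset 4 (.div (.mul (.var 4) (.cast (.const q))) (.cast (.const (q + 1))))) ;; greedy)
    (s₀ := s) (f₀ := 600 * K * (q * (3 * lg)))
    -- After `i` rounds either the current threshold has passed, or it has failed while the previous
    -- one, kept in real register `0`, had passed.
    (fun f s' => ∃ i, f = 600 * K * (q * (3 * lg) - i) ∧
      ((s'.nvar 14 = 1 ∧ s'.rvar 4 = s.rvar 4 * ρ ^ i ∧ D ≤ ENNReal.ofReal (s'.rvar 4)) ∨
        (s'.nvar 14 = 0 ∧ D ≤ ENNReal.ofReal (s'.rvar 0) ∧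
          s'.rvar 0 * ρ ≤ (k + 1) * D.toReal)))
    ⟨0, by simp, Or.inl ⟨h14, by simp, hle⟩⟩ ?_
  · refine key.mono ?_ ?_
    · simp only [BExp.cost, NExp.cost]
      have : 600 * K * (q * (3 * lg)) = 1800 * K * q * lg := by ring
      omega
    · rintro s' - ⟨⟨f, i, -, h⟩, hb⟩
      have hb' : s'.nvar 14 ≠ 1 := by simpa using hb
      rcases h with ⟨h, -⟩ | ⟨-, h1, h2⟩
      · exact absurd h hb'
      · refine ⟨h1, ?_⟩
        -- The last passing threshold is `1 + 1 / q` times the first failing one, and the latter is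
        -- below `(k + 1) * D.toReal`.
        have : s'.rvar 0 = (1 + 1 / q) * (s'.rvar 0 * ρ) := by rw [hρ]; field_simp
        rw [this, mul_assoc (1 + 1 / (q : ℝ))]
        gcongr
  · rintro f s' hag ⟨i, rfl, h⟩ hb
    have hb' : s'.nvar 14 = 1 := by simpa using hb
    rcases h with ⟨-, h4, hD4⟩ | ⟨h, -⟩
    swap
    · omega
    have hi := hsteps i (h4 ▸ hD4)
    have hprep' : Prepared p G k s' := hprep.agree hag (by simp +decide [Cmd.writesN])
      (by simp +decide [Cmd.writesNA]) (by simp +decide [Cmd.writesRA])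
    refine ⟨500 * K + 20, ?_⟩
    refine Runs.seq (B₁ := 20) (B₂ := 500 * K)
      (P := fun s₂ => s₂.rvar 0 = s.rvar 4 * ρ ^ i ∧ s₂.rvar 4 = s.rvar 4 * ρ ^ (i + 1)) ?_ ?_
      (by omega)
    · refine Runs.straight rfl (by simp [Cmd.maxCost, RExp.cost, NExp.cost]) ⟨?_, ?_⟩
      · simp [Cmd.run, h4]
      · simp [Cmd.run, h4, hρ, pow_succ]
        ring
    rintro s₂ hag₂ ⟨g0, g4⟩
    have hprep₂ : Prepared p G k s₂ := hprep'.agree hag₂ (by simp [Cmd.writesN])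
      (by simp [Cmd.writesNA]) (by simp [Cmd.writesRA])
    refine (greedy_runs hp hn hk hkn hprep₂ g4).mono le_rfl ?_
    intro s₃ hag₃ hres
    refine ⟨_, ⟨i + 1, rfl, ?_⟩, ?_⟩
    · rcases hres with ⟨r14, hr⟩ | ⟨r14, hr⟩
      · exact Or.inl ⟨r14, by rw [hag₃.rvar 4 rfl, g4], by rwa [hag₃.rvar 4 rfl, g4]⟩
      · refine Or.inr ⟨r14, ?_, ?_⟩
        · rw [hag₃.rvar 0 rfl, g0, ← h4]; exact hD4
        · rw [hag₃.rvar 0 rfl, g0, mul_assoc, ← pow_succ]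
          exact (lt_mul_toReal_of_ofReal_lt hfin (by positivity) hr).le
    · have : q * (3 * lg) - i = (q * (3 * lg) - (i + 1)) + 1 := by omega
      rw [this, mul_add (600 * K), mul_one]
      simp only [BExp.cost, NExp.cost]
      generalize 600 * K * (q * (3 * lg) - (i + 1)) = X
      omega

/-- Compute the output from the results of the preprocessing. -/
def search (q : ℕ) : Cmd :=
  .rset 4 (.get 5 (.sub (.var 10) (.const 1))) ;; greedy ;;
  .cond (.neq (.var 14) (.const 1))
    (bisect ;; (.rset 4 (.get 5 (.var 31)) ;; .nset 14 (.const 1)) ;; scanDown q)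
    (.nset 0 (.const 0))

/-- If the minimum dilation is finite, some candidate is at least `k + 1` times as large, so the
largest candidate cannot fail. A failure there therefore proves that the answer is infinite. -/
theorem search_runs {p : Fin n → M} (hp : Function.Injective p) (hn : 2 ≤ n)
    {G : SimpleGraph (Fin n)} {k q N : ℕ} (hk : 1 ≤ k) (hkn : k ≤ n * n) (hq : 1 ≤ q) {s : State}
    (hprep : Prepared p G k s) (hc : HasCandidates p G k N s) :
    Runs (search q) s (3000 * (k * (n * n)) * q * (Nat.log 2 (n * n + n * n) + 1)) fun s' =>
      minDilation p G k ≤ output s' ∧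
        output s' ≤ ENNReal.ofReal ((1 + 1 / q) * (k + 1)) * minDilation p G k := by
  set K := k * (n * n) with hK
  have hK1 : 1 ≤ K := Nat.mul_pos hk (Nat.mul_pos (by omega) (by omega))
  set D := minDilation p G k with hD
  set lg := Nat.log 2 (n * n + n * n) + 1 with hlg
  have hpos := hc.pos
  have hq0 : (0 : ℝ) < q := by exact_mod_cast hq
  have hqK : K * lg ≤ K * q * lg := Nat.mul_le_mul_right _ (Nat.le_mul_of_pos_right _ hq)
  have hKl : K ≤ K * lg := Nat.le_mul_of_pos_right _ (by omega)
  refine Runs.seq (B₁ := 10) (B₂ := 500 * K + (600 * K * lg + 1800 * K * q * lg + 50))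
    (P := fun s₁ => s₁.rvar 4 = s.rarr 5 (N - 1)) ?_ ?_ ?_
  · exact Runs.straight rfl (by decide) (by simp [Cmd.run, hc.count])
  swap
  · have e1 : 600 * K * lg = 600 * (K * lg) := by ring
    have e2 : 1800 * K * q * lg = 1800 * (K * q * lg) := by ring
    have e3 : 3000 * K * q * lg = 3000 * (K * q * lg) := by ring
    omega
  intro s₁ hag₁ h4
  have hprep₁ : Prepared p G k s₁ := hprep.agree hag₁ (by decide) (by decide) (by decide)
  have hc₁ := hc.agree hag₁ rfl rfl
  rw [← hag₁.rarr 5 rfl] at h4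
  refine Runs.seq (greedy_runs hp hn hk hkn hprep₁ h4) ?_ le_rfl
  intro s₂ hag₂ hres
  have hprep₂ : Prepared p G k s₂ := hprep₁.agree hag₂ (by decide) (by decide) (by decide)
  have hc₂ := hc₁.agree hag₂ rfl rfl
  rw [← hag₂.rarr 5 rfl] at hres
  refine Runs.cond (B := 600 * K * lg + 1800 * K * q * lg + 40) ?_ ?_
    (by simp only [BExp.cost, NExp.cost]; omega)
  · intro hb
    have hb' : s₂.nvar 14 = 1 := by simpa using hb
    have htop : D ≤ ENNReal.ofReal (s₂.rarr 5 (N - 1)) := by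
      rcases hres with ⟨-, h⟩ | ⟨h, -⟩
      · exact h
      · omega
    have hfin : D ≠ ∞ := ne_top_of_le_ne_top ENNReal.ofReal_ne_top htop
    refine Runs.seq (B₁ := 600 * K * lg + 20) (bisect_runs hp hn hk hkn hprep₂ hc₂ htop)
      (B₂ := 10 + (1800 * K * q * lg + 4)) ?_ (by omega)
    rintro s₃ hag₃ ⟨h1, h2⟩
    have hprep₃ : Prepared p G k s₃ := hprep₂.agree hag₃ (by decide) (by decide) (by decide)
    refine Runs.seq (B₁ := 10) (B₂ := 1800 * K * q * lg + 4)
      (P := fun s₄ => s₄.rvar 4 = s₃.rarr 5 (s₃.nvar 31) ∧ s₄.nvar 14 = 1) ?_ ?_ le_rfl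
    · refine Runs.straight rfl (by decide) ⟨?_, ?_⟩ <;> simp [Cmd.run]
    rintro s₄ hag₄ ⟨g4, g14⟩
    have hprep₄ : Prepared p G k s₄ := hprep₃.agree hag₄ (by decide) (by decide) (by decide)
    refine (scanDown_runs hp hn hk hkn hq hprep₄ g14 (g4 ▸ h1) (g4 ▸ h2)).mono le_rfl ?_
    rintro s₅ hag₅ ⟨r1, r2⟩
    have h0 : output s₅ = ENNReal.ofReal (s₅.rvar 0) := by
      -- Register `0` still holds `n ≥ 2`, which serves as the mark of a finite output.
      refine if_neg ?_
      rw [hag₅.nvar 0 rfl, hprep₄.tables.vertices]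
      omega
    rw [h0]
    refine ⟨r1, ?_⟩
    rw [← ENNReal.ofReal_toReal hfin, ← ENNReal.ofReal_mul (by positivity)]
    exact ENNReal.ofReal_le_ofReal r2
  · intro hb
    have hb' : s₂.nvar 14 ≠ 1 := by simpa using hb
    have hlt : ENNReal.ofReal (s₂.rarr 5 (N - 1)) < ENNReal.ofReal (k + 1) * D := by
      rcases hres with ⟨h, -⟩ | ⟨-, h⟩
      · exact absurd h hb'
      · exact h
    have hinf : D = ∞ := by
      by_contra hfin
      obtain ⟨c, hcN, hc1, -⟩ := hc₂.exists_near hfin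
      have h1 := lt_mul_toReal_of_ofReal_lt hfin (by positivity) hlt
      have h2 := hc₂.mono c (N - 1) (by omega) (by omega)
      linarith
    refine Runs.straight rfl (by simp [Cmd.maxCost, NExp.cost]) ?_
    have hpos' : ENNReal.ofReal ((1 + 1 / q) * (k + 1)) ≠ 0 :=
      (ENNReal.ofReal_pos.2 (by positivity)).ne'
    rw [hinf, ENNReal.mul_top hpos']
    simp [output, Cmd.run]

end Dilation

/-! ### Preprocessing, total running time and the main theorem -/

namespace Dilation

open RealRAM

variable {n : ℕ} {M : Type*} [MetricSpace M]

theorem ListsEdges.adj_iff {m : ℕ} {G : SimpleGraph (Fin n)} {e : Fin m → Fin n × Fin n}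
    (he : ListsEdges G e) (u v : Fin n) :
    G.Adj u v ↔ ∃ i, (u = (e i).1 ∧ v = (e i).2) ∨ (u = (e i).2 ∧ v = (e i).1) := by
  rw [← SimpleGraph.mem_edgeSet, ← he.2]
  simp only [Set.mem_range, Sym2.eq_iff]
  refine exists_congr fun i => or_congr ?_ ?_ <;> constructor <;> rintro ⟨h1, h2⟩ <;>
    constructor <;> symm <;> assumption

theorem AdjLists.adjListsOf {m : ℕ} {G : SimpleGraph (Fin n)} {e : Fin m → Fin n × Fin n}
    (he : ListsEdges G e) {c w : ℕ} {a b : ℕ → ℕ} (ha : ∀ i : Fin m, a i = (e i).1)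
    (hb : ∀ i : Fin m, b i = (e i).2) {s : State}
    (h : AdjLists n c w (fun x y => ∃ i < m, (x = a i ∧ y = b i) ∨ (x = b i ∧ y = a i)) s) :
    AdjListsOf G s := by
  intro v x
  rw [h.base v v.2, h.mem v v.2 x]
  simp only [he.adj_iff]
  constructor
  · rintro ⟨i, hi, h | h⟩
    · rw [ha ⟨i, hi⟩, hb ⟨i, hi⟩] at h
      exact ⟨_, h.2.symm, ⟨i, hi⟩, Or.inl ⟨Fin.ext h.1, rfl⟩⟩
    · rw [ha ⟨i, hi⟩, hb ⟨i, hi⟩] at h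
      exact ⟨_, h.2.symm, ⟨i, hi⟩, Or.inr ⟨Fin.ext h.1, rfl⟩⟩
  · rintro ⟨y, rfl, i, ⟨rfl, rfl⟩ | ⟨rfl, rfl⟩⟩
    · exact ⟨i, i.2, Or.inl ⟨(ha i).symm, (hb i).symm⟩⟩
    · exact ⟨i, i.2, Or.inr ⟨(hb i).symm, (ha i).symm⟩⟩

def preprocess : Cmd :=
  tablesInit ;; adjInit ;; distAll ;; sortPairs ;; pickScales ;; sortCandidates

theorem preprocess_runs {p : Fin n → M} (hp : Function.Injective p) (hn : 2 ≤ n)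
    {G : SimpleGraph (Fin n)} {k m : ℕ} (hkn : k ≤ n * n) {e : Fin m → Fin n × Fin n}
    (he : ListsEdges G e) {s : State} (hs : HoldsInput p e k s) :
    Runs preprocess s (3000 * (n * (m + n)) * (Nat.log 2 (n * n + n * n) + 1)) fun s' =>
      Prepared p G k s' ∧ ∃ N, HasCandidates p G k N s' := by
  set lg := Nat.log 2 (n * n + n * n) + 1 with hlg
  have hnn : 1 ≤ n * n := Nat.mul_pos (by omega) (by omega)
  have e1 : n * (m + n) ≤ n * (m + n) * lg := Nat.le_mul_of_pos_right _ (by omega)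
  have e2 : 2 * (m + n) ≤ n * (m + n) := Nat.mul_le_mul_right _ hn
  have e3 : n * n ≤ n * (m + n) := Nat.mul_le_mul_left _ (by omega)
  have e4 : n * n * lg ≤ n * (m + n) * lg := Nat.mul_le_mul_right _ e3
  have e5 : 3000 * (n * (m + n)) * lg = 3000 * (n * (m + n) * lg) := by ring
  have e6 : 1000 * (n * (m + n)) * lg = 1000 * (n * (m + n) * lg) := by ring
  have e7 : 1000 * (n * n) * lg = 1000 * (n * n * lg) := by ring
  have e8 : 500 * (n * n) * lg = 500 * (n * n * lg) := by ring
  refine Runs.seq (B₁ := 100 * (n * n)) (B₂ := 100 * (n + m + 1) + (1000 * (n * (m + n)) * lg +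
    (500 * (n * n) * lg + (100 * (n * n) + 1000 * (n * n) * lg))))
    (tablesInit_runs hs.vertices (by omega)) ?_ (by clear_value lg; omega)
  intro s₁ hag₁ ht₁
  have a0 : ∀ i : Fin m, s₁.narr 0 i = (e i).1 := by rw [hag₁.narr 0 rfl]; exact hs.tail
  have a1 : ∀ i : Fin m, s₁.narr 1 i = (e i).2 := by rw [hag₁.narr 1 rfl]; exact hs.head
  have d1 : ∀ u v : Fin n, s₁.rarr 0 (u * n + v) = dist (p u) (p v) := by
    rw [hag₁.rarr 0 rfl]; exact hs.distances
  have k1 : s₁.nvar 2 = k := (hag₁.nvar 2 rfl).trans hs.budget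
  refine Runs.seq (adjInit_runs ht₁.vertices ((hag₁.nvar 1 rfl).trans hs.edges) ?_) ?_ le_rfl
  · intro i hi
    rw [a0 ⟨i, hi⟩, a1 ⟨i, hi⟩]
    exact ⟨(e ⟨i, hi⟩).1.2, (e ⟨i, hi⟩).2.2⟩
  intro s₂ hag₂ hadj
  have ht₂ : Tables n s₂ := ht₁.agree hag₂ rfl rfl rfl rfl rfl
  rw [← hag₂.rarr 0 rfl] at d1
  rw [← hag₂.nvar 2 rfl] at k1
  refine Runs.seq (distAll_runs p G ht₂ (by omega) d1 (hadj.adjListsOf he a0 a1) hadj.sum) ?_ le_rfl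
  intro s₃ hag₃ hmat
  have ht₃ : Tables n s₃ := ht₂.agree hag₃ rfl rfl rfl rfl rfl
  rw [← hag₃.rarr 0 rfl] at d1
  rw [← hag₃.nvar 2 rfl] at k1
  refine Runs.seq (sortPairs_runs ht₃.size hnn) ?_ le_rfl
  intro s₄ hag₄ hsort
  have ht₄ : Tables n s₄ := ht₃.agree hag₄ rfl rfl rfl rfl rfl
  rw [← hag₄.rarr 0 rfl] at d1 hsort
  rw [← hag₄.nvar 2 rfl] at k1
  rw [← hag₄.narr 9 rfl, ← hag₄.rarr 3 rfl] at hmat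
  have hprep₄ : Prepared p G k s₄ := ⟨ht₄, k1, d1, hsort, hmat⟩
  refine Runs.seq (pickScales_runs ht₄.size hnn hsort.mono) ?_ le_rfl
  intro s₅ hag₅ hsc
  have hprep₅ : Prepared p G k s₅ := hprep₄.agree hag₅ (by decide) (by decide) (by decide)
  rw [← hag₅.rarr 2 rfl] at hsc
  have hL : s₅.nvar 11 ≤ n := hsc.length_le hprep₅.sorted hprep₅.distances
  have hnear := hsc.exists_near_dist hp hprep₅.sorted hprep₅.distances
  refine (sortCandidates_runs hprep₅.tables hprep₅.budget rfl hL (by omega)).mono le_rfl ?_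
  rintro s₆ hag₆ ⟨hN, hmono, hmem⟩
  refine ⟨hprep₅.agree hag₆ (by decide) (by decide) (by decide), _, hN, ?_, Nat.mul_le_mul hL hL,
    hmono, fun hfin => ?_⟩
  · obtain ⟨i, hi, -⟩ := hnear ⟨0, by omega⟩ ⟨1, by omega⟩ (by simp)
    exact Nat.mul_pos (by omega) (by omega)
  · obtain ⟨i, hi, j, hj, h1, h2⟩ := exists_candidate hp hn G hkn hfin hsc.pos hnear
    obtain ⟨c, hc, hcv⟩ := hmem i hi j hj
    exact ⟨c, hc, hcv ▸ h1, hcv ▸ h2⟩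

/-- For `n ≥ 2` the bound `2 * n ^ 2 ≤ n ^ 3` gives a binary logarithm of at most `3 * Real.log n /
Real.log 2`; the summand `1` is at most `Real.log n / Real.log 2`, and `4 / Real.log 2 < 8`. -/
theorem log_two_mul_sq_le (hn : 2 ≤ n) :
    ((Nat.log 2 (n * n + n * n) + 1 : ℕ) : ℝ) ≤ 8 * Real.log n := by
  have hn' : (2 : ℝ) ≤ n := by exact_mod_cast hn
  have h2 : Real.log 2 ≤ Real.log n := Real.log_le_log (by norm_num) hn'
  have h1 : (2 : ℝ) ^ Nat.log 2 (n * n + n * n) ≤ (n : ℝ) ^ 3 := by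
    have h : 2 ^ Nat.log 2 (n * n + n * n) ≤ n * n + n * n :=
      Nat.pow_log_le_self 2 (Nat.add_pos_left (Nat.mul_pos (by omega) (by omega)) _).ne'
    have h' : n * n + n * n ≤ n ^ 3 := by
      calc n * n + n * n = 2 * (n * n) := by ring
        _ ≤ n * (n * n) := Nat.mul_le_mul_right _ hn
        _ = n ^ 3 := by ring
    exact_mod_cast h.trans h'
  have h3 := Real.log_le_log (by positivity) h1
  rw [Real.log_pow, Real.log_pow] at h3
  have h4 := Real.log_two_gt_d9
  have h5 : (0 : ℝ) ≤ (Nat.log 2 (n * n + n * n) : ℝ) := Nat.cast_nonneg _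
  push_cast at h3 ⊢
  nlinarith

/-- Since `1 ≤ k`, the part `n * n` of the preprocessing is absorbed by `k * n * n`. The summand `n
* Real.log n` in the first factor is slack; the only logarithm needed is that of the second factor.
-/
theorem run_time_le {m k q : ℕ} (hn : 2 ≤ n) (hk : 1 ≤ k) (hq : 1 ≤ q) {T : ℕ}
    (hT : T ≤ 3000 * (n * (m + n)) * (Nat.log 2 (n * n + n * n) + 1) +
      3000 * (k * (n * n)) * q * (Nat.log 2 (n * n + n * n) + 1)) :
    (T : ℝ) ≤ 48000 * q * ((m + n * Real.log n + k * n) * (n * Real.log n)) := by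
  have hlog := log_two_mul_sq_le hn
  set lg := Nat.log 2 (n * n + n * n) + 1
  have hl0 : 0 ≤ Real.log n := Real.log_natCast_nonneg n
  have hT' : T ≤ 6000 * q * ((m + k * n) * (n * lg)) := by
    have h1 : n * (m + n) * lg ≤ (m + k * n) * (n * lg) := by
      calc n * (m + n) * lg = (m + n) * (n * lg) := by ring
        _ ≤ _ := Nat.mul_le_mul_right _ (Nat.add_le_add_left (Nat.le_mul_of_pos_left _ hk) _)
    have h2 : k * (n * n) * lg ≤ (m + k * n) * (n * lg) := by
      calc k * (n * n) * lg = k * n * (n * lg) := by ring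
        _ ≤ _ := Nat.mul_le_mul_right _ (Nat.le_add_left _ _)
    have h3 : (m + k * n) * (n * lg) ≤ q * ((m + k * n) * (n * lg)) :=
      Nat.le_mul_of_pos_left _ hq
    have h4 := Nat.mul_le_mul_left q h2
    calc T ≤ 3000 * (n * (m + n) * lg) + 3000 * (q * (k * (n * n) * lg)) := by
          refine hT.trans (le_of_eq ?_)
          ring
      _ ≤ 6000 * (q * ((m + k * n) * (n * lg))) := by omega
      _ = _ := by ring
  calc (T : ℝ) ≤ 6000 * q * ((m + k * n) * (n * lg)) := by exact_mod_cast hT'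
    _ ≤ 6000 * q * ((m + n * Real.log n + k * n) * (n * (8 * Real.log n))) := by
        gcongr
        have : 0 ≤ n * Real.log n := by positivity
        linarith
    _ = _ := by ring

end Dilation

theorem mainTheorem3 (ε : ℝ) (hε : 0 < ε) :
    ∃ (prog : RealRAM.Cmd) (C : ℝ),
      ∀ (M : Type*) [MetricSpace M] (n m k : ℕ) (p : Fin n → M) (G : SimpleGraph (Fin n))
        (e : Fin m → Fin n × Fin n) (s : RealRAM.State),
        2 ≤ n → 1 ≤ k → k ≤ n * n → Function.Injective p → Dilation.ListsEdges G e →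
        Dilation.HoldsInput p e k s →
        ∃ (T : ℕ) (s' : RealRAM.State),
          RealRAM.Exec prog s T s' ∧
          (T : ℝ) ≤ C * ((m + n * Real.log n + k * n) * (n * Real.log n)) ∧
          Dilation.minDilation p G k ≤ Dilation.output s' ∧
          Dilation.output s' ≤
            ENNReal.ofReal ((1 + ε) * (k + 1)) * Dilation.minDilation p G k := by
  -- The program depends on `ε` only through the natural constant `q` with `1 / q ≤ ε`, as real
  -- constants are not available to it.
  obtain ⟨r, hr⟩ := exists_nat_one_div_lt hε
  set q := r + 1 with hq
  have hqε : 1 / (q : ℝ) ≤ ε := by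
    rw [hq]
    push_cast
    exact hr.le
  refine ⟨RealRAM.Cmd.seq Dilation.preprocess (Dilation.search q), 48000 * q, ?_⟩
  intro M _ n m k p G e s hn hk hkn hp he hs
  obtain ⟨T, s', hexec, hT, h1, h2⟩ :=
    RealRAM.Runs.seq (Dilation.preprocess_runs hp hn hkn he hs)
      (fun s₁ _ ⟨hprep, N, hc⟩ => Dilation.search_runs hp hn hk hkn (q := q) (by omega) hprep hc)
      le_rfl
  refine ⟨T, s', hexec, Dilation.run_time_le hn hk (by omega) hT, h1, h2.trans ?_⟩
  gcongr
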